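/- Let $G$ be a (finite-dimensional) complex Lie group with Lie algebra $\mathfrak g$, $U\subset G$ a connected closed complex Lie subgroup with Lie algebra $\mathfrak u$, and $p:G\to G/U$ the projection, where $G/U$ carries the complex structure for which $p$ is a holomorphic submersion. All multivector fields are holomorphic; $\bigwedge^k$ is identified with skew-symmetric tensors ($a\wedge b=a\otimes b-b\otimes a$), and $[\cdot,\cdot]$ is the Schouten bracket extending the Lie bracket of vector fields, so that $\frac12[\pi,\pi](df,dg,dh)=\{f,\{g,h\}\}+\{g,\{h,f\}\}+\{h,\{f,g\}\}$ with $\{f,g\}=\pi(df,dg)$. For a tensor $a$ over $\mathfrak g$ write $a^L$, $a^R$ for the corresponding left- and right-invariant tensor fields on $G$. For $r\in\mathfrak g\otimes\mathfrak g$ put $\mathrm{CYB}(r)=[r^{12},r^{13}]+[r^{12},r^{23}]+[r^{13},r^{23}]$. Let $\rho\in\mathfrak g\otimes\mathfrak g$ be such that $\Omega=\rho+\rho^{21}$ lies in $(S^2\mathfrak g)^{\mathfrak g}$; if $G$ is not connected, assume moreover that $\Omega$ is $\mathrm{Ad}(G)$-invariant, i.e. $\Omega^L=\Omega^R$. Put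 $\pi_\rho=\rho^L-\rho^R$ and $\varphi=-\mathrm{CYB}(\rho)$. A quasi-Poisson homogeneous $(G,\pi_\rho,\varphi)$-structure on $G/U$ is a bivector field $\pi$ on $G/U$ such that $\pi(gx)=(l_g)_*\pi(x)+(\rho_x)_*\pi_\rho(g)$ for all $g\in G$, $x\in G/U$ and $\frac12[\pi,\pi]=\varphi_{G/U}$, where $l_g(x)=\rho_x(g)=g\cdot x$ and $\varphi_{G/U}(x)=(\rho_x)_*\varphi$ is the trivector field induced by $\varphi$; $\mathbf{Homsp}(G,\pi_\rho,\varphi,U)$ is the set of all such structures. 1. Let $b\in(\mathfrak g\otimes\mathfrak g)^{\mathfrak u}$ satisfy $b+b^{21}=\Omega$. Then there is a well-defined field $\pi_b^\rho$ on $G/U$ with $\pi^\rho_b(p(g))=p_*(b^L(g)-\rho^R(g))$ for all $g\in G$, and $\pi_b^\rho$ is a quasi-Poisson homogeneous $(G,\pi_\rho,\varphi)$-structure on $G/U$ if and only if $\mathrm{CYB}(b)=0$ in $\bigwedge^3(\mathfrak g/\mathfrak u)$. 2. Let $\mathfrak m$ be a $\mathfrak u$-invariant complement of $\mathfrak u$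 in $\mathfrak g$, and let $\mathcal M_\Omega$ be the set of all $x\in\frac{\Omega}{2}+\left(\bigwedge^2\mathfrak m\right)^{\mathfrak u}$ such that $\mathrm{CYB}(x)=0$ in $\bigwedge^3(\mathfrak g/\mathfrak u)$. Then $b\mapsto\pi_b^\rho$ is a bijection from $\mathcal M_\Omega$ onto $\mathbf{Homsp}(G,\pi_\rho,\varphi,U)$. -/

import Mathlib

open scoped Manifold ContDiff TensorProduct Topology

noncomputable section

namespace QuasiPoisson

/-! ### Tensor algebra

Bivectors and trivectors on `V` are skew-symmetric tensors in `V ⊗ V` and `V ⊗ (V ⊗ V)`,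
with `a ∧ b = a ⊗ b - b ⊗ a`. -/

section Algebra

variable {V W : Type*} [AddCommGroup V] [Module ℂ V] [AddCommGroup W] [Module ℂ W]

/-- `t ↦ t²¹`, the exchange of the two tensor factors. -/
def flip (t : V ⊗[ℂ] V) : V ⊗[ℂ] V := TensorProduct.comm ℂ V V t

/-- The map `f ⊗ f`. -/
def map2 (f : V →ₗ[ℂ] W) : V ⊗[ℂ] V →ₗ[ℂ] W ⊗[ℂ] W := TensorProduct.map f f

/-- The map `f ⊗ f ⊗ f`. -/
def map3 (f : V →ₗ[ℂ] W) : V ⊗[ℂ] (V ⊗[ℂ] V) →ₗ[ℂ] W ⊗[ℂ] (W ⊗[ℂ] W) :=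
  TensorProduct.map f (TensorProduct.map f f)

/-- The value of a tensor of degree two on two covectors: `v ⊗ w ↦ ξ(v) η(w)`. -/
def pair2 (ξ η : V →ₗ[ℂ] ℂ) : V ⊗[ℂ] V →ₗ[ℂ] ℂ :=
  LinearMap.mul' ℂ ℂ ∘ₗ TensorProduct.map ξ η

/-- The value of a tensor of degree three on three covectors. -/
def pair3 (ξ η ζ : V →ₗ[ℂ] ℂ) : V ⊗[ℂ] (V ⊗[ℂ] V) →ₗ[ℂ] ℂ :=
  LinearMap.mul' ℂ ℂ ∘ₗ TensorProduct.map ξ (pair2 η ζ)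

/-- `∧² m` as a subspace of `V ⊗ V`, for a subspace `m` of `V`. -/
def wedge2 (m : Submodule ℂ V) : Submodule ℂ (V ⊗[ℂ] V) :=
  (LinearMap.ker ((TensorProduct.comm ℂ m m : m ⊗[ℂ] m →ₗ[ℂ] m ⊗[ℂ] m) +
    LinearMap.id)).map (map2 m.subtype)

variable {L : Type*} [LieRing L] [LieAlgebra ℂ L]

/-- The Lie bracket as a linear map `L ⊗ L → L`. -/
def bracketMap : L ⊗[ℂ] L →ₗ[ℂ] L := (LieModule.toModuleHom ℂ L L : L ⊗[ℂ] L →ₗ[ℂ] L)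

/-- `[r¹², s¹³]`; on pure tensors `(a ⊗ b, c ⊗ d) ↦ [a, c] ⊗ b ⊗ d`. -/
def br1213 (r s : L ⊗[ℂ] L) : L ⊗[ℂ] (L ⊗[ℂ] L) :=
  TensorProduct.map bracketMap LinearMap.id
    (TensorProduct.tensorTensorTensorComm ℂ L L L L (r ⊗ₜ[ℂ] s))

/-- `[r¹², s²³]`; on pure tensors `(a ⊗ b, c ⊗ d) ↦ a ⊗ [b, c] ⊗ d`. -/
def br1223 (r s : L ⊗[ℂ] L) : L ⊗[ℂ] (L ⊗[ℂ] L) :=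
  TensorProduct.map LinearMap.id
    (TensorProduct.map bracketMap LinearMap.id ∘ₗ (TensorProduct.assoc ℂ L L L).symm.toLinearMap)
    (TensorProduct.assoc ℂ L L (L ⊗[ℂ] L) (r ⊗ₜ[ℂ] s))

/-- `[r¹³, s²³]`; on pure tensors `(a ⊗ b, c ⊗ d) ↦ a ⊗ c ⊗ [b, d]`. -/
def br1323 (r s : L ⊗[ℂ] L) : L ⊗[ℂ] (L ⊗[ℂ] L) :=
  TensorProduct.assoc ℂ L L L (TensorProduct.map LinearMap.id bracketMap
    (TensorProduct.tensorTensorTensorComm ℂ L L L L (r ⊗ₜ[ℂ] s)))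

/-- `CYB(r) = [r¹², r¹³] + [r¹², r²³] + [r¹³, r²³]`. -/
def CYB (r : L ⊗[ℂ] L) : L ⊗[ℂ] (L ⊗[ℂ] L) := br1213 r r + br1223 r r + br1323 r r

/-- `CYB(r) = 0` in `∧³(L / u)`. -/
def CYBVanishesMod (u : Submodule ℂ L) (r : L ⊗[ℂ] L) : Prop := map3 u.mkQ (CYB r) = 0

/-- The tensor `t` is invariant under `u`, for the (diagonal) adjoint action. -/
def IsInvariant (u : Submodule ℂ L) (t : L ⊗[ℂ] L) : Prop := ∀ x ∈ u, ⁅x, t⁆ = 0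

/-- The variety `M_Ω`: all `x ∈ Ω/2 + (∧² m)^u` such that `CYB(x) = 0` in `∧³(L / u)`. -/
def MOmega (u m : Submodule ℂ L) (Ω : L ⊗[ℂ] L) : Set (L ⊗[ℂ] L) :=
  {x | (∃ B ∈ wedge2 m, IsInvariant u B ∧ x = (1 / 2 : ℂ) • Ω + B) ∧ CYBVanishesMod u x}

end Algebra

/-! ### Tensor fields on a complex manifold -/

section Fields

variable (F : Type*) [NormedAddCommGroup F] [NormedSpace ℂ F]
  {X : Type*} [TopologicalSpace X] [ChartedSpace F X]

/-- The differential `df` of a function at `x`, as a covector. -/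
def covector (f : X → ℂ) (x : X) : TangentSpace 𝓘(ℂ, F) x →ₗ[ℂ] ℂ :=
  (mfderiv 𝓘(ℂ, F) 𝓘(ℂ, ℂ) f x).toLinearMap

variable {F}

/-- The function `x ↦ π_x(df, dg)`. -/
def fieldBracket (π : (x : X) → TangentSpace 𝓘(ℂ, F) x ⊗[ℂ] TangentSpace 𝓘(ℂ, F) x)
    (f g : X → ℂ) (x : X) : ℂ :=
  pair2 (covector F f x) (covector F g x) (π x)

/-- A holomorphic bivector field: pointwise skew-symmetric, and `π(df, dg)` is holomorphic
wherever `f` and `g` are. -/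
structure IsBivectorField
    (π : (x : X) → TangentSpace 𝓘(ℂ, F) x ⊗[ℂ] TangentSpace 𝓘(ℂ, F) x) : Prop where
  skew : ∀ x, flip (π x) = -π x
  holomorphic : ∀ (x : X) (f g : X → ℂ), ContMDiffAt 𝓘(ℂ, F) 𝓘(ℂ, ℂ) ω f x →
    ContMDiffAt 𝓘(ℂ, F) 𝓘(ℂ, ℂ) ω g x → ContMDiffAt 𝓘(ℂ, F) 𝓘(ℂ, ℂ) ω (fieldBracket π f g) x

/-- The value `[P, Q](df, dg, dh)` at `x` of the Schouten bracket of two bivector fields, in the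
normalization that extends the Lie bracket of vector fields:
`[a ∧ b, c ∧ d] = [a, c] ∧ b ∧ d - [a, d] ∧ b ∧ c - [b, c] ∧ a ∧ d + [b, d] ∧ a ∧ c`. -/
def schouten (P Q : (x : X) → TangentSpace 𝓘(ℂ, F) x ⊗[ℂ] TangentSpace 𝓘(ℂ, F) x)
    (f g h : X → ℂ) (x : X) : ℂ :=
  fieldBracket P f (fieldBracket Q g h) x + fieldBracket Q f (fieldBracket P g h) x +
  (fieldBracket P g (fieldBracket Q h f) x + fieldBracket Q g (fieldBracket P h f) x) +
  (fieldBracket P h (fieldBracket Q f g) x + fieldBracket Q h (fieldBracket P f g) x)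

end Fields

/-! ### Quasi-Poisson homogeneous spaces of a complex Lie group -/

section Groups

variable {E : Type*} [NormedAddCommGroup E] [NormedSpace ℂ E]
  {G : Type*} [TopologicalSpace G] [ChartedSpace E G] [Group G]

/-- The differential at the identity of left multiplication by `g`. -/
def leftMulDeriv (g : G) : GroupLieAlgebra 𝓘(ℂ, E) G →L[ℂ] TangentSpace 𝓘(ℂ, E) g :=
  mfderiv 𝓘(ℂ, E) 𝓘(ℂ, E) (fun h : G => g * h) 1

/-- The differential at the identity of right multiplication by `g`. -/
def rightMulDeriv (g : G) : GroupLieAlgebra 𝓘(ℂ, E) G →L[ℂ] TangentSpace 𝓘(ℂ, E) g :=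
  mfderiv 𝓘(ℂ, E) 𝓘(ℂ, E) (fun h : G => h * g) 1

/-- The left-invariant tensor field on `G` with value `a` at the identity. -/
def leftInvariant (a : GroupLieAlgebra 𝓘(ℂ, E) G ⊗[ℂ] GroupLieAlgebra 𝓘(ℂ, E) G) (g : G) :
    TangentSpace 𝓘(ℂ, E) g ⊗[ℂ] TangentSpace 𝓘(ℂ, E) g :=
  map2 (leftMulDeriv g).toLinearMap a

/-- The right-invariant tensor field on `G` with value `a` at the identity. -/
def rightInvariant (a : GroupLieAlgebra 𝓘(ℂ, E) G ⊗[ℂ] GroupLieAlgebra 𝓘(ℂ, E) G) (g : G) :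
    TangentSpace 𝓘(ℂ, E) g ⊗[ℂ] TangentSpace 𝓘(ℂ, E) g :=
  map2 (rightMulDeriv g).toLinearMap a

/-- The field on `G` that is the left-invariant field of `b` minus the right-invariant field
of `ρ`. -/
def fieldOnGroup (ρ b : GroupLieAlgebra 𝓘(ℂ, E) G ⊗[ℂ] GroupLieAlgebra 𝓘(ℂ, E) G) (g : G) :
    TangentSpace 𝓘(ℂ, E) g ⊗[ℂ] TangentSpace 𝓘(ℂ, E) g :=
  leftInvariant b g - rightInvariant ρ g

variable (E) in
/-- The Lie algebra of a subgroup `U`: the tangent vectors at the identity to germs of holomorphic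
curves that lie in `U`. (For a closed complex Lie subgroup these vectors already form the
subspace `T_e U`.) -/
def lieAlgebraOf (U : Subgroup G) : Submodule ℂ (GroupLieAlgebra 𝓘(ℂ, E) G) :=
  Submodule.span ℂ {v | ∃ γ : ℂ → G, γ 0 = 1 ∧ (∀ᶠ t in 𝓝 (0 : ℂ), γ t ∈ U) ∧
    ContMDiffAt 𝓘(ℂ, ℂ) 𝓘(ℂ, E) ω γ 0 ∧
    HEq v (mfderiv 𝓘(ℂ, ℂ) 𝓘(ℂ, E) γ 0 (1 : ℂ))}

section Action

variable {F : Type*} [NormedAddCommGroup F] [NormedSpace ℂ F]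
  {X : Type*} [TopologicalSpace X] [ChartedSpace F X] [MulAction G X]

/-- The infinitesimal action `a ↦ d/dt (exp(ta) • x)` at `t = 0`. -/
def infinitesimalAction (x : X) : GroupLieAlgebra 𝓘(ℂ, E) G →L[ℂ] TangentSpace 𝓘(ℂ, F) x :=
  one_smul G x ▸ mfderiv 𝓘(ℂ, E) 𝓘(ℂ, F) (fun h : G => h • x) 1

/-- The trivector field on `X` induced by `φ`. -/
def inducedTrivector (φ : GroupLieAlgebra 𝓘(ℂ, E) G ⊗[ℂ]
      (GroupLieAlgebra 𝓘(ℂ, E) G ⊗[ℂ] GroupLieAlgebra 𝓘(ℂ, E) G)) (x : X) :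
    TangentSpace 𝓘(ℂ, F) x ⊗[ℂ] (TangentSpace 𝓘(ℂ, F) x ⊗[ℂ] TangentSpace 𝓘(ℂ, F) x) :=
  map3 (infinitesimalAction x).toLinearMap φ

/-- `(X, π)` is a quasi-Poisson homogeneous `(G, πG, φ)`-space. -/
structure IsQuasiPoissonHomogeneous [MulAction.IsPretransitive G X]
    (πG : (g : G) → TangentSpace 𝓘(ℂ, E) g ⊗[ℂ] TangentSpace 𝓘(ℂ, E) g)
    (φ : GroupLieAlgebra 𝓘(ℂ, E) G ⊗[ℂ]
      (GroupLieAlgebra 𝓘(ℂ, E) G ⊗[ℂ] GroupLieAlgebra 𝓘(ℂ, E) G))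
    (π : (x : X) → TangentSpace 𝓘(ℂ, F) x ⊗[ℂ] TangentSpace 𝓘(ℂ, F) x) : Prop where
  isBivectorField : IsBivectorField π
  /-- `π(g • x) = (l_g)_* π(x) + (ρ_x)_* πG(g)`. -/
  multiplicative : ∀ (g : G) (x : X), π (g • x) =
    map2 (mfderiv 𝓘(ℂ, F) 𝓘(ℂ, F) (fun y : X => g • y) x).toLinearMap (π x) +
    map2 (mfderiv 𝓘(ℂ, E) 𝓘(ℂ, F) (fun h : G => h • x) g).toLinearMap (πG g)
  /-- `½ [π, π] = φ_X`, evaluated on the differentials of holomorphic functions. -/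
  half_schouten : ∀ (x : X) (f g h : X → ℂ), ContMDiffAt 𝓘(ℂ, F) 𝓘(ℂ, ℂ) ω f x →
    ContMDiffAt 𝓘(ℂ, F) 𝓘(ℂ, ℂ) ω g x → ContMDiffAt 𝓘(ℂ, F) 𝓘(ℂ, ℂ) ω h x →
    (1 / 2 : ℂ) * schouten π π f g h x =
      pair3 (covector F f x) (covector F g x) (covector F h x) (inducedTrivector φ x)

end Action

section Quotient

variable (F : Type*) [NormedAddCommGroup F] [NormedSpace ℂ F]
  (U : Subgroup G) [ChartedSpace F (G ⧸ U)]

/-- The differential at `g` of the projection `p : G → G / U`. -/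
def projDeriv (g : G) :
    TangentSpace 𝓘(ℂ, E) g →L[ℂ] TangentSpace 𝓘(ℂ, F) (QuotientGroup.mk g : G ⧸ U) :=
  mfderiv 𝓘(ℂ, E) 𝓘(ℂ, F) (QuotientGroup.mk : G → G ⧸ U) g

/-- The field `π_b^ρ` on `G / U`: its value at `gU` is the image under the differential of
`p : G → G / U` of the value of `fieldOnGroup ρ b` at a representative of `gU`. -/
def quotientField (ρ b : GroupLieAlgebra 𝓘(ℂ, E) G ⊗[ℂ] GroupLieAlgebra 𝓘(ℂ, E) G)
    (x : G ⧸ U) : TangentSpace 𝓘(ℂ, F) x ⊗[ℂ] TangentSpace 𝓘(ℂ, F) x :=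
  QuotientGroup.out_eq' x ▸ map2 (projDeriv F U x.out).toLinearMap (fieldOnGroup ρ b x.out)

/-- `Homsp(G, πG, φ, U)`: all quasi-Poisson homogeneous `(G, πG, φ)`-structures on `G / U`. -/
def Homsp (πG : (g : G) → TangentSpace 𝓘(ℂ, E) g ⊗[ℂ] TangentSpace 𝓘(ℂ, E) g)
    (φ : GroupLieAlgebra 𝓘(ℂ, E) G ⊗[ℂ]
      (GroupLieAlgebra 𝓘(ℂ, E) G ⊗[ℂ] GroupLieAlgebra 𝓘(ℂ, E) G)) :
    Set ((x : G ⧸ U) → TangentSpace 𝓘(ℂ, F) x ⊗[ℂ] TangentSpace 𝓘(ℂ, F) x) :=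
  {π | IsQuasiPoissonHomogeneous πG φ π}

end Quotient

end Groups

end QuasiPoisson

end

/-! Pulled back to `G`, the bracket of functions defined by `π_b^ρ` is `b^L(df, dh) - ρ^R(df, dh)`,
so the Schouten condition becomes a computation with left and right derivatives on `G`. Its cyclic
sum has pure left, pure right and mixed terms. Left- and right-invariant fields commute, so a mixed
term contains only second derivatives. Since `b` and `ρ` need not be skew, the second-order terms do
not cancel within each type. However `b + b²¹ = Ω = ρ + ρ²¹` and `Ω^L = Ω^R`, so a sum symmetrized
over the factors of `b` equals the same sum over the factors of `ρ`, and this makes the pure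
second-order terms cancel the mixed ones (`TwoJet.sum_cyclic_iterBracket`).

What remains is the cyclic sum of `[b¹², b²³]` along left derivatives minus that of `[ρ¹², ρ²³]`
along right derivatives. By invariance of `Ω`, each cyclic sum is `CYB` minus `[Ω¹², Ω¹³]`, and the
two corrections agree by `Ad`-invariance. Hence `½[π, π] = p_*(CYB(b)^L) - p_*(CYB(ρ)^R)`
(`half_schouten_mk`). The second term is `φ_{G/U}`. The first is a translate of its value at the
base point, and `g/u` is the tangent space there because `ker dp = u` (`mapD_mk_eq_zero_iff`). So
the Schouten condition says exactly that `CYB(b)` vanishes modulo `u`.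

The field is well defined because `u`-invariance of `b` integrates to `Ad(U)`-invariance when `U` is
connected (`map2_Ad_eq_of_isInvariant`). Multiplicativity is the chain rule, and skewness is `Ω^L =
Ω^R` again.

For the bijection, multiplicativity determines `π` from `π(eU)`, and `p_*` identifies `∧² m` with
the bivectors at `eU`. This gives injectivity and a unique candidate `b = Ω/2 + B`. Consistency of
`π` along `U` makes `p_*(Ad_u b) = p_* b`. Differentiating at the identity gives `p_*[x, B] = 0` for
`x ∈ u`, and `[x, B] = 0` follows because `m` is `u`-stable. -/

noncomputable section

namespace QuasiPoisson

/-! ### Calculus on complex manifolds, with derivatives taking values in the model spaces. -/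

section Derivatives

variable (E : Type*) [NormedAddCommGroup E] [NormedSpace ℂ E]
  {M : Type*} [TopologicalSpace M] [ChartedSpace E M]
  {W : Type*} [NormedAddCommGroup W] [NormedSpace ℂ W]

/-- The differential of a vector valued function on a manifold, as a map on the model space. -/
def dAt (f : M → W) (x : M) : E →L[ℂ] W := mfderiv 𝓘(ℂ, E) 𝓘(ℂ, W) f x

variable {E}

theorem dAt_congr {f g : M → W} {x : M} (h : f =ᶠ[𝓝 x] g) : dAt E f x = dAt E g x :=
  h.mfderiv_eq

theorem dAt_const (c : W) (x : M) : dAt E (fun _ : M => c) x = 0 :=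
  mfderiv_const

theorem dAt_eq_fderiv {f : M → W} {x : M} (hf : MDifferentiableAt 𝓘(ℂ, E) 𝓘(ℂ, W) f x) :
    dAt E f x = fderiv ℂ (f ∘ (extChartAt 𝓘(ℂ, E) x).symm) (extChartAt 𝓘(ℂ, E) x x) := by
  refine hf.mfderiv.trans ?_
  rw [modelWithCornersSelf_coe, Set.range_id, fderivWithin_univ]
  rfl

theorem differentiableAt_comp_extChartAt_symm {f : M → W} {x : M}
    (hf : MDifferentiableAt 𝓘(ℂ, E) 𝓘(ℂ, W) f x) :
    DifferentiableAt ℂ (f ∘ (extChartAt 𝓘(ℂ, E) x).symm) (extChartAt 𝓘(ℂ, E) x x) := by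
  have h := hf.differentiableWithinAt_writtenInExtChartAt
  rw [modelWithCornersSelf_coe, Set.range_id, differentiableWithinAt_univ] at h
  exact h

theorem dAt_clm_apply {W' : Type*} [NormedAddCommGroup W'] [NormedSpace ℂ W']
    {A : M → W →L[ℂ] W'} {f : M → W} {x : M}
    (hA : MDifferentiableAt 𝓘(ℂ, E) 𝓘(ℂ, W →L[ℂ] W') A x)
    (hf : MDifferentiableAt 𝓘(ℂ, E) 𝓘(ℂ, W) f x) (v : E) :
    dAt E (fun y => A y (f y)) x v = A x (dAt E f x v) + dAt E A x v (f x) := by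
  rw [dAt_eq_fderiv (hA.clm_apply hf), dAt_eq_fderiv hA, dAt_eq_fderiv hf]
  have h := (differentiableAt_comp_extChartAt_symm hA).hasFDerivAt.clm_apply
    (differentiableAt_comp_extChartAt_symm hf).hasFDerivAt
  have h2 := DFunLike.congr_fun h.fderiv v
  simp only [Function.comp_apply, extChartAt_to_inv] at h2
  exact h2

theorem dAt_extChartAt [IsManifold 𝓘(ℂ, E) ω M] (x : M) :
    dAt E (extChartAt 𝓘(ℂ, E) x) x = ContinuousLinearMap.id ℂ E :=
  have : IsManifold 𝓘(ℂ, E) 1 M := IsManifold.of_le (n := ω) le_top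
  mfderiv_extChartAt_self

theorem dAt_add {f g : M → W} {x : M} (hf : MDifferentiableAt 𝓘(ℂ, E) 𝓘(ℂ, W) f x)
    (hg : MDifferentiableAt 𝓘(ℂ, E) 𝓘(ℂ, W) g x) :
    dAt E (fun y => f y + g y) x = dAt E f x + dAt E g x :=
  mfderiv_add hf hg

theorem dAt_sub {f g : M → W} {x : M} (hf : MDifferentiableAt 𝓘(ℂ, E) 𝓘(ℂ, W) f x)
    (hg : MDifferentiableAt 𝓘(ℂ, E) 𝓘(ℂ, W) g x) :
    dAt E (fun y => f y - g y) x = dAt E f x - dAt E g x :=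
  mfderiv_sub hf hg

theorem dAt_add_apply {f g : M → W} {x : M} (hf : MDifferentiableAt 𝓘(ℂ, E) 𝓘(ℂ, W) f x)
    (hg : MDifferentiableAt 𝓘(ℂ, E) 𝓘(ℂ, W) g x) (v : E) :
    dAt E (fun y => f y + g y) x v = dAt E f x v + dAt E g x v := by
  rw [dAt_add hf hg, add_apply]

theorem dAt_sub_apply {f g : M → W} {x : M} (hf : MDifferentiableAt 𝓘(ℂ, E) 𝓘(ℂ, W) f x)
    (hg : MDifferentiableAt 𝓘(ℂ, E) 𝓘(ℂ, W) g x) (v : E) :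
    dAt E (fun y => f y - g y) x v = dAt E f x v - dAt E g x v := by
  rw [dAt_sub hf hg, sub_apply]

theorem dAt_mul_apply {f g : M → ℂ} {x : M} (hf : MDifferentiableAt 𝓘(ℂ, E) 𝓘(ℂ, ℂ) f x)
    (hg : MDifferentiableAt 𝓘(ℂ, E) 𝓘(ℂ, ℂ) g x) (v : E) :
    dAt E (fun y => f y * g y) x v = dAt E f x v * g x + f x * dAt E g x v := by
  have h : dAt E (fun y => f y * g y) x = f x • dAt E g x + g x • dAt E f x :=
    (hf.hasMFDerivAt.mul hg.hasMFDerivAt).mfderiv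
  rw [h]
  simp only [add_apply, smul_apply, smul_eq_mul]
  ring

theorem mdifferentiableAt_sum {ι : Type*} (s : Finset ι) {f : ι → M → W} {x : M}
    (hf : ∀ i ∈ s, MDifferentiableAt 𝓘(ℂ, E) 𝓘(ℂ, W) (f i) x) :
    MDifferentiableAt 𝓘(ℂ, E) 𝓘(ℂ, W) (fun y => ∑ i ∈ s, f i y) x := by
  classical
  induction s using Finset.induction_on with
  | empty => simpa using mdifferentiableAt_const
  | insert a s ha ih =>
    simp only [Finset.sum_insert ha]
    exact (hf a (Finset.mem_insert_self a s)).add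
      (ih fun i hi => hf i (Finset.mem_insert_of_mem hi))

theorem dAt_sum_apply {ι : Type*} (s : Finset ι) {f : ι → M → W} {x : M}
    (hf : ∀ i ∈ s, MDifferentiableAt 𝓘(ℂ, E) 𝓘(ℂ, W) (f i) x) (v : E) :
    dAt E (fun y => ∑ i ∈ s, f i y) x v = ∑ i ∈ s, dAt E (f i) x v := by
  classical
  induction s using Finset.induction_on with
  | empty => simp [dAt_const]
  | insert a s ha ih =>
    have hs : ∀ i ∈ s, MDifferentiableAt 𝓘(ℂ, E) 𝓘(ℂ, W) (f i) x :=
      fun i hi => hf i (Finset.mem_insert_of_mem hi)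
    simp only [Finset.sum_insert ha]
    rw [dAt_add (hf a (Finset.mem_insert_self a s)) (mdifferentiableAt_sum s hs), add_apply, ih hs]

section Comp

variable {E' : Type*} [NormedAddCommGroup E'] [NormedSpace ℂ E']
  {N : Type*} [TopologicalSpace N] [ChartedSpace E' N]

theorem dAt_comp_apply {f : N → W} {c : M → N} {x : M}
    (hf : MDifferentiableAt 𝓘(ℂ, E') 𝓘(ℂ, W) f (c x))
    (hc : MDifferentiableAt 𝓘(ℂ, E) 𝓘(ℂ, E') c x) (v : E) :
    dAt E (fun y => f (c y)) x v =
      dAt E' f (c x) ((mfderiv 𝓘(ℂ, E) 𝓘(ℂ, E') c x : E →L[ℂ] E') v) := by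
  have h : dAt E (fun y => f (c y)) x =
      (dAt E' f (c x)).comp (mfderiv 𝓘(ℂ, E) 𝓘(ℂ, E') c x : E →L[ℂ] E') :=
    mfderiv_comp x hf hc
  rw [h]; rfl

theorem fderiv_comp_dAt {W' : Type*} [NormedAddCommGroup W'] [NormedSpace ℂ W']
    {f : W → W'} {c : M → W} {x : M}
    (hf : DifferentiableAt ℂ f (c x)) (hc : MDifferentiableAt 𝓘(ℂ, E) 𝓘(ℂ, W) c x) :
    dAt E (fun y => f (c y)) x = (fderiv ℂ f (c x)).comp (dAt E c x) := by
  ext v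
  have h1 : dAt W f (c x) = fderiv ℂ f (c x) := mfderiv_eq_fderiv
  have h := dAt_comp_apply (E := E) hf.mdifferentiableAt hc v
  rw [h1] at h
  exact h

theorem contMDiffAt_comp_extChartAt_symm [IsManifold 𝓘(ℂ, E) ω M] {f : M → W} {x : M}
    (hf : ContMDiffAt 𝓘(ℂ, E) 𝓘(ℂ, W) ω f x) :
    ContDiffAt ℂ ω (f ∘ (extChartAt 𝓘(ℂ, E) x).symm) (extChartAt 𝓘(ℂ, E) x x) := by
  rw [← contMDiffAt_iff_contDiffAt]
  refine ContMDiffAt.comp _ ?_ ((contMDiffOn_extChartAt_symm (n := ω) x).contMDiffAt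
      (extChartAt_target_mem_nhds x))
  rwa [extChartAt_to_inv]

theorem contMDiffAt_extChartAt_symm_self [IsManifold 𝓘(ℂ, E) ω M] (x : M) :
    ContMDiffAt 𝓘(ℂ, E) 𝓘(ℂ, E) ω (extChartAt 𝓘(ℂ, E) x).symm (extChartAt 𝓘(ℂ, E) x x) :=
  (contMDiffOn_extChartAt_symm (n := ω) x).contMDiffAt (extChartAt_target_mem_nhds x)

/-- Holomorphy at a point spreads to a neighbourhood, so every nearby slice is differentiable at
`x`. The coordinate formula therefore holds on a neighbourhood and can itself be differentiated in
`z`. -/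
theorem dAt_prodMk_eventuallyEq [IsManifold 𝓘(ℂ, E) ω M] [IsManifold 𝓘(ℂ, E') ω N]
    {f : N → M → W} {y : N} {x : M}
    (hf : ContMDiffAt (𝓘(ℂ, E').prod 𝓘(ℂ, E)) 𝓘(ℂ, W) ω (Function.uncurry f) (y, x)) :
    ∀ᶠ z in 𝓝 y, dAt E (f z) x =
      fderiv ℂ (f z ∘ (extChartAt 𝓘(ℂ, E) x).symm) (extChartAt 𝓘(ℂ, E) x x) := by
  have h1 : ∀ᶠ p in 𝓝 (y, x),
      ContMDiffAt (𝓘(ℂ, E').prod 𝓘(ℂ, E)) 𝓘(ℂ, W) ω (Function.uncurry f) p :=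
    (contMDiffAt_iff_contMDiffAt_nhds (by simp)).1 hf
  have h2 : Filter.Tendsto (fun z : N => (z, x)) (𝓝 y) (𝓝 (y, x)) :=
    Continuous.tendsto (by fun_prop) y
  filter_upwards [h2.eventually h1] with z hz
  refine dAt_eq_fderiv ?_
  have h3 : ContMDiffAt 𝓘(ℂ, E) 𝓘(ℂ, W) ω (fun t => Function.uncurry f (z, t)) x :=
    ContMDiffAt.comp (g := Function.uncurry f) (f := fun t => (z, t)) x hz
      (contMDiffAt_const.prodMk contMDiffAt_id)
  exact h3.mdifferentiableAt (by simp)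

/-- Partial derivatives of holomorphic functions are holomorphic. -/
theorem contMDiffAt_dAt [IsManifold 𝓘(ℂ, E) ω M] [IsManifold 𝓘(ℂ, E') ω N]
    {f : N → M → W} {y : N} {x : M}
    (hf : ContMDiffAt (𝓘(ℂ, E').prod 𝓘(ℂ, E)) 𝓘(ℂ, W) ω (Function.uncurry f) (y, x)) :
    ContMDiffAt 𝓘(ℂ, E') 𝓘(ℂ, E →L[ℂ] W) ω (fun z => dAt E (f z) x) y := by
  have : IsManifold 𝓘(ℂ, E') 1 N := IsManifold.of_le (n := ω) le_top
  -- Composing with the inverse chart makes the source a vector space, where tangent coordinates are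
  -- trivial and the smoothness of `mfderiv` in a parameter applies directly.
  let f' : N → E → W := fun z => f z ∘ (extChartAt 𝓘(ℂ, E) x).symm
  have hf' : ContMDiffAt (𝓘(ℂ, E').prod 𝓘(ℂ, E)) 𝓘(ℂ, W) ω (Function.uncurry f')
      (y, extChartAt 𝓘(ℂ, E) x x) := by
    refine ContMDiffAt.comp (g := Function.uncurry f)
      (f := fun p : N × E => (p.1, (extChartAt 𝓘(ℂ, E) x).symm p.2))
      (y, extChartAt 𝓘(ℂ, E) x x) (by simpa using hf) (contMDiffAt_fst.prodMk ?_)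
    exact ContMDiffAt.comp (g := (extChartAt 𝓘(ℂ, E) x).symm) (y, extChartAt 𝓘(ℂ, E) x x)
      (contMDiffAt_extChartAt_symm_self x) contMDiffAt_snd
  have h := ContMDiffAt.mfderiv (I := 𝓘(ℂ, E)) (I' := 𝓘(ℂ, W)) (J := 𝓘(ℂ, E')) f'
    (fun _ => extChartAt 𝓘(ℂ, E) x x) hf' contMDiffAt_const (m := ω) (by simp)
  have h' : ContMDiffAt 𝓘(ℂ, E') 𝓘(ℂ, E →L[ℂ] W) ω (fun z => dAt E (f' z)
      (extChartAt 𝓘(ℂ, E) x x)) y := by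
    refine h.congr_of_eventuallyEq (Filter.Eventually.of_forall fun z => ?_)
    exact (congrFun (inTangentCoordinates_model_space (I := 𝓘(ℂ, E)) (I' := 𝓘(ℂ, W))
      (fun _ : N => extChartAt 𝓘(ℂ, E) x x) (fun z => f' z (extChartAt 𝓘(ℂ, E) x x))
      (fun z => dAt E (f' z) (extChartAt 𝓘(ℂ, E) x x)) y) z).symm
  refine h'.congr_of_eventuallyEq ?_
  filter_upwards [dAt_prodMk_eventuallyEq hf] with z hz
  rw [hz]
  exact mfderiv_eq_fderiv.symm

/-- Each iterated partial derivative, here and in the primed version, is a value of the one second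
derivative of `f`, whose symmetry then exchanges the two orders. -/
theorem fderiv_fderiv_prodMk {f : E' × E → W} {p : E' × E} (hf : ContDiffAt ℂ ω f p)
    (a : E') (b : E) :
    fderiv ℂ (fun z => fderiv ℂ (fun t => f (z, t)) p.2 b) p.1 a =
      fderiv ℂ (fderiv ℂ f) p (a, 0) (0, b) := by
  have h1 : ∀ᶠ z in 𝓝 p.1, DifferentiableAt ℂ f (z, p.2) := by
    have h2 : Filter.Tendsto (fun z : E' => (z, p.2)) (𝓝 p.1) (𝓝 p) :=
      Continuous.tendsto (f := fun z : E' => (z, p.2)) (by fun_prop) p.1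
    filter_upwards [h2.eventually (hf.eventually (by simp))] with z hz
    exact hz.differentiableAt (by simp)
  have h2 : (fun z => fderiv ℂ (fun t => f (z, t)) p.2 b) =ᶠ[𝓝 p.1]
      fun z => fderiv ℂ f (z, p.2) (0, b) := by
    filter_upwards [h1] with z hz
    have h3 := hz.hasFDerivAt.comp p.2 (hasFDerivAt_prodMk_right z p.2)
    rw [show (fun t => f (z, t)) = f ∘ fun t => (z, t) from rfl, h3.fderiv]
    simp
  have h4 : DifferentiableAt ℂ (fderiv ℂ f) p :=
    (hf.fderiv_right (m := ω) (by simp)).differentiableAt (by simp)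
  have h5 : HasFDerivAt (fun z => fderiv ℂ f (z, p.2) (0, b)) _ p.1 :=
    ((h4.hasFDerivAt.comp (g := fderiv ℂ f) (f := fun z => (z, p.2)) p.1
      (hasFDerivAt_prodMk_left p.1 p.2)).clm_apply (hasFDerivAt_const _ _))
  rw [h2.fderiv_eq, h5.fderiv]
  simp

theorem fderiv_fderiv_prodMk' {f : E' × E → W} {p : E' × E} (hf : ContDiffAt ℂ ω f p)
    (a : E') (b : E) :
    fderiv ℂ (fun t => fderiv ℂ (fun z => f (z, t)) p.1 a) p.2 b =
      fderiv ℂ (fderiv ℂ f) p (0, b) (a, 0) := by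
  have h1 : ∀ᶠ z in 𝓝 p.2, DifferentiableAt ℂ f (p.1, z) := by
    have h2 : Filter.Tendsto (fun z : E => (p.1, z)) (𝓝 p.2) (𝓝 p) :=
      Continuous.tendsto (f := fun z : E => (p.1, z)) (by fun_prop) p.2
    filter_upwards [h2.eventually (hf.eventually (by simp))] with z hz
    exact hz.differentiableAt (by simp)
  have h2 : (fun t => fderiv ℂ (fun z => f (z, t)) p.1 a) =ᶠ[𝓝 p.2]
      fun t => fderiv ℂ f (p.1, t) (a, 0) := by
    filter_upwards [h1] with t ht
    have h3 := ht.hasFDerivAt.comp (f := fun z => (z, t)) p.1 (hasFDerivAt_prodMk_left p.1 t)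
    rw [show (fun z => f (z, t)) = f ∘ fun z => (z, t) from rfl, h3.fderiv]
    simp
  have h4 : DifferentiableAt ℂ (fderiv ℂ f) p :=
    (hf.fderiv_right (m := ω) (by simp)).differentiableAt (by simp)
  have h5 : HasFDerivAt (fun t => fderiv ℂ f (p.1, t) (a, 0)) _ p.2 :=
    ((h4.hasFDerivAt.comp (g := fderiv ℂ f) (f := fun t => (p.1, t)) p.2
      (hasFDerivAt_prodMk_right p.1 p.2)).clm_apply (hasFDerivAt_const _ _))
  rw [h2.fderiv_eq, h5.fderiv]
  simp

theorem contMDiffAt_uncurry_swap {f : N → M → W} {y : N} {x : M}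
    (hf : ContMDiffAt (𝓘(ℂ, E').prod 𝓘(ℂ, E)) 𝓘(ℂ, W) ω (Function.uncurry f) (y, x)) :
    ContMDiffAt (𝓘(ℂ, E).prod 𝓘(ℂ, E')) 𝓘(ℂ, W) ω
      (Function.uncurry fun t z => f z t) (x, y) :=
  ContMDiffAt.comp (g := Function.uncurry f) (f := Prod.swap) (x, y) hf
    (contMDiffAt_snd.prodMk contMDiffAt_fst)

theorem dAt_dAt_eq_fderiv [IsManifold 𝓘(ℂ, E) ω M] [IsManifold 𝓘(ℂ, E') ω N]
    {f : N → M → W} {y : N} {x : M}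
    (hf : ContMDiffAt (𝓘(ℂ, E').prod 𝓘(ℂ, E)) 𝓘(ℂ, W) ω (Function.uncurry f) (y, x))
    (a : E') (b : E) :
    dAt E' (fun z => dAt E (f z) x b) y a =
      fderiv ℂ (fun w => fderiv ℂ (fun t => f ((extChartAt 𝓘(ℂ, E') y).symm w)
        ((extChartAt 𝓘(ℂ, E) x).symm t)) (extChartAt 𝓘(ℂ, E) x x) b)
        (extChartAt 𝓘(ℂ, E') y y) a := by
  have hd : MDifferentiableAt 𝓘(ℂ, E') 𝓘(ℂ, W) (fun z => dAt E (f z) x b) y :=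
    ((contMDiffAt_dAt hf).clm_apply contMDiffAt_const).mdifferentiableAt (by simp)
  rw [dAt_eq_fderiv hd]
  congr 1
  refine Filter.EventuallyEq.fderiv_eq ?_
  have ht : Filter.Tendsto (extChartAt 𝓘(ℂ, E') y).symm (𝓝 (extChartAt 𝓘(ℂ, E') y y)) (𝓝 y) := by
    have := (continuousAt_extChartAt_symm (I := 𝓘(ℂ, E')) y).tendsto
    rwa [extChartAt_to_inv] at this
  filter_upwards [ht.eventually (dAt_prodMk_eventuallyEq hf)] with w hw
  simp only [Function.comp_apply, hw]
  rfl

/-- Mixed partial derivatives commute. -/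
theorem dAt_dAt_comm [IsManifold 𝓘(ℂ, E) ω M] [IsManifold 𝓘(ℂ, E') ω N]
    {f : N → M → W} {y : N} {x : M}
    (hf : ContMDiffAt (𝓘(ℂ, E').prod 𝓘(ℂ, E)) 𝓘(ℂ, W) ω (Function.uncurry f) (y, x))
    (a : E') (b : E) :
    dAt E' (fun z => dAt E (f z) x b) y a = dAt E (fun t => dAt E' (fun z => f z t) y a) x b := by
  rw [dAt_dAt_eq_fderiv hf, dAt_dAt_eq_fderiv (contMDiffAt_uncurry_swap hf)]
  let ψ : E' × E → W := fun p =>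
    f ((extChartAt 𝓘(ℂ, E') y).symm p.1) ((extChartAt 𝓘(ℂ, E) x).symm p.2)
  have hψ : ContDiffAt ℂ ω ψ (extChartAt 𝓘(ℂ, E') y y, extChartAt 𝓘(ℂ, E) x x) := by
    rw [← contMDiffAt_iff_contDiffAt]
    refine ContMDiffAt.comp (I' := 𝓘(ℂ, E').prod 𝓘(ℂ, E)) (g := Function.uncurry f)
      (f := fun p : E' × E => ((extChartAt 𝓘(ℂ, E') y).symm p.1, (extChartAt 𝓘(ℂ, E) x).symm p.2))
      (extChartAt 𝓘(ℂ, E') y y, extChartAt 𝓘(ℂ, E) x x) (by simpa using hf)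
      (ContMDiffAt.prodMk ?_ ?_)
    · exact ContMDiffAt.comp (g := (extChartAt 𝓘(ℂ, E') y).symm)
        (extChartAt 𝓘(ℂ, E') y y, extChartAt 𝓘(ℂ, E) x x)
        (contMDiffAt_extChartAt_symm_self y) contDiffAt_fst.contMDiffAt
    · exact ContMDiffAt.comp (g := (extChartAt 𝓘(ℂ, E) x).symm)
        (extChartAt 𝓘(ℂ, E') y y, extChartAt 𝓘(ℂ, E) x x)
        (contMDiffAt_extChartAt_symm_self x) contDiffAt_snd.contMDiffAt
  have hs : IsSymmSndFDerivAt ℂ ψ (extChartAt 𝓘(ℂ, E') y y, extChartAt 𝓘(ℂ, E) x x) :=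
    hψ.isSymmSndFDerivAt (by simp)
  exact (fderiv_fderiv_prodMk hψ a b).trans
    ((hs.eq _ _).trans (fderiv_fderiv_prodMk' hψ a b).symm)

end Comp

theorem fderiv_line {f : E → W} {x : E}
    (hf : DifferentiableAt ℂ f x) (v : E) :
    fderiv ℂ (fun t : ℂ => f (x + t • v)) 0 1 = fderiv ℂ f x v := by
  have h1 : HasFDerivAt (fun t : ℂ => x + t • v)
      ((ContinuousLinearMap.id ℂ ℂ).smulRight v) 0 :=
    ((hasFDerivAt_id (𝕜 := ℂ) (0 : ℂ)).smul_const v).const_add x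
  have h2 : HasFDerivAt f (fderiv ℂ f x) (x + (0 : ℂ) • v) := by simpa using hf.hasFDerivAt
  have h3 : HasFDerivAt (fun t : ℂ => f (x + t • v)) _ 0 := h2.comp (0 : ℂ) h1
  rw [h3.fderiv]
  simp

/-- The curve through `x` that is a straight line with direction `v` in the chart at `x`. -/
def chartLine (x : M) (v : E) (t : ℂ) : M :=
  (extChartAt 𝓘(ℂ, E) x).symm (extChartAt 𝓘(ℂ, E) x x + t • v)

theorem chartLine_zero (x : M) (v : E) : chartLine x v 0 = x := by
  rw [chartLine, zero_smul, add_zero, extChartAt_to_inv]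

theorem contMDiffAt_chartLine [IsManifold 𝓘(ℂ, E) ω M] (x : M) (v : E) :
    ContMDiffAt 𝓘(ℂ, ℂ) 𝓘(ℂ, E) ω (chartLine x v) 0 := by
  refine ContMDiffAt.comp (I' := 𝓘(ℂ, E)) (g := (extChartAt 𝓘(ℂ, E) x).symm)
    (f := fun t : ℂ => extChartAt 𝓘(ℂ, E) x x + t • v) 0 ?_ ?_
  · rw [zero_smul, add_zero]
    exact contMDiffAt_extChartAt_symm_self x
  · exact (contDiff_const.add (contDiff_id.smul contDiff_const)).contMDiff.contMDiffAt

/-- Lines in a chart take the place of one-parameter subgroups: they realize every tangent vector as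
a velocity. -/
theorem dAt_comp_chartLine {f : M → W} {x : M}
    (hf : MDifferentiableAt 𝓘(ℂ, E) 𝓘(ℂ, W) f x) (v : E) :
    dAt ℂ (fun t => f (chartLine x v t)) 0 1 = dAt E f x v := by
  rw [dAt_eq_fderiv hf, ← fderiv_line (differentiableAt_comp_extChartAt_symm hf) v]
  have h : dAt ℂ (fun t => f (chartLine x v t)) 0 = fderiv ℂ (fun t => f (chartLine x v t)) 0 :=
    mfderiv_eq_fderiv
  rw [h]
  rfl

end Derivatives

/-! ### Derivatives along invariant vector fields, and the Lie bracket. -/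

section InvariantDerivatives

variable (E : Type*) [NormedAddCommGroup E] [NormedSpace ℂ E]
  {G : Type*} [TopologicalSpace G] [ChartedSpace E G] [Group G]
  {W : Type*} [NormedAddCommGroup W] [NormedSpace ℂ W]

/-- `leftD E f g a` is the value at `g` of the derivative of `f` along the left-invariant vector
field of `a`. -/
def leftD (f : G → W) (g : G) : GroupLieAlgebra 𝓘(ℂ, E) G →L[ℂ] W := dAt E (fun y => f (g * y)) 1

/-- `rightD E f g a` is the value at `g` of the derivative of `f` along the right-invariant vector
field of `a`. -/
def rightD (f : G → W) (g : G) : GroupLieAlgebra 𝓘(ℂ, E) G →L[ℂ] W := dAt E (fun y => f (y * g)) 1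

variable {E}

theorem leftD_one (f : G → W) : leftD E f 1 = dAt E f 1 := by
  simp only [leftD, one_mul]; rfl

theorem rightD_one (f : G → W) : rightD E f 1 = dAt E f 1 := by
  simp only [rightD, mul_one]; rfl

theorem leftD_mul (f : G → W) (g h : G) : leftD E f (g * h) = leftD E (fun y => f (g * y)) h := by
  simp only [leftD, mul_assoc]; rfl

theorem rightD_mul (f : G → W) (g h : G) :
    rightD E f (h * g) = rightD E (fun y => f (y * g)) h := by
  simp only [rightD, mul_assoc]; rfl

variable [LieGroup 𝓘(ℂ, E) ω G]

variable (E) in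
theorem contMDiff_mul_left' (g : G) : ContMDiff 𝓘(ℂ, E) 𝓘(ℂ, E) ω (fun y : G => g * y) :=
  contMDiff_mul_left

variable (E) in
theorem contMDiff_mul_right' (g : G) : ContMDiff 𝓘(ℂ, E) 𝓘(ℂ, E) ω (fun y : G => y * g) :=
  contMDiff_mul_right

variable (E) in
theorem contMDiff_conj (g : G) : ContMDiff 𝓘(ℂ, E) 𝓘(ℂ, E) ω (fun y : G => g * y * g⁻¹) :=
  (contMDiff_mul_right' E g⁻¹).comp (contMDiff_mul_left' E g)

theorem leftD_apply {f : G → W} {g : G} (hf : MDifferentiableAt 𝓘(ℂ, E) 𝓘(ℂ, W) f g)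
    (a : GroupLieAlgebra 𝓘(ℂ, E) G) : leftD E f g a = dAt E f g (leftMulDeriv g a) := by
  have h := dAt_comp_apply (E := E) (E' := E) (f := f) (c := fun y : G => g * y) (x := 1)
    (by simpa using hf) ((contMDiff_mul_left' E g).mdifferentiableAt (by simp)) a
  simp only [mul_one] at h
  exact h

theorem contMDiffAt_comp_mul {f : G → W} {g h : G} (hf : ContMDiffAt 𝓘(ℂ, E) 𝓘(ℂ, W) ω f (g * h)) :
    ContMDiffAt (𝓘(ℂ, E).prod 𝓘(ℂ, E)) 𝓘(ℂ, W) ω (Function.uncurry fun x y : G => f (x * y))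
      (g, h) :=
  ContMDiffAt.comp (g := f) (f := fun p : G × G => p.1 * p.2) (g, h) hf
    (contMDiffAt_fst.mul contMDiffAt_snd)

theorem contMDiffAt_leftD {f : G → W} {g : G} (hf : ContMDiffAt 𝓘(ℂ, E) 𝓘(ℂ, W) ω f g)
    (a : GroupLieAlgebra 𝓘(ℂ, E) G) :
    ContMDiffAt 𝓘(ℂ, E) 𝓘(ℂ, W) ω (fun h => leftD E f h a) g := by
  have h : ContMDiffAt (𝓘(ℂ, E).prod 𝓘(ℂ, E)) 𝓘(ℂ, W) ω
      (Function.uncurry fun x y : G => f (x * y)) (g, 1) := contMDiffAt_comp_mul (by simpa using hf)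
  have h2 : ∀ a : E, ContMDiffAt 𝓘(ℂ, E) 𝓘(ℂ, W) ω (fun x => dAt E (fun y => f (x * y)) 1 a) g :=
    fun a => (contMDiffAt_dAt h).clm_apply contMDiffAt_const
  exact h2 a

theorem contMDiffAt_rightD {f : G → W} {g : G} (hf : ContMDiffAt 𝓘(ℂ, E) 𝓘(ℂ, W) ω f g)
    (a : GroupLieAlgebra 𝓘(ℂ, E) G) :
    ContMDiffAt 𝓘(ℂ, E) 𝓘(ℂ, W) ω (fun h => rightD E f h a) g := by
  have h : ContMDiffAt (𝓘(ℂ, E).prod 𝓘(ℂ, E)) 𝓘(ℂ, W) ω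
      (Function.uncurry fun x y : G => f (x * y)) (1, g) := contMDiffAt_comp_mul (by simpa using hf)
  have h2 : ∀ a : E, ContMDiffAt 𝓘(ℂ, E) 𝓘(ℂ, W) ω (fun x => dAt E (fun y => f (y * x)) 1 a) g :=
    fun a => (contMDiffAt_dAt (contMDiffAt_uncurry_swap h)).clm_apply contMDiffAt_const
  exact h2 a

/-- Left-invariant and right-invariant vector fields commute. -/
theorem leftD_rightD_comm {f : G → W} {g : G} (hf : ContMDiffAt 𝓘(ℂ, E) 𝓘(ℂ, W) ω f g)
    (a b : GroupLieAlgebra 𝓘(ℂ, E) G) :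
    leftD E (fun h => rightD E f h b) g a = rightD E (fun h => leftD E f h a) g b := by
  -- The two derivatives are the partial derivatives at `(1, 1)` of `(x, y) ↦ f(y g x)`, because
  -- left and right multiplication commute.
  have h : ContMDiffAt (𝓘(ℂ, E).prod 𝓘(ℂ, E)) 𝓘(ℂ, W) ω
      (Function.uncurry fun x y : G => f (y * g * x)) (1, 1) := by
    refine ContMDiffAt.comp (g := f) (f := fun p : G × G => p.2 * g * p.1) (1, 1)
      (by simpa using hf) ((contMDiffAt_snd.mul contMDiffAt_const).mul contMDiffAt_fst)
  have h2 := dAt_dAt_comm h a b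
  simp only [leftD, rightD]
  simp only [← mul_assoc]
  exact h2

theorem eventually_contMDiffAt {M : Type*} [TopologicalSpace M] [ChartedSpace E M]
    [IsManifold 𝓘(ℂ, E) ω M] {f : M → W} {x : M} (hf : ContMDiffAt 𝓘(ℂ, E) 𝓘(ℂ, W) ω f x) :
    ∀ᶠ y in 𝓝 x, ContMDiffAt 𝓘(ℂ, E) 𝓘(ℂ, W) ω f y :=
  (contMDiffAt_iff_contMDiffAt_nhds (by simp)).1 hf

theorem leftD_congr {f f' : G → W} {g : G} (h : f =ᶠ[𝓝 g] f') : leftD E f g = leftD E f' g := by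
  refine dAt_congr (E := E) ?_
  have h1 : Filter.Tendsto (fun y : G => g * y) (𝓝 1) (𝓝 g) := by
    simpa using ((contMDiff_mul_left' E g).continuous.tendsto 1)
  exact h1.eventually h

theorem rightD_congr {f f' : G → W} {g : G} (h : f =ᶠ[𝓝 g] f') : rightD E f g = rightD E f' g := by
  refine dAt_congr (E := E) ?_
  have h1 : Filter.Tendsto (fun y : G => y * g) (𝓝 1) (𝓝 g) := by
    simpa using ((contMDiff_mul_right' E g).continuous.tendsto 1)
  exact h1.eventually h

/-- The coordinate expression of a vector field is the derivative of the chart along it. This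
translates the pullbacks in the definition of the bracket into iterated `leftD`. -/
theorem mpullbackWithin_chart_eventuallyEq (a : GroupLieAlgebra 𝓘(ℂ, E) G) :
    ∀ᶠ z in 𝓝 (extChartAt 𝓘(ℂ, E) (1 : G) 1),
      (VectorField.mpullbackWithin 𝓘(ℂ, E) 𝓘(ℂ, E) (extChartAt 𝓘(ℂ, E) (1 : G)).symm
        (mulInvariantVectorField a) (Set.range 𝓘(ℂ, E)) z : E) =
      leftD E (extChartAt 𝓘(ℂ, E) (1 : G)) ((extChartAt 𝓘(ℂ, E) (1 : G)).symm z) a := by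
  have : IsManifold 𝓘(ℂ, E) 1 G := IsManifold.of_le (n := ω) le_top
  filter_upwards [extChartAt_target_mem_nhds (I := 𝓘(ℂ, E)) (1 : G)] with z hz
  have h1 := mfderiv_extChartAt_comp_mfderivWithin_extChartAt_symm hz
  have h2 := mfderivWithin_extChartAt_symm_comp_mfderiv_extChartAt hz
  have h3 : (mfderivWithin 𝓘(ℂ, E) 𝓘(ℂ, E) (extChartAt 𝓘(ℂ, E) (1 : G)).symm
      (Set.range 𝓘(ℂ, E)) z).inverse = mfderiv 𝓘(ℂ, E) 𝓘(ℂ, E) (extChartAt 𝓘(ℂ, E) (1 : G))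
      ((extChartAt 𝓘(ℂ, E) (1 : G)).symm z) := ContinuousLinearMap.inverse_eq h2 h1
  rw [VectorField.mpullbackWithin_apply, h3, leftD_apply]
  · rfl
  · refine mdifferentiableAt_extChartAt ?_
    rw [← extChartAt_source 𝓘(ℂ, E)]
    exact (extChartAt 𝓘(ℂ, E) (1 : G)).map_target hz

theorem fderiv_mpullbackWithin (a b : GroupLieAlgebra 𝓘(ℂ, E) G) :
    fderiv ℂ (VectorField.mpullbackWithin 𝓘(ℂ, E) 𝓘(ℂ, E) (extChartAt 𝓘(ℂ, E) (1 : G)).symm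
        (mulInvariantVectorField a) (Set.range 𝓘(ℂ, E)) : E → E)
        (extChartAt 𝓘(ℂ, E) (1 : G) 1) (b : E) =
      leftD E (fun h => leftD E (extChartAt 𝓘(ℂ, E) (1 : G)) h a) 1 b := by
  have h := (mpullbackWithin_chart_eventuallyEq a)
  have h1 : ContMDiffAt 𝓘(ℂ, E) 𝓘(ℂ, E) ω (fun h => leftD E (extChartAt 𝓘(ℂ, E) (1 : G)) h a) 1 :=
    contMDiffAt_leftD contMDiffAt_extChartAt a
  rw [Filter.EventuallyEq.fderiv_eq h, leftD_one, dAt_eq_fderiv (h1.mdifferentiableAt (by simp))]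
  rfl

/-- The case of the coordinate function. The chart at `1` has identity differential there, so the
bracket is the coordinate formula `DV'(V) - DV(V')` for the two left-invariant fields. -/
theorem leftD_chart_bracket (a b : GroupLieAlgebra 𝓘(ℂ, E) G) :
    leftD E (extChartAt 𝓘(ℂ, E) (1 : G)) 1 ⁅a, b⁆ =
      leftD E (fun h => leftD E (extChartAt 𝓘(ℂ, E) (1 : G)) h b) 1 a -
      leftD E (fun h => leftD E (extChartAt 𝓘(ℂ, E) (1 : G)) h a) 1 b := by
  have : IsManifold 𝓘(ℂ, E) 1 G := IsManifold.of_le (n := ω) le_top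
  rw [leftD_one, dAt_extChartAt, ← fderiv_mpullbackWithin, ← fderiv_mpullbackWithin,
    GroupLieAlgebra.bracket_def, ← VectorField.mlieBracketWithin_univ,
    VectorField.mlieBracketWithin_apply, mfderiv_extChartAt_self]
  erw [ContinuousLinearMap.inverse_id]
  rw [Set.preimage_univ, Set.univ_inter]
  have ha := (mpullbackWithin_chart_eventuallyEq a).self_of_nhds
  have hb := (mpullbackWithin_chart_eventuallyEq b).self_of_nhds
  rw [extChartAt_to_inv, leftD_one, dAt_extChartAt] at ha hb
  rw [modelWithCornersSelf_coe, Set.range_id] at ha hb ⊢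
  set V := VectorField.mpullbackWithin 𝓘(ℂ, E) 𝓘(ℂ, E) (extChartAt 𝓘(ℂ, E) (1 : G)).symm
    (mulInvariantVectorField a) Set.univ
  set V' := VectorField.mpullbackWithin 𝓘(ℂ, E) 𝓘(ℂ, E) (extChartAt 𝓘(ℂ, E) (1 : G)).symm
    (mulInvariantVectorField b) Set.univ
  have h := congrFun (VectorField.lieBracketWithin_univ (𝕜 := ℂ) (V := (V : E → E))
    (W := (V' : E → E))) (extChartAt 𝓘(ℂ, E) (1 : G) 1)
  refine h.trans ?_
  refine (VectorField.lieBracket_eq (𝕜 := ℂ) (V := (V : E → E)) (W := (V' : E → E)) ▸ rfl :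
    VectorField.lieBracket ℂ (V : E → E) (V' : E → E) (extChartAt 𝓘(ℂ, E) (1 : G) 1) =
      fderiv ℂ (V' : E → E) (extChartAt 𝓘(ℂ, E) (1 : G) 1) (V (extChartAt 𝓘(ℂ, E) (1 : G) 1)) -
      fderiv ℂ (V : E → E) (extChartAt 𝓘(ℂ, E) (1 : G) 1)
        (V' (extChartAt 𝓘(ℂ, E) (1 : G) 1))).trans ?_
  exact congrArg₂ (· - ·) (congrArg (fderiv ℂ (V' : E → E) (extChartAt 𝓘(ℂ, E) (1 : G) 1)) ha)
    (congrArg (fderiv ℂ (V : E → E) (extChartAt 𝓘(ℂ, E) (1 : G) 1)) hb)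

/-- Near `1` write `f = F ∘ φ` with `φ` the chart. By the chain rule a second left derivative is a
`D²F` term plus `DF` of the second derivative of `φ`. The `D²F` terms cancel by symmetry, which
leaves the coordinate case. -/
theorem leftD_bracket_one {f : G → W} (hf : ContMDiffAt 𝓘(ℂ, E) 𝓘(ℂ, W) ω f 1)
    (a b : GroupLieAlgebra 𝓘(ℂ, E) G) :
    leftD E f 1 ⁅a, b⁆ =
      leftD E (fun h => leftD E f h b) 1 a - leftD E (fun h => leftD E f h a) 1 b := by
  set φ := extChartAt 𝓘(ℂ, E) (1 : G) with hφ
  let F : E → W := f ∘ φ.symm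
  have hF : ContDiffAt ℂ ω F (φ 1) := contMDiffAt_comp_extChartAt_symm hf
  have hφ1 : ContMDiffAt 𝓘(ℂ, E) 𝓘(ℂ, E) ω φ 1 := contMDiffAt_extChartAt
  have h1 : ∀ᶠ h in 𝓝 (1 : G), f h = F (φ h) := by
    filter_upwards [extChartAt_source_mem_nhds (I := 𝓘(ℂ, E)) (1 : G)] with h hh
    simp [F, φ.left_inv hh]
  have h2 : ∀ c : GroupLieAlgebra 𝓘(ℂ, E) G, (fun h => leftD E f h c) =ᶠ[𝓝 1]
      fun h => fderiv ℂ F (φ h) (leftD E φ h c) := by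
    intro c
    filter_upwards [h1.eventually_nhds, eventually_contMDiffAt hφ1,
      hφ1.continuousAt.tendsto.eventually (hF.eventually (by simp))] with h hh hh' hF'
    rw [leftD_congr hh]
    have h3 := fderiv_comp_dAt (E := E) (f := F) (c := fun y => φ (h * y)) (x := 1)
      (by simpa using hF'.differentiableAt (by simp)) ?_
    · have h4 := DFunLike.congr_fun h3 c
      simp only [mul_one] at h4
      exact h4
    · refine ContMDiffAt.mdifferentiableAt (n := ω) ?_ (by simp)
      exact ContMDiffAt.comp (g := φ) (f := fun y => h * y) 1 (by simpa using hh')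
        (contMDiff_mul_left' E h 1)
  have h5 : ∀ c d : GroupLieAlgebra 𝓘(ℂ, E) G, leftD E (fun h => leftD E f h c) 1 d =
      fderiv ℂ (fderiv ℂ F) (φ 1) (d : E) (c : E) +
        fderiv ℂ F (φ 1) (leftD E (fun h => leftD E φ h c) 1 d) := by
    intro c d
    have hd : MDifferentiableAt 𝓘(ℂ, E) 𝓘(ℂ, E →L[ℂ] W) (fun h => fderiv ℂ F (φ h)) 1 := by
      refine ContMDiffAt.mdifferentiableAt (n := ω) ?_ (by simp)
      exact ContMDiffAt.comp (g := fderiv ℂ F) (f := φ) 1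
        (hF.fderiv_right (m := ω) (by simp)).contMDiffAt hφ1
    have hl : MDifferentiableAt 𝓘(ℂ, E) 𝓘(ℂ, E) (fun h => leftD E φ h c) 1 :=
      (contMDiffAt_leftD hφ1 c).mdifferentiableAt (by simp)
    rw [leftD_congr (h2 c), leftD_one]
    have h6 := dAt_clm_apply (E := E) hd hl d
    have h7 := fderiv_comp_dAt (E := E) (f := fderiv ℂ F) (c := φ) (x := 1)
      ((hF.fderiv_right (m := ω) (by simp)).differentiableAt (by simp))
      (hφ1.mdifferentiableAt (by simp))
    rw [dAt_extChartAt, ContinuousLinearMap.comp_id] at h7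
    rw [h7, leftD_one φ, dAt_extChartAt] at h6
    rw [leftD_one (fun h => leftD E φ h c), add_comm]
    exact h6
  have hs : IsSymmSndFDerivAt ℂ F (φ 1) := hF.isSymmSndFDerivAt (by simp)
  have h6 : leftD E f 1 ⁅a, b⁆ = fderiv ℂ F (φ 1) (leftD E φ 1 ⁅a, b⁆) :=
    (h2 ⁅a, b⁆).self_of_nhds
  rw [h6, h5, h5, leftD_chart_bracket, map_sub]
  have h7 := hs.eq (a : E) (b : E)
  rw [h7]
  abel

theorem leftD_bracket {f : G → W} {g : G} (hf : ContMDiffAt 𝓘(ℂ, E) 𝓘(ℂ, W) ω f g)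
    (a b : GroupLieAlgebra 𝓘(ℂ, E) G) :
    leftD E f g ⁅a, b⁆ =
      leftD E (fun h => leftD E f h b) g a - leftD E (fun h => leftD E f h a) g b := by
  have h1 : ContMDiffAt 𝓘(ℂ, E) 𝓘(ℂ, W) ω (fun y => f (g * y)) 1 :=
    ContMDiffAt.comp (g := f) (f := fun y => g * y) 1 (by simpa using hf)
      (contMDiff_mul_left' E g 1)
  have h2 := leftD_bracket_one h1 a b
  simp only [← leftD_mul] at h2
  rw [leftD_mul] at h2
  rw [← mul_one g, leftD_mul, leftD_mul, leftD_mul]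
  exact h2

/-- Iterated right derivatives at `g` are iterated left derivatives at `1` of `y ↦ f(y g)` taken in
the opposite order: both are mixed partials of `f(x y g)`. This reversal produces the sign. -/
theorem rightD_bracket {f : G → W} {g : G} (hf : ContMDiffAt 𝓘(ℂ, E) 𝓘(ℂ, W) ω f g)
    (a b : GroupLieAlgebra 𝓘(ℂ, E) G) :
    rightD E f g ⁅a, b⁆ =
      rightD E (fun h => rightD E f h a) g b - rightD E (fun h => rightD E f h b) g a := by
  have h1 : ContMDiffAt 𝓘(ℂ, E) 𝓘(ℂ, W) ω (fun y => f (y * g)) 1 :=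
    ContMDiffAt.comp (g := f) (f := fun y => y * g) 1 (by simpa using hf)
      (contMDiff_mul_right' E g 1)
  have h2 := leftD_bracket_one h1 a b
  have h3 : ∀ c d : GroupLieAlgebra 𝓘(ℂ, E) G, rightD E (fun h => rightD E f h c) g d =
      leftD E (fun h => leftD E (fun y => f (y * g)) h d) 1 c := by
    intro c d
    have h4 : ContMDiffAt (𝓘(ℂ, E).prod 𝓘(ℂ, E)) 𝓘(ℂ, W) ω
        (Function.uncurry fun x y : G => f (y * x * g)) (1, 1) := by
      refine ContMDiffAt.comp (g := f) (f := fun p : G × G => p.2 * p.1 * g) (1, 1)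
        (by simpa using hf) ((contMDiffAt_snd.mul contMDiffAt_fst).mul contMDiffAt_const)
    have h5 := dAt_dAt_comm h4 d c
    simp only [leftD, rightD, one_mul]
    simp only [← mul_assoc]
    exact h5
  rw [h3, h3, ← h2, leftD_one, ← rightD_one, ← rightD_mul, one_mul]

end InvariantDerivatives

/-! ### The adjoint action and its derivative. -/

section Adjoint

variable {E : Type*} [NormedAddCommGroup E] [NormedSpace ℂ E]
  {G : Type*} [TopologicalSpace G] [ChartedSpace E G] [Group G]
  {W : Type*} [NormedAddCommGroup W] [NormedSpace ℂ W]

variable (E) in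
/-- The adjoint action of a Lie group, on the model space of the group. -/
def modelAd (g : G) : E →L[ℂ] E :=
  dAt E (fun y => extChartAt 𝓘(ℂ, E) (1 : G) (g * y * g⁻¹)) 1

variable (E) in
/-- The adjoint action of a Lie group on its Lie algebra. -/
def Ad (g : G) : GroupLieAlgebra 𝓘(ℂ, E) G →L[ℂ] GroupLieAlgebra 𝓘(ℂ, E) G :=
  modelAd E g

theorem contMDiffAt_extChartAt_one :
    ContMDiffAt 𝓘(ℂ, E) 𝓘(ℂ, E) ω (extChartAt 𝓘(ℂ, E) (1 : G)) 1 :=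
  contMDiffAt_extChartAt

variable [LieGroup 𝓘(ℂ, E) ω G]

theorem dAt_comp_conj_eq_mfderiv {f : G → W} (hf : MDifferentiableAt 𝓘(ℂ, E) 𝓘(ℂ, W) f 1) (g : G)
    (a : E) : dAt E (fun y => f (g * y * g⁻¹)) 1 a =
      dAt E f 1 ((mfderiv 𝓘(ℂ, E) 𝓘(ℂ, E) (fun y : G => g * y * g⁻¹) 1 : E →L[ℂ] E) a) := by
  have h := dAt_comp_apply (E := E) (E' := E) (f := f) (c := fun y : G => g * y * g⁻¹) (x := 1)
    (by simpa using hf) ((contMDiff_conj E g).mdifferentiableAt (by simp)) a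
  simp only [mul_one, mul_inv_cancel] at h
  exact h

theorem dAt_comp_conj {f : G → W} (hf : MDifferentiableAt 𝓘(ℂ, E) 𝓘(ℂ, W) f 1) (g : G) (a : E) :
    dAt E (fun y => f (g * y * g⁻¹)) 1 a = dAt E f 1 (modelAd E g a) := by
  have h2 := dAt_comp_conj_eq_mfderiv (E := E)
    (contMDiffAt_extChartAt_one.mdifferentiableAt (by simp)) g a
  rw [dAt_extChartAt] at h2
  rw [dAt_comp_conj_eq_mfderiv hf]
  exact congrArg (dAt E f 1) h2.symm

/-- From `g y = (g y g⁻¹) g`. -/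
theorem leftD_eq_rightD_Ad {f : G → W} {g : G} (hf : MDifferentiableAt 𝓘(ℂ, E) 𝓘(ℂ, W) f g)
    (a : GroupLieAlgebra 𝓘(ℂ, E) G) : leftD E f g a = rightD E f g (Ad E g a) := by
  have h : MDifferentiableAt 𝓘(ℂ, E) 𝓘(ℂ, W) (fun y : G => f (y * g)) 1 :=
    MDifferentiableAt.comp (g := f) (f := fun y => y * g) 1 (by simpa using hf)
      ((contMDiff_mul_right' E g).mdifferentiableAt (by simp))
  have h2 := dAt_comp_conj h g a
  simp only [inv_mul_cancel_right] at h2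
  exact h2

theorem modelAd_one (a : E) : modelAd E (1 : G) a = a := by
  simp only [modelAd, one_mul, inv_one, mul_one]
  exact DFunLike.congr_fun (dAt_extChartAt (E := E) (1 : G)) a

theorem Ad_one (a : GroupLieAlgebra 𝓘(ℂ, E) G) : Ad E (1 : G) a = a :=
  modelAd_one (E := E) (G := G) a

theorem modelAd_mul (g h : G) (a : E) :
    modelAd E (g * h) a = modelAd E g (modelAd E h a) := by
  have h1 : MDifferentiableAt 𝓘(ℂ, E) 𝓘(ℂ, E)
      (fun y => extChartAt 𝓘(ℂ, E) (1 : G) (g * y * g⁻¹)) 1 :=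
    MDifferentiableAt.comp (g := extChartAt 𝓘(ℂ, E) (1 : G)) (f := fun y => g * y * g⁻¹) 1
      (by
        simp only [mul_one, mul_inv_cancel]
        exact contMDiffAt_extChartAt_one.mdifferentiableAt (by simp))
      ((contMDiff_conj E g).mdifferentiableAt (by simp))
  have h2 := dAt_comp_conj h1 h a
  rw [← modelAd] at h2
  rw [← h2, modelAd]
  simp only [mul_inv_rev, mul_assoc]

theorem Ad_mul (g h : G) (a : GroupLieAlgebra 𝓘(ℂ, E) G) :
    Ad E (g * h) a = Ad E g (Ad E h a) :=
  modelAd_mul (E := E) g h a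

theorem contMDiffAt_extChartAt_mul_mul (g : G) :
    ContMDiffAt (𝓘(ℂ, E).prod 𝓘(ℂ, E)) 𝓘(ℂ, E) ω
      (Function.uncurry fun x y : G => extChartAt 𝓘(ℂ, E) (1 : G) (x * y * x⁻¹)) (g, 1) := by
  refine ContMDiffAt.comp (g := extChartAt 𝓘(ℂ, E) (1 : G))
    (f := fun p : G × G => p.1 * p.2 * p.1⁻¹) (g, 1)
    (by
      simp only [mul_one, mul_inv_cancel]
      exact contMDiffAt_extChartAt_one) ?_
  exact (contMDiffAt_fst.mul contMDiffAt_snd).mul contMDiffAt_fst.inv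

theorem contMDiff_modelAd (a : E) :
    ContMDiff 𝓘(ℂ, E) 𝓘(ℂ, E) ω (fun g : G => modelAd E g a) := fun g =>
  (contMDiffAt_dAt (contMDiffAt_extChartAt_mul_mul g)).clm_apply contMDiffAt_const

theorem contMDiffAt_dAt_mul_right :
    ContMDiffAt 𝓘(ℂ, E) 𝓘(ℂ, E →L[ℂ] E) ω
      (fun g : G => dAt E (fun y : G => extChartAt 𝓘(ℂ, E) (1 : G) (y * g)) 1) 1 := by
  refine contMDiffAt_dAt (contMDiffAt_uncurry_swap
    (f := fun x y : G => extChartAt 𝓘(ℂ, E) (1 : G) (x * y)) (contMDiffAt_comp_mul ?_))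
  rw [mul_one]
  exact contMDiffAt_extChartAt_one

/-- The derivative of the adjoint action is the Lie bracket. -/
theorem dAt_modelAd (x y : GroupLieAlgebra 𝓘(ℂ, E) G) :
    dAt E (fun g : G => modelAd E g y) 1 x = (⁅x, y⁆ : GroupLieAlgebra 𝓘(ℂ, E) G) := by
  set φ := extChartAt 𝓘(ℂ, E) (1 : G) with hφ
  have hφ1 : ContMDiffAt 𝓘(ℂ, E) 𝓘(ℂ, E) ω φ 1 := contMDiffAt_extChartAt_one
  have hA := (contMDiffAt_dAt_mul_right (E := E) (G := G)).mdifferentiableAt (by simp)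
  -- The identity `L_y φ = R_{Ad y} φ` for the chart `φ` is differentiated at `1` along `x`. The
  -- product rule gives the derivative of `Ad` plus `L_x R_y φ = R_y L_x φ`, which at `1` equals
  -- `L_y L_x φ`. The derivative of `Ad` is thus `L_x L_y φ - L_y L_x φ`, the bracket.
  have h1 : ∀ y : E, (fun g => dAt E (fun z : G => φ (g * z)) 1 y) =ᶠ[𝓝 1]
      fun g => dAt E (fun z : G => φ (z * g)) 1 (modelAd E g y) := by
    intro y
    filter_upwards [eventually_contMDiffAt hφ1] with g hg
    exact leftD_eq_rightD_Ad (hg.mdifferentiableAt (by simp)) y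
  have h2 : ∀ x y : E, dAt E (fun g => dAt E (fun z : G => φ (z * g)) 1 (modelAd E g y)) 1 x =
      dAt E (fun g : G => modelAd E g y) 1 x +
        dAt E (fun g : G => dAt E (fun z : G => φ (z * g)) 1) 1 x y := by
    intro x y
    have h := dAt_clm_apply (E := E) hA ((contMDiff_modelAd y).mdifferentiableAt (by simp)) x
    simp only [mul_one, modelAd_one] at h
    rw [h, dAt_extChartAt]
    rfl
  have h4 : ∀ x y : E, dAt E (fun h => dAt E (fun z : G => φ (h * z)) 1 x) 1 y =
      dAt E (fun g : G => dAt E (fun z : G => φ (z * g)) 1) 1 x y := by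
    intro x y
    have h5 : rightD E (fun h => leftD E φ h x) 1 y = leftD E (fun h => rightD E φ h y) 1 x :=
      (leftD_rightD_comm hφ1 x y).symm
    rw [rightD_one, leftD_one] at h5
    have h6 := dAt_clm_apply (E := E) (f := fun _ : G => y) hA mdifferentiableAt_const x
    rw [dAt_const, zero_apply, map_zero, zero_add] at h6
    exact h5.trans h6
  have h3 := leftD_bracket_one hφ1 x y
  rw [leftD_one, leftD_one, leftD_one, dAt_extChartAt] at h3
  have h7 : ∀ x y z : E, z = dAt E (fun h => dAt E (fun z : G => φ (h * z)) 1 y) 1 x -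
      dAt E (fun h => dAt E (fun z : G => φ (h * z)) 1 x) 1 y →
      dAt E (fun g : G => modelAd E g y) 1 x = z := by
    intro x y z h
    rw [h, h4 x y, dAt_congr (h1 y), h2, add_sub_cancel_right]
  exact h7 x y _ h3

/-- Conjugation is an automorphism, so the iterated left derivatives at `1` of the chart composed
with it are those of the chart along `Ad`-images. Comparing the two bracket formulas gives the
result. -/
theorem Ad_bracket (g : G) (a b : GroupLieAlgebra 𝓘(ℂ, E) G) :
    Ad E g ⁅a, b⁆ = ⁅Ad E g a, Ad E g b⁆ := by
  set φ := extChartAt 𝓘(ℂ, E) (1 : G) with hφ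
  have hφ1 : ContMDiffAt 𝓘(ℂ, E) 𝓘(ℂ, E) ω φ 1 := contMDiffAt_extChartAt_one
  have h1 : ContMDiffAt 𝓘(ℂ, E) 𝓘(ℂ, E) ω (fun y => φ (g * y * g⁻¹)) 1 :=
    ContMDiffAt.comp (g := φ) (f := fun y => g * y * g⁻¹) 1 (by simpa using hφ1)
      (contMDiff_conj E g 1)
  have h2 := leftD_bracket_one h1 a b
  have h3 := leftD_bracket_one hφ1 (Ad E g a) (Ad E g b)
  have ht : Filter.Tendsto (fun y : G => g * y * g⁻¹) (𝓝 1) (𝓝 1) := by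
    simpa using (contMDiff_conj E g).continuous.tendsto 1
  have h4 : ∀ c d : GroupLieAlgebra 𝓘(ℂ, E) G,
      leftD E (fun h => leftD E (fun y => φ (g * y * g⁻¹)) h c) 1 d =
      leftD E (fun h => leftD E φ h (Ad E g c)) 1 (Ad E g d) := by
    intro c d
    have h5 : (fun h => leftD E (fun y => φ (g * y * g⁻¹)) h c) =ᶠ[𝓝 1]
        fun h => leftD E φ (g * h * g⁻¹) (Ad E g c) := by
      filter_upwards [ht.eventually (eventually_contMDiffAt hφ1)] with h hh
      have h7 : MDifferentiableAt 𝓘(ℂ, E) 𝓘(ℂ, E) (fun y : G => φ (g * h * g⁻¹ * y)) 1 :=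
        MDifferentiableAt.comp (g := φ) (f := fun y => g * h * g⁻¹ * y) 1
          (by rw [mul_one]; exact hh.mdifferentiableAt (by simp))
          ((contMDiff_mul_left' E _).mdifferentiableAt (by simp))
      have h6 := dAt_comp_conj h7 g c
      simp only [mul_assoc, inv_mul_cancel_left] at h6
      simp only [leftD, mul_assoc]
      exact h6
    rw [leftD_congr h5, leftD_one, leftD_one]
    exact dAt_comp_conj (f := fun h => leftD E φ h (Ad E g c))
      ((contMDiffAt_leftD hφ1 _).mdifferentiableAt (by simp)) g d
  rw [h4, h4, ← h3, leftD_one, leftD_one, dAt_extChartAt] at h2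
  exact h2

end Adjoint

/-! ### Pairing tensors with covectors. -/

section TensorPairings

variable {V W : Type*} [AddCommGroup V] [Module ℂ V] [AddCommGroup W] [Module ℂ W]

@[simp]
theorem pair2_tmul (ξ η : V →ₗ[ℂ] ℂ) (v w : V) : pair2 ξ η (v ⊗ₜ[ℂ] w) = ξ v * η w := rfl

@[simp]
theorem pair3_tmul (ξ η ζ : V →ₗ[ℂ] ℂ) (v : V) (t : V ⊗[ℂ] V) :
    pair3 ξ η ζ (v ⊗ₜ[ℂ] t) = ξ v * pair2 η ζ t := rfl

@[simp]
theorem map2_tmul (f : V →ₗ[ℂ] W) (v w : V) : map2 f (v ⊗ₜ[ℂ] w) = f v ⊗ₜ[ℂ] f w := rfl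

@[simp]
theorem map3_tmul (f : V →ₗ[ℂ] W) (v : V) (t : V ⊗[ℂ] V) :
    map3 f (v ⊗ₜ[ℂ] t) = f v ⊗ₜ[ℂ] map2 f t := rfl

theorem pair2_map2 (ξ η : W →ₗ[ℂ] ℂ) (f : V →ₗ[ℂ] W) (t : V ⊗[ℂ] V) :
    pair2 ξ η (map2 f t) = pair2 (ξ ∘ₗ f) (η ∘ₗ f) t := by
  have : pair2 ξ η ∘ₗ map2 f = pair2 (ξ ∘ₗ f) (η ∘ₗ f) := TensorProduct.ext' fun _ _ => rfl
  exact LinearMap.congr_fun this t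

theorem pair3_map3 (ξ η ζ : W →ₗ[ℂ] ℂ) (f : V →ₗ[ℂ] W) (t : V ⊗[ℂ] (V ⊗[ℂ] V)) :
    pair3 ξ η ζ (map3 f t) = pair3 (ξ ∘ₗ f) (η ∘ₗ f) (ζ ∘ₗ f) t := by
  have : pair3 ξ η ζ ∘ₗ map3 f = pair3 (ξ ∘ₗ f) (η ∘ₗ f) (ζ ∘ₗ f) := by
    refine TensorProduct.ext' fun v s => ?_
    simp [pair2_map2]
  exact LinearMap.congr_fun this t

theorem map2_comp {W' : Type*} [AddCommGroup W'] [Module ℂ W'] (g : W →ₗ[ℂ] W') (f : V →ₗ[ℂ] W)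
    (t : V ⊗[ℂ] V) : map2 (g ∘ₗ f) t = map2 g (map2 f t) := by
  have : map2 (g ∘ₗ f) = map2 g ∘ₗ map2 f := TensorProduct.ext' fun _ _ => rfl
  exact LinearMap.congr_fun this t

theorem map2_id (t : V ⊗[ℂ] V) : map2 LinearMap.id t = t := by
  have : map2 (LinearMap.id : V →ₗ[ℂ] V) = LinearMap.id := TensorProduct.ext' fun _ _ => rfl
  exact LinearMap.congr_fun this t

theorem map3_comp {W' : Type*} [AddCommGroup W'] [Module ℂ W'] (g : W →ₗ[ℂ] W') (f : V →ₗ[ℂ] W)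
    (t : V ⊗[ℂ] (V ⊗[ℂ] V)) : map3 (g ∘ₗ f) t = map3 g (map3 f t) := by
  have : map3 (g ∘ₗ f) = map3 g ∘ₗ map3 f := by
    refine TensorProduct.ext' fun v s => ?_
    simp [map2_comp]
  exact LinearMap.congr_fun this t

theorem flip_map2 (f : V →ₗ[ℂ] W) (t : V ⊗[ℂ] V) : flip (map2 f t) = map2 f (flip t) := by
  have : (TensorProduct.comm ℂ W W).toLinearMap ∘ₗ map2 f =
      map2 f ∘ₗ (TensorProduct.comm ℂ V V).toLinearMap := TensorProduct.ext' fun _ _ => rfl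
  exact LinearMap.congr_fun this t

theorem flip_add (s t : V ⊗[ℂ] V) : flip (s + t) = flip s + flip t := map_add _ s t

theorem flip_sub (s t : V ⊗[ℂ] V) : flip (s - t) = flip s - flip t := map_sub _ s t

theorem flip_smul (c : ℂ) (t : V ⊗[ℂ] V) : flip (c • t) = c • flip t := map_smul _ c t

theorem flip_flip (t : V ⊗[ℂ] V) : flip (flip t) = t :=
  (TensorProduct.comm ℂ V V).symm_apply_apply t

theorem map2_injective {f : V →ₗ[ℂ] W} (hf : Function.Injective f) :
    Function.Injective (map2 f) := by
  obtain ⟨g, hg⟩ := f.exists_leftInverse_of_injective (LinearMap.ker_eq_bot.2 hf)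
  intro s t h
  rw [← map2_id s, ← map2_id t, ← hg, map2_comp, map2_comp, h]

theorem map3_injective {f : V →ₗ[ℂ] W} (hf : Function.Injective f) :
    Function.Injective (map3 f) := by
  obtain ⟨g, hg⟩ := f.exists_leftInverse_of_injective (LinearMap.ker_eq_bot.2 hf)
  have hid : ∀ t : V ⊗[ℂ] (V ⊗[ℂ] V), map3 (LinearMap.id : V →ₗ[ℂ] V) t = t := by
    have : map3 (LinearMap.id : V →ₗ[ℂ] V) = LinearMap.id :=
      TensorProduct.ext' fun v s => by simp [map2_id]
    exact LinearMap.congr_fun this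
  intro s t h
  rw [← hid s, ← hid t, ← hg, map3_comp, map3_comp, h]

/-- Covectors separate tensors of degree two. -/
theorem eq_zero_of_pair2 {t : V ⊗[ℂ] V} (h : ∀ ξ η : V →ₗ[ℂ] ℂ, pair2 ξ η t = 0) : t = 0 := by
  let B := Module.Basis.ofVectorSpace ℂ V
  refine (B.tensorProduct B).ext_elem fun ⟨i, j⟩ => ?_
  have : (B.tensorProduct B).coord (i, j) = pair2 (B.coord i) (B.coord j) :=
    TensorProduct.ext' fun v w => by
      simp [Module.Basis.tensorProduct_repr_tmul_apply, mul_comm]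
  rw [map_zero, Finsupp.zero_apply, ← h (B.coord i) (B.coord j), ← this]
  rfl

/-- Covectors separate tensors of degree three. -/
theorem eq_zero_of_pair3 {t : V ⊗[ℂ] (V ⊗[ℂ] V)}
    (h : ∀ ξ η ζ : V →ₗ[ℂ] ℂ, pair3 ξ η ζ t = 0) : t = 0 := by
  let B := Module.Basis.ofVectorSpace ℂ V
  refine (B.tensorProduct (B.tensorProduct B)).ext_elem fun ⟨i, j, k⟩ => ?_
  have : (B.tensorProduct (B.tensorProduct B)).coord (i, j, k) =
      pair3 (B.coord i) (B.coord j) (B.coord k) := by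
    refine TensorProduct.ext' fun v t => ?_
    induction t using TensorProduct.induction_on with
    | zero => simp
    | add s t hs ht => rw [TensorProduct.tmul_add, map_add, map_add, hs, ht]
    | tmul x y =>
      simp only [Module.Basis.coord_apply, Module.Basis.tensorProduct_repr_tmul_apply, smul_eq_mul,
        pair3_tmul, pair2_tmul]
      ring
  rw [map_zero, Finsupp.zero_apply, ← h (B.coord i) (B.coord j) (B.coord k), ← this]
  rfl

end TensorPairings

/-! ### From invariance under a Lie algebra to invariance under a connected group. -/

section Invariance

variable {E : Type*} [NormedAddCommGroup E] [NormedSpace ℂ E]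
  {G : Type*} [TopologicalSpace G] [ChartedSpace E G] [Group G] [LieGroup 𝓘(ℂ, E) ω G]

theorem contMDiff_comp_modelAd (ξ : E →L[ℂ] ℂ) (x : E) :
    ContMDiff 𝓘(ℂ, E) 𝓘(ℂ, ℂ) ω (fun g : G => ξ (modelAd E g x)) :=
  ξ.contDiff.contMDiff.comp (contMDiff_modelAd x)

theorem contMDiff_pair2_Ad (ξ η : GroupLieAlgebra 𝓘(ℂ, E) G →L[ℂ] ℂ)
    (b : GroupLieAlgebra 𝓘(ℂ, E) G ⊗[ℂ] GroupLieAlgebra 𝓘(ℂ, E) G) :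
    ContMDiff 𝓘(ℂ, E) 𝓘(ℂ, ℂ) ω (fun g : G =>
      pair2 ξ.toLinearMap η.toLinearMap (map2 (Ad E g).toLinearMap b)) := by
  induction b using TensorProduct.induction_on with
  | zero => simpa using contMDiff_const
  | add s t hs ht =>
    simp only [map_add]
    exact hs.add ht
  | tmul x y =>
    have h : ∀ (ξ η : E →L[ℂ] ℂ) (x y : E), ContMDiff 𝓘(ℂ, E) 𝓘(ℂ, ℂ) ω
        (fun g : G => ξ (modelAd E g x) * η (modelAd E g y)) := fun ξ η x y =>
      (contMDiff_comp_modelAd ξ x).mul (contMDiff_comp_modelAd η y)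
    exact h ξ η x y

theorem map2_Ad_mul (g h : G) (b : GroupLieAlgebra 𝓘(ℂ, E) G ⊗[ℂ] GroupLieAlgebra 𝓘(ℂ, E) G) :
    map2 (Ad E (g * h)).toLinearMap b =
      map2 (Ad E g).toLinearMap (map2 (Ad E h).toLinearMap b) := by
  rw [← map2_comp]
  congr 2
  exact LinearMap.ext (Ad_mul g h)

/-- The stabilizer of a tensor under the adjoint action. -/
def adStabilizer (b : GroupLieAlgebra 𝓘(ℂ, E) G ⊗[ℂ] GroupLieAlgebra 𝓘(ℂ, E) G) : Subgroup G where
  carrier := {g | map2 (Ad E g).toLinearMap b = b}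
  mul_mem' {g h} hg hh := by
    rw [Set.mem_ofPred_eq] at hg hh ⊢
    rw [map2_Ad_mul, hh, hg]
  one_mem' := by
    rw [Set.mem_ofPred_eq, show (Ad E (1 : G)).toLinearMap = LinearMap.id from LinearMap.ext Ad_one,
      map2_id]
  inv_mem' {g} hg := by
    rw [Set.mem_ofPred_eq] at hg ⊢
    conv_lhs => rw [← hg]
    rw [← map2_Ad_mul, inv_mul_cancel,
      show (Ad E (1 : G)).toLinearMap = LinearMap.id from LinearMap.ext Ad_one, map2_id]

variable (E) in
/-- The tangent map of a holomorphic map at `h` sends a vector into the Lie algebra of `U` when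
the map sends `h` to `1` and a neighbourhood of `h` into `U`. -/
theorem mfderiv_mem_lieAlgebraOf {M : Type*} [TopologicalSpace M] [ChartedSpace E M]
    [IsManifold 𝓘(ℂ, E) ω M] (U : Subgroup G) {s : M → G} {h : M}
    (hs : ContMDiffAt 𝓘(ℂ, E) 𝓘(ℂ, E) ω s h) (h1 : s h = 1) (hU : ∀ᶠ y in 𝓝 h, s y ∈ U) (v : E) :
    ((mfderiv 𝓘(ℂ, E) 𝓘(ℂ, E) s h : E →L[ℂ] E) v : E) ∈
      (lieAlgebraOf E U : Submodule ℂ (GroupLieAlgebra 𝓘(ℂ, E) G)) := by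
  have hγ : ContMDiffAt 𝓘(ℂ, ℂ) 𝓘(ℂ, E) ω (fun t => s (chartLine h v t)) 0 :=
    ContMDiffAt.comp (g := s) (f := chartLine h v) 0 (by rwa [chartLine_zero])
      (contMDiffAt_chartLine h v)
  have ht : Filter.Tendsto (chartLine h v) (𝓝 0) (𝓝 h) := by
    simpa only [chartLine_zero] using (contMDiffAt_chartLine h v).continuousAt.tendsto
  have hφ : MDifferentiableAt 𝓘(ℂ, E) 𝓘(ℂ, E) (extChartAt 𝓘(ℂ, E) (1 : G)) 1 :=
    contMDiffAt_extChartAt_one.mdifferentiableAt (by simp)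
  refine Submodule.subset_span ⟨fun t => s (chartLine h v t),
    (congrArg s (chartLine_zero h v)).trans h1, ht.eventually hU, hγ, ?_⟩
  refine @heq_of_eq E _ _ ?_
  have e1 := dAt_comp_apply (E := E) (f := extChartAt 𝓘(ℂ, E) (1 : G)) (c := s) (x := h)
    (by rwa [h1]) (hs.mdifferentiableAt (by simp)) v
  have e2 := dAt_comp_apply (E := ℂ) (E' := E) (f := extChartAt 𝓘(ℂ, E) (1 : G))
    (c := fun t => s (chartLine h v t)) (x := 0)
    (by rwa [chartLine_zero, h1]) (hγ.mdifferentiableAt (by simp)) (1 : ℂ)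
  rw [h1, dAt_extChartAt] at e1
  rw [chartLine_zero, h1, dAt_extChartAt] at e2
  have e3 := dAt_comp_chartLine (f := fun y => extChartAt 𝓘(ℂ, E) (1 : G) (s y)) (x := h)
    (MDifferentiableAt.comp (g := extChartAt 𝓘(ℂ, E) (1 : G)) h (by rwa [h1])
      (hs.mdifferentiableAt (by simp))) v
  exact (e1.symm.trans e3.symm).trans e2

theorem dAt_comp_modelAd (ξ : GroupLieAlgebra 𝓘(ℂ, E) G →L[ℂ] ℂ) (x y : GroupLieAlgebra 𝓘(ℂ, E) G) :
    dAt E (fun g : G => ξ (Ad E g y)) 1 x = ξ ⁅x, y⁆ := by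
  have h : ∀ (ξ : E →L[ℂ] ℂ) (x y : E), dAt E (fun g : G => ξ (modelAd E g y)) 1 x =
      ξ (dAt E (fun g : G => modelAd E g y) 1 x) := by
    intro ξ x y
    rw [fderiv_comp_dAt ξ.differentiableAt ((contMDiff_modelAd y).mdifferentiableAt (by simp)),
      ξ.fderiv]
    rfl
  exact (h ξ x y).trans (congrArg ξ (dAt_modelAd x y))

variable [CompleteSpace E]

theorem dAt_pair2_Ad (ξ η : GroupLieAlgebra 𝓘(ℂ, E) G →L[ℂ] ℂ)
    (b : GroupLieAlgebra 𝓘(ℂ, E) G ⊗[ℂ] GroupLieAlgebra 𝓘(ℂ, E) G)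
    (x : GroupLieAlgebra 𝓘(ℂ, E) G) :
    dAt E (fun g : G => pair2 ξ.toLinearMap η.toLinearMap (map2 (Ad E g).toLinearMap b)) 1 x =
      pair2 ξ.toLinearMap η.toLinearMap ⁅x, b⁆ := by
  induction b using TensorProduct.induction_on with
  | zero =>
    simp only [map_zero, lie_zero]
    exact DFunLike.congr_fun (dAt_const (E := E) (0 : ℂ) (1 : G)) (x : E)
  | add s t hs ht =>
    simp only [map_add, lie_add]
    rw [← hs, ← ht]
    exact dAt_add_apply (E := E) ((contMDiff_pair2_Ad ξ η s).mdifferentiableAt (by simp))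
      ((contMDiff_pair2_Ad ξ η t).mdifferentiableAt (by simp)) x
  | tmul y z =>
    have h : ∀ (ξ η : E →L[ℂ] ℂ) (x y z : E),
        dAt E (fun g : G => ξ (modelAd E g y) * η (modelAd E g z)) 1 x =
        dAt E (fun g : G => ξ (modelAd E g y)) 1 x * η z +
          ξ y * dAt E (fun g : G => η (modelAd E g z)) 1 x := by
      intro ξ η x y z
      rw [dAt_mul_apply ((contMDiff_comp_modelAd ξ y).mdifferentiableAt (by simp))
        ((contMDiff_comp_modelAd η z).mdifferentiableAt (by simp)), modelAd_one, modelAd_one]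
    rw [TensorProduct.LieModule.lie_tmul_right, map_add, pair2_tmul, pair2_tmul]
    refine (h ξ η x y z).trans ?_
    exact congrArg₂ (· + ·) (congrArg (· * _) (dAt_comp_modelAd ξ x y))
      (congrArg (_ * ·) (dAt_comp_modelAd η x z))

/-- Factor `Ad(r y) = Ad(r h) Ad((r h)⁻¹ r y)`. The second argument is `1` at `y = h` and stays in
`U`, so its velocity `x` lies in the Lie algebra. The derivative is then a pairing with `[x, b] =
0`. -/
theorem dAt_pair2_Ad_eq_zero (U : Subgroup G) {r : G → G} {h : G}
    (hr : ContMDiffAt 𝓘(ℂ, E) 𝓘(ℂ, E) ω r h) (hrU : ∀ᶠ y in 𝓝 h, r y ∈ U)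
    {b : GroupLieAlgebra 𝓘(ℂ, E) G ⊗[ℂ] GroupLieAlgebra 𝓘(ℂ, E) G}
    (hb : IsInvariant (lieAlgebraOf E U) b) (ξ η : GroupLieAlgebra 𝓘(ℂ, E) G →L[ℂ] ℂ) :
    dAt E (fun y => pair2 ξ.toLinearMap η.toLinearMap (map2 (Ad E (r y)).toLinearMap b)) h = 0 := by
  ext w
  let ξ' := ξ.comp (Ad E (r h))
  let η' := η.comp (Ad E (r h))
  have hrh : r h ∈ U := hrU.self_of_nhds
  let s : G → G := fun y => (r h)⁻¹ * r y
  have hs : ContMDiffAt 𝓘(ℂ, E) 𝓘(ℂ, E) ω s h := contMDiffAt_const.mul hr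
  have hs1 : s h = 1 := inv_mul_cancel _
  have hsU : ∀ᶠ y in 𝓝 h, s y ∈ U := hrU.mono fun y hy => U.mul_mem (U.inv_mem hrh) hy
  have e1 : (fun y => pair2 ξ.toLinearMap η.toLinearMap (map2 (Ad E (r y)).toLinearMap b)) =
      fun y => pair2 ξ'.toLinearMap η'.toLinearMap (map2 (Ad E (s y)).toLinearMap b) := by
    funext y
    rw [show ξ'.toLinearMap = ξ.toLinearMap ∘ₗ (Ad E (r h)).toLinearMap from rfl,
      show η'.toLinearMap = η.toLinearMap ∘ₗ (Ad E (r h)).toLinearMap from rfl, ← pair2_map2,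
      ← map2_comp]
    congr 2
    congr 1
    ext x
    exact (congrArg (fun g => Ad E g x) (mul_inv_cancel_left (r h) (r y))).symm.trans
      (Ad_mul (r h) (s y) x)
  rw [e1, dAt_comp_apply (f := fun g =>
    pair2 ξ'.toLinearMap η'.toLinearMap (map2 (Ad E g).toLinearMap b))
    ((contMDiff_pair2_Ad ξ' η' b).mdifferentiableAt (by simp)) (hs.mdifferentiableAt (by simp)),
    hs1]
  refine (dAt_pair2_Ad ξ' η' b _).trans ?_
  exact (congrArg (pair2 ξ'.toLinearMap η'.toLinearMap)
    (hb _ (mfderiv_mem_lieAlgebraOf E U hs hs1 hsU w))).trans (map_zero _)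

variable [FiniteDimensional ℂ E]

omit [LieGroup 𝓘(ℂ, E) ω G] [CompleteSpace E] in
theorem eq_zero_of_pair2_continuous
    {t : GroupLieAlgebra 𝓘(ℂ, E) G ⊗[ℂ] GroupLieAlgebra 𝓘(ℂ, E) G}
    (h : ∀ ξ η : GroupLieAlgebra 𝓘(ℂ, E) G →L[ℂ] ℂ, pair2 ξ.toLinearMap η.toLinearMap t = 0) :
    t = 0 := by
  have hc : ∀ ξ : E →ₗ[ℂ] ℂ, ∃ ξ' : E →L[ℂ] ℂ, ξ'.toLinearMap = ξ := fun ξ =>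
    ⟨LinearMap.toContinuousLinearMap ξ, rfl⟩
  refine eq_zero_of_pair2 fun ξ η => ?_
  obtain ⟨ξ', hξ⟩ := hc ξ
  obtain ⟨η', hη⟩ := hc η
  have h2 := h ξ' η'
  rw [← h2]
  exact congrArg₂ (fun a b => pair2 a b t) hξ.symm hη.symm

/-- A retraction onto `U` replaces the exponential map: `y ↦ Ad(r y) b` has zero derivative on a
ball in the chart, hence is constant there, and `r` fixes the points of `U`. -/
theorem eventually_map2_Ad_eq (U : Subgroup G)
    {r : G → G} (hr : ContMDiffAt 𝓘(ℂ, E) 𝓘(ℂ, E) ω r 1) (hrU : ∀ᶠ h in 𝓝 1, r h ∈ U)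
    (hrr : ∀ u ∈ U, r u = u)
    {b : GroupLieAlgebra 𝓘(ℂ, E) G ⊗[ℂ] GroupLieAlgebra 𝓘(ℂ, E) G}
    (hb : IsInvariant (lieAlgebraOf E U) b) :
    ∀ᶠ u in 𝓝 (1 : G), u ∈ U → map2 (Ad E u).toLinearMap b = b := by
  set φ := extChartAt 𝓘(ℂ, E) (1 : G) with hφ
  have hr' : ∀ᶠ h in 𝓝 (1 : G), ContMDiffAt 𝓘(ℂ, E) 𝓘(ℂ, E) ω r h :=
    (contMDiffAt_iff_contMDiffAt_nhds (by simp)).1 hr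
  have ht : Filter.Tendsto φ.symm (𝓝 (φ 1)) (𝓝 1) := by
    have := (continuousAt_extChartAt_symm (I := 𝓘(ℂ, E)) (1 : G)).tendsto
    rwa [extChartAt_to_inv] at this
  obtain ⟨ε, hε, hball⟩ := Metric.eventually_nhds_iff_ball.1
    ((ht.eventually (hr'.and hrU.eventually_nhds)).and
      (extChartAt_target_mem_nhds (I := 𝓘(ℂ, E)) (1 : G)))
  have hφc : Filter.Tendsto φ (𝓝 1) (𝓝 (φ 1)) := continuousAt_extChartAt (I := 𝓘(ℂ, E)) (1 : G)
  filter_upwards [extChartAt_source_mem_nhds (I := 𝓘(ℂ, E)) (1 : G),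
    hφc.eventually (Metric.ball_mem_nhds _ hε)] with u hu1 hu2 huU
  rw [← sub_eq_zero]
  refine eq_zero_of_pair2_continuous fun ξ η => ?_
  let Q : G → ℂ := fun y =>
    pair2 ξ.toLinearMap η.toLinearMap (map2 (Ad E (r y)).toLinearMap b)
  have hQ : ∀ z ∈ Metric.ball (φ 1) ε, MDifferentiableAt 𝓘(ℂ, E) 𝓘(ℂ, ℂ) Q (φ.symm z) :=
    fun z hz => (ContMDiffAt.comp (g := fun g =>
      pair2 ξ.toLinearMap η.toLinearMap (map2 (Ad E g).toLinearMap b)) _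
      (contMDiff_pair2_Ad ξ η b _) (hball z hz).1.1).mdifferentiableAt (by simp)
  have hs : ∀ z ∈ Metric.ball (φ 1) ε, MDifferentiableAt 𝓘(ℂ, E) 𝓘(ℂ, E) φ.symm z :=
    fun z hz => ((contMDiffOn_extChartAt_symm (n := ω) (1 : G)).contMDiffAt
      ((isOpen_extChartAt_target (1 : G)).mem_nhds (hball z hz).2)).mdifferentiableAt (by simp)
  have hconst : Q (φ.symm (φ u)) = Q (φ.symm (φ 1)) := by
    refine Metric.isOpen_ball.is_const_of_fderiv_eq_zero (𝕜 := ℂ) (f := fun z => Q (φ.symm z))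
      (convex_ball (φ 1) ε).isPreconnected ?_ ?_ hu2 (Metric.mem_ball_self hε)
    · intro z hz
      exact (mdifferentiableAt_iff_differentiableAt.1
        (MDifferentiableAt.comp (g := Q) z (hQ z hz) (hs z hz))).differentiableWithinAt
    · intro z hz
      ext v
      have e1 : dAt E (fun z => Q (φ.symm z)) z = fderiv ℂ (fun z => Q (φ.symm z)) z :=
        mfderiv_eq_fderiv
      rw [← e1, dAt_comp_apply (hQ z hz) (hs z hz),
        dAt_pair2_Ad_eq_zero U (hball z hz).1.1 (hball z hz).1.2 hb ξ η]
      rfl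
  rw [φ.left_inv hu1, extChartAt_to_inv] at hconst
  simp only [Q, hrr u huU, hrr 1 U.one_mem] at hconst
  rw [map_sub, hconst]
  have h1 : (Ad E (1 : G)).toLinearMap = LinearMap.id := LinearMap.ext Ad_one
  rw [h1, map2_id, sub_self]

/-- A tensor invariant under the Lie algebra of a connected subgroup is invariant under the
subgroup. -/
theorem map2_Ad_eq_of_isInvariant (U : Subgroup G) (hU : IsConnected (U : Set G))
    {r : G → G} (hr : ContMDiffAt 𝓘(ℂ, E) 𝓘(ℂ, E) ω r 1) (hrU : ∀ᶠ h in 𝓝 1, r h ∈ U)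
    (hrr : ∀ u ∈ U, r u = u)
    {b : GroupLieAlgebra 𝓘(ℂ, E) G ⊗[ℂ] GroupLieAlgebra 𝓘(ℂ, E) G}
    (hb : IsInvariant (lieAlgebraOf E U) b) {u : G} (hu : u ∈ U) :
    map2 (Ad E u).toLinearMap b = b := by
  have : IsTopologicalGroup G := topologicalGroup_of_lieGroup 𝓘(ℂ, E) ω
  have : ConnectedSpace U := isConnected_iff_connectedSpace.1 hU
  -- The stabilizer in `U` contains a neighbourhood of `1`, so it is an open and therefore closed
  -- subgroup of the connected group `U`.
  have h1 : ((adStabilizer b).subgroupOf U : Set U) ∈ 𝓝 (1 : U) := by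
    have ht : Filter.Tendsto (Subtype.val : U → G) (𝓝 1) (𝓝 1) := continuous_subtype_val.tendsto 1
    filter_upwards [ht.eventually (eventually_map2_Ad_eq U hr hrU hrr hb)] with v hv
    exact hv v.2
  have h2 : IsOpen ((adStabilizer b).subgroupOf U : Set U) := Subgroup.isOpen_of_mem_nhds _ h1
  have h3 : ((adStabilizer b).subgroupOf U : Set U) = Set.univ :=
    IsClopen.eq_univ ⟨Subgroup.isClosed_of_isOpen _ h2, h2⟩ ⟨1, Subgroup.one_mem _⟩
  have h4 : (⟨u, hu⟩ : U) ∈ ((adStabilizer b).subgroupOf U : Set U) := h3 ▸ Set.mem_univ _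
  exact h4

end Invariance

/-! ### The Yang–Baxter expression in terms of pairings. -/

section YangBaxter

variable {L : Type*} [LieRing L] [LieAlgebra ℂ L] {ι : Type*} [Fintype ι]

theorem bracketMap_tmul (x y : L) : bracketMap (x ⊗ₜ[ℂ] y) = ⁅x, y⁆ := rfl

theorem pair3_br1213 (ξ η ζ : L →ₗ[ℂ] ℂ) (a b : ι → L) :
    pair3 ξ η ζ (br1213 (∑ i, a i ⊗ₜ[ℂ] b i) (∑ i, a i ⊗ₜ[ℂ] b i)) =
      ∑ i, ∑ j, ξ ⁅a i, a j⁆ * η (b i) * ζ (b j) := by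
  simp only [br1213, TensorProduct.sum_tmul, TensorProduct.tmul_sum, map_sum,
    TensorProduct.tensorTensorTensorComm_tmul, TensorProduct.map_tmul, bracketMap_tmul,
    LinearMap.id_apply, pair3_tmul, pair2_tmul, mul_assoc]
  exact Finset.sum_comm

theorem pair3_br1223 (ξ η ζ : L →ₗ[ℂ] ℂ) (a b : ι → L) :
    pair3 ξ η ζ (br1223 (∑ i, a i ⊗ₜ[ℂ] b i) (∑ i, a i ⊗ₜ[ℂ] b i)) =
      ∑ i, ∑ j, ξ (a i) * η ⁅b i, a j⁆ * ζ (b j) := by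
  simp only [br1223, TensorProduct.sum_tmul, TensorProduct.tmul_sum, map_sum,
    TensorProduct.assoc_tmul, TensorProduct.map_tmul, bracketMap_tmul, LinearMap.comp_apply,
    LinearEquiv.coe_coe, TensorProduct.assoc_symm_tmul,
    LinearMap.id_apply, pair3_tmul, pair2_tmul, mul_assoc]
  exact Finset.sum_comm

theorem pair3_br1323 (ξ η ζ : L →ₗ[ℂ] ℂ) (a b : ι → L) :
    pair3 ξ η ζ (br1323 (∑ i, a i ⊗ₜ[ℂ] b i) (∑ i, a i ⊗ₜ[ℂ] b i)) =
      ∑ i, ∑ j, ξ (a i) * η (a j) * ζ ⁅b i, b j⁆ := by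
  simp only [br1323, TensorProduct.sum_tmul, TensorProduct.tmul_sum, map_sum,
    TensorProduct.tensorTensorTensorComm_tmul, TensorProduct.map_tmul, bracketMap_tmul,
    TensorProduct.assoc_tmul, LinearMap.id_apply, pair3_tmul, pair2_tmul, mul_assoc]
  exact Finset.sum_comm

theorem exists_sum_tmul {V : Type*} [AddCommGroup V] [Module ℂ V] (t : V ⊗[ℂ] V) :
    ∃ (n : ℕ) (a b : Fin n → V), t = ∑ i, a i ⊗ₜ[ℂ] b i := by
  induction t using TensorProduct.induction_on with
  | zero => exact ⟨0, ![], ![], by simp⟩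
  | tmul x y => exact ⟨1, fun _ => x, fun _ => y, by simp⟩
  | add s t hs ht =>
    obtain ⟨m, a, b, rfl⟩ := hs
    obtain ⟨n, c, d, rfl⟩ := ht
    exact ⟨m + n, Fin.append a c, Fin.append b d, by simp [Fin.sum_univ_add]⟩

/-- The sum of `[r¹², r²³]` over cyclic permutations, when the symmetric part of `r` is
invariant. -/
theorem sum_cyclic_br1223 (ξ η ζ : L →ₗ[ℂ] ℂ) (a b : ι → L)
    (hinv : ∀ (x : L) (ξ ζ : L →ₗ[ℂ] ℂ),
      ∑ i, (ξ ⁅x, a i⁆ * ζ (b i) + ξ (a i) * ζ ⁅x, b i⁆ +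
        (ξ ⁅x, b i⁆ * ζ (a i) + ξ (b i) * ζ ⁅x, a i⁆)) = 0) :
    (∑ i, ∑ j, ξ (a i) * η ⁅b i, a j⁆ * ζ (b j)) +
      (∑ i, ∑ j, η (a i) * ζ ⁅b i, a j⁆ * ξ (b j)) +
      (∑ i, ∑ j, ζ (a i) * ξ ⁅b i, a j⁆ * η (b j)) =
    pair3 ξ η ζ (CYB (∑ i, a i ⊗ₜ[ℂ] b i)) -
      ∑ i, ∑ j, ((ξ ⁅a i, a j⁆ * η (b i) * ζ (b j) + ξ ⁅a i, b j⁆ * η (b i) * ζ (a j)) +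
        (ξ ⁅b i, a j⁆ * η (a i) * ζ (b j) + ξ ⁅b i, b j⁆ * η (a i) * ζ (a j))) := by
  -- Invariance of the symmetric part under `x = b i`, contracted with `η (a i)` in the first
  -- factor. Together with two antisymmetry swaps this turns the cyclic sum into `CYB`.
  have h1 : ∑ i, η (a i) * ∑ j, (ξ ⁅b i, a j⁆ * ζ (b j) + ξ (a j) * ζ ⁅b i, b j⁆ +
        (ξ ⁅b i, b j⁆ * ζ (a j) + ξ (b j) * ζ ⁅b i, a j⁆)) = 0 := by
    simp only [hinv, mul_zero, Finset.sum_const_zero]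
  have h2 : ∑ i, ∑ j, ξ ⁅b i, a j⁆ * η (b j) * ζ (a i) =
      ∑ i, ∑ j, -(ξ ⁅a i, b j⁆ * η (b i) * ζ (a j)) := by
    rw [Finset.sum_comm]
    refine Finset.sum_congr rfl fun i _ => Finset.sum_congr rfl fun j _ => ?_
    rw [← lie_skew, map_neg]
    ring
  have h3 : ∑ i, ∑ j, ξ (a i) * η (a j) * ζ ⁅b i, b j⁆ =
      ∑ i, ∑ j, -(ξ (a j) * η (a i) * ζ ⁅b i, b j⁆) := by
    rw [Finset.sum_comm]
    refine Finset.sum_congr rfl fun i _ => Finset.sum_congr rfl fun j _ => ?_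
    rw [← lie_skew, map_neg]
    ring
  have h4 : (∑ i, ∑ j, ζ (a i) * ξ ⁅b i, a j⁆ * η (b j)) =
      ∑ i, ∑ j, ξ ⁅b i, a j⁆ * η (b j) * ζ (a i) :=
    Finset.sum_congr rfl fun i _ => Finset.sum_congr rfl fun j _ => by ring
  rw [CYB, map_add, map_add, pair3_br1213, pair3_br1223, pair3_br1323, h4, h2, h3, ← sub_eq_zero]
  rw [← h1]
  simp only [Finset.mul_sum]
  simp only [← Finset.sum_add_distrib, ← Finset.sum_sub_distrib]
  refine Finset.sum_congr rfl fun i _ => Finset.sum_congr rfl fun j _ => ?_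
  ring

end YangBaxter

/-! ### The Jacobiator as finite-sum algebra in two-jets. -/

section Jets

variable {L : Type*} [LieRing L] [LieAlgebra ℂ L] {ι κ : Type*} [Fintype ι] [Fintype κ]

/-- The first and second derivatives of a function at a point of a Lie group, along left-invariant
and right-invariant vector fields. -/
structure TwoJet (L : Type*) [AddCommGroup L] [Module ℂ L] where
  l : L →ₗ[ℂ] ℂ
  r : L →ₗ[ℂ] ℂ
  ll : L → L → ℂ
  rr : L → L → ℂ
  lr : L → L → ℂ

namespace TwoJet

variable (a b : ι → L) (c d : κ → L) (f g h : TwoJet L)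

/-- The derivative of the bracket of `f` and `g` along a left-invariant vector field. -/
def bracketL (x : L) : ℂ :=
  ∑ i, (f.ll x (a i) * g.l (b i) + f.l (a i) * g.ll x (b i)) -
    ∑ j, (f.lr x (c j) * g.r (d j) + f.r (c j) * g.lr x (d j))

/-- The derivative of the bracket of `f` and `g` along a right-invariant vector field. -/
def bracketR (y : L) : ℂ :=
  ∑ i, (f.lr (a i) y * g.l (b i) + f.l (a i) * g.lr (b i) y) -
    ∑ j, (f.rr y (c j) * g.r (d j) + f.r (c j) * g.rr y (d j))

/-- The iterated bracket of `f` with the bracket of `g` and `h`. -/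
def iterBracket : ℂ :=
  ∑ i, f.l (a i) * bracketL a b c d g h (b i) - ∑ j, f.r (c j) * bracketR a b c d g h (d j)

/-- Second order terms at `g` on a pair of indices. -/
def secondOrder (p q : L →ₗ[ℂ] ℂ) (s : L → L → ℂ) (a b : ι → L) : ℂ :=
  ∑ i, p (a i) * ∑ j, (s (a j) (b i) * q (b j) + s (b j) (b i) * q (a j))

/-- Collects the pure terms in which one given function is differentiated twice. Exchanging its two
derivatives in the first sum costs a bracket and leaves the symmetrized expression `secondOrder`. -/
theorem sum_pure_eq (ε : ℂ) (p q t : L →ₗ[ℂ] ℂ) (s : L → L → ℂ) (a b : ι → L)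
    (hs : ∀ x y, s x y - s y x = ε * t ⁅x, y⁆) :
    (∑ i, ∑ j, p (a i) * (s (b i) (a j) * q (b j))) +
      (∑ i, ∑ j, q (a i) * (p (a j) * s (b i) (b j))) =
    secondOrder p q s a b + ε * ∑ i, ∑ j, p (a i) * t ⁅b i, a j⁆ * q (b j) := by
  have h2 : (∑ i, ∑ j, q (a i) * (p (a j) * s (b i) (b j))) =
      ∑ i, ∑ j, q (a j) * (p (a i) * s (b j) (b i)) := Finset.sum_comm
  rw [h2, secondOrder]
  simp only [Finset.mul_sum, ← Finset.sum_add_distrib]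
  refine Finset.sum_congr rfl fun i _ => Finset.sum_congr rfl fun j _ => ?_
  linear_combination p (a i) * q (b j) * hs (b i) (a j)

/-- Collects the mixed terms in which one given function is differentiated twice. The hypotheses are
`Ω^L = Ω^R` applied to a left, respectively right, derivative of that function. They identify the
four mixed sums with the left and right `secondOrder` terms. -/
theorem sum_mixed_eq (pl ql pr qr : L →ₗ[ℂ] ℂ) (sl sr m : L → L → ℂ)
    (hl : ∀ x, ∑ i, (sl (a i) x * ql (b i) + sl (b i) x * ql (a i)) =
      ∑ j, (m x (c j) * qr (d j) + m x (d j) * qr (c j)))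
    (hr : ∀ y, ∑ i, (m (a i) y * ql (b i) + m (b i) y * ql (a i)) =
      ∑ j, (sr (c j) y * qr (d j) + sr (d j) y * qr (c j))) :
    (∑ i, ∑ j, pl (a i) * (m (b i) (c j) * qr (d j))) +
      (∑ j, ∑ i, pr (c j) * (m (a i) (d j) * ql (b i))) +
      (∑ i, ∑ j, ql (a i) * (pr (c j) * m (b i) (d j))) +
      (∑ j, ∑ i, qr (c j) * (pl (a i) * m (b i) (d j))) =
    secondOrder pl ql sl a b + secondOrder pr qr sr c d := by
  have h1 : (∑ i, ∑ j, ql (a i) * (pr (c j) * m (b i) (d j))) =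
      ∑ j, ∑ i, ql (a i) * (pr (c j) * m (b i) (d j)) := Finset.sum_comm
  have h2 : (∑ j, ∑ i, qr (c j) * (pl (a i) * m (b i) (d j))) =
      ∑ i, ∑ j, qr (c j) * (pl (a i) * m (b i) (d j)) := Finset.sum_comm
  have h3 : secondOrder pl ql sl a b = (∑ i, ∑ j, pl (a i) * (m (b i) (c j) * qr (d j))) +
      ∑ i, ∑ j, qr (c j) * (pl (a i) * m (b i) (d j)) := by
    simp only [secondOrder, hl, Finset.mul_sum, ← Finset.sum_add_distrib]
    exact Finset.sum_congr rfl fun i _ => Finset.sum_congr rfl fun j _ => by ring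
  have h4 : secondOrder pr qr sr c d = (∑ j, ∑ i, pr (c j) * (m (a i) (d j) * ql (b i))) +
      ∑ j, ∑ i, ql (a i) * (pr (c j) * m (b i) (d j)) := by
    simp only [secondOrder, ← hr, Finset.mul_sum, ← Finset.sum_add_distrib]
    exact Finset.sum_congr rfl fun i _ => Finset.sum_congr rfl fun j _ => by ring
  rw [h1, h2, h3, h4]
  ring

theorem iterBracket_eq : iterBracket a b c d f g h =
    ((∑ i, ∑ j, f.l (a i) * (g.ll (b i) (a j) * h.l (b j))) +
      (∑ i, ∑ j, f.l (a i) * (g.l (a j) * h.ll (b i) (b j)))) -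
    ((∑ i, ∑ j, f.l (a i) * (g.lr (b i) (c j) * h.r (d j))) +
      (∑ i, ∑ j, f.l (a i) * (g.r (c j) * h.lr (b i) (d j)))) -
    ((∑ j, ∑ i, f.r (c j) * (g.lr (a i) (d j) * h.l (b i))) +
      (∑ j, ∑ i, f.r (c j) * (g.l (a i) * h.lr (b i) (d j)))) +
    ((∑ i, ∑ j, f.r (c i) * (g.rr (d i) (c j) * h.r (d j))) +
      (∑ i, ∑ j, f.r (c i) * (g.r (c j) * h.rr (d i) (d j)))) := by
  simp only [iterBracket, bracketL, bracketR, mul_sub, mul_add, Finset.mul_sum,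
    Finset.sum_sub_distrib, Finset.sum_add_distrib]
  ring

/-- The Jacobiator of the bracket defined by the left-invariant tensor field of `∑ aᵢ ⊗ bᵢ` minus
the right-invariant tensor field of `∑ cⱼ ⊗ dⱼ`. -/
theorem sum_cyclic_iterBracket
    (hll : ∀ k ∈ [f, g, h], ∀ x y, k.ll x y - k.ll y x = k.l ⁅x, y⁆)
    (hrr : ∀ k ∈ [f, g, h], ∀ x y, k.rr x y - k.rr y x = -k.r ⁅x, y⁆)
    (hΩl : ∀ k ∈ [f, g, h], ∀ k' ∈ [f, g, h], ∀ x,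
      ∑ i, (k.ll (a i) x * k'.l (b i) + k.ll (b i) x * k'.l (a i)) =
      ∑ j, (k.lr x (c j) * k'.r (d j) + k.lr x (d j) * k'.r (c j)))
    (hΩr : ∀ k ∈ [f, g, h], ∀ k' ∈ [f, g, h], ∀ y,
      ∑ i, (k.lr (a i) y * k'.l (b i) + k.lr (b i) y * k'.l (a i)) =
      ∑ j, (k.rr (c j) y * k'.r (d j) + k.rr (d j) y * k'.r (c j))) :
    iterBracket a b c d f g h + iterBracket a b c d g h f + iterBracket a b c d h f g =
      ((∑ i, ∑ j, f.l (a i) * g.l ⁅b i, a j⁆ * h.l (b j)) +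
        (∑ i, ∑ j, g.l (a i) * h.l ⁅b i, a j⁆ * f.l (b j)) +
        (∑ i, ∑ j, h.l (a i) * f.l ⁅b i, a j⁆ * g.l (b j))) -
      ((∑ i, ∑ j, f.r (c i) * g.r ⁅d i, c j⁆ * h.r (d j)) +
        (∑ i, ∑ j, g.r (c i) * h.r ⁅d i, c j⁆ * f.r (d j)) +
        (∑ i, ∑ j, h.r (c i) * f.r ⁅d i, c j⁆ * g.r (d j))) := by
  have hf : f ∈ [f, g, h] := by simp
  have hg : g ∈ [f, g, h] := by simp
  have hh : h ∈ [f, g, h] := by simp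
  have hll' : ∀ k ∈ [f, g, h], ∀ x y, k.ll x y - k.ll y x = 1 * k.l ⁅x, y⁆ := by simpa using hll
  have hrr' : ∀ k ∈ [f, g, h], ∀ x y, k.rr x y - k.rr y x = (-1) * k.r ⁅x, y⁆ := by
    simpa using hrr
  simp only [iterBracket_eq]
  -- The terms are grouped by the function that carries the second derivative, and the `secondOrder`
  -- terms cancel within each group. The sign `-1` is that of the bracket of right-invariant fields.
  linear_combination sum_pure_eq 1 f.l h.l g.l g.ll a b (hll' g hg) +
    sum_pure_eq 1 g.l f.l h.l h.ll a b (hll' h hh) +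
    sum_pure_eq 1 h.l g.l f.l f.ll a b (hll' f hf) +
    sum_pure_eq (-1) f.r h.r g.r g.rr c d (hrr' g hg) +
    sum_pure_eq (-1) g.r f.r h.r h.rr c d (hrr' h hh) +
    sum_pure_eq (-1) h.r g.r f.r f.rr c d (hrr' f hf) -
    sum_mixed_eq a b c d f.l h.l f.r h.r g.ll g.rr g.lr (hΩl g hg h hh) (hΩr g hg h hh) -
    sum_mixed_eq a b c d g.l f.l g.r f.r h.ll h.rr h.lr (hΩl h hh f hf) (hΩr h hh f hf) -
    sum_mixed_eq a b c d h.l g.l h.r g.r f.ll f.rr f.lr (hΩl f hf g hg) (hΩr f hf g hg)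

end TwoJet
end Jets

/-! ### The contribution of the invariant symmetric part. -/

section InvariantSymmetricPart

variable {L : Type*} [LieRing L] [LieAlgebra ℂ L]

/-- The correction to `CYB` depends only on `Ω`, so it is common to every tensor with this symmetric
part. It is recognized as `[Ω¹², Ω¹³]` by writing `Ω` as a sum over `ι ⊕ ι`, both orders of the
factors included. -/
theorem pair3_CYB_of_isInvariant {ι : Type*} [Fintype ι] (a b : ι → L) {Ω : L ⊗[ℂ] L}
    (hb : ∑ i, a i ⊗ₜ[ℂ] b i + flip (∑ i, a i ⊗ₜ[ℂ] b i) = Ω) (hΩ : IsInvariant ⊤ Ω)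
    (ξ η ζ : L →ₗ[ℂ] ℂ) :
    (∑ i, ∑ j, ξ (a i) * η ⁅b i, a j⁆ * ζ (b j)) +
      (∑ i, ∑ j, η (a i) * ζ ⁅b i, a j⁆ * ξ (b j)) +
      (∑ i, ∑ j, ζ (a i) * ξ ⁅b i, a j⁆ * η (b j)) =
    pair3 ξ η ζ (CYB (∑ i, a i ⊗ₜ[ℂ] b i)) - pair3 ξ η ζ (br1213 Ω Ω) := by
  have hflip : flip (∑ i, a i ⊗ₜ[ℂ] b i) = ∑ i, b i ⊗ₜ[ℂ] a i := by
    simp only [flip, map_sum, TensorProduct.comm_tmul]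
  rw [hflip] at hb
  have hinv : ∀ (x : L) (ξ ζ : L →ₗ[ℂ] ℂ),
      ∑ i, (ξ ⁅x, a i⁆ * ζ (b i) + ξ (a i) * ζ ⁅x, b i⁆ +
        (ξ ⁅x, b i⁆ * ζ (a i) + ξ (b i) * ζ ⁅x, a i⁆)) = 0 := by
    intro x ξ ζ
    have h := congrArg (pair2 ξ ζ) (hΩ x trivial)
    rw [← hb, lie_add, lie_sum, lie_sum] at h
    simp only [TensorProduct.LieModule.lie_tmul_right, map_add, map_sum, pair2_tmul, map_zero] at h
    rw [← h, ← Finset.sum_add_distrib]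
  have hz : pair3 ξ η ζ (br1213 Ω Ω) =
      ∑ i, ∑ j, ((ξ ⁅a i, a j⁆ * η (b i) * ζ (b j) + ξ ⁅a i, b j⁆ * η (b i) * ζ (a j)) +
        (ξ ⁅b i, a j⁆ * η (a i) * ζ (b j) + ξ ⁅b i, b j⁆ * η (a i) * ζ (a j))) := by
    have hs : Ω = ∑ i : ι ⊕ ι, Sum.elim a b i ⊗ₜ[ℂ] Sum.elim b a i := by
      rw [← hb, Fintype.sum_sum_type]
      rfl
    rw [hs, pair3_br1213]
    simp only [Fintype.sum_sum_type, Sum.elim_inl, Sum.elim_inr, Finset.sum_add_distrib]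
    ring
  rw [sum_cyclic_br1223 ξ η ζ a b hinv, hz]

/-- Applied to `Ad g`, this passes the invariance of `Ω` on to `[Ω¹², Ω¹³]`. -/
theorem map3_br1213 {f : L →ₗ[ℂ] L} (hf : ∀ x y, f ⁅x, y⁆ = ⁅f x, f y⁆) (s t : L ⊗[ℂ] L) :
    map3 f (br1213 s t) = br1213 (map2 f s) (map2 f t) := by
  induction s using TensorProduct.induction_on with
  | zero => simp [br1213]
  | add s s' hs hs' =>
    have h : ∀ x y z : L ⊗[ℂ] L, br1213 (x + y) z = br1213 x z + br1213 y z := by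
      intro x y z; simp only [br1213, TensorProduct.add_tmul, map_add]
    rw [h, map_add, hs, hs', map_add, h]
  | tmul a b =>
    induction t using TensorProduct.induction_on with
    | zero => simp [br1213]
    | add t t' ht ht' =>
      have h : ∀ x y z : L ⊗[ℂ] L, br1213 x (y + z) = br1213 x y + br1213 x z := by
        intro x y z; simp only [br1213, TensorProduct.tmul_add, map_add]
      rw [h, map_add, ht, ht', map_add, h]
    | tmul c d =>
      simp [br1213, bracketMap_tmul, hf]

end InvariantSymmetricPart

/-! ### The Jacobiator on the group. -/

section GroupBracket

variable {E : Type*} [NormedAddCommGroup E] [NormedSpace ℂ E]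
  {G : Type*} [TopologicalSpace G] [ChartedSpace E G] [Group G]

/-- The bracket of functions on a Lie group defined by `fieldOnGroup ρ b`. -/
def groupBracket (ρ b : GroupLieAlgebra 𝓘(ℂ, E) G ⊗[ℂ] GroupLieAlgebra 𝓘(ℂ, E) G)
    (f h : G → ℂ) (g : G) : ℂ :=
  pair2 (leftD E f g).toLinearMap (leftD E h g).toLinearMap b -
    pair2 (rightD E f g).toLinearMap (rightD E h g).toLinearMap ρ

variable (E) in
/-- The two-jet of a function on a Lie group. -/
def twoJet (f : G → ℂ) (g : G) : TwoJet (GroupLieAlgebra 𝓘(ℂ, E) G) where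
  l := (leftD E f g).toLinearMap
  r := (rightD E f g).toLinearMap
  ll x y := leftD E (fun h => leftD E f h y) g x
  rr x y := rightD E (fun h => rightD E f h y) g x
  lr x y := leftD E (fun h => rightD E f h y) g x

theorem groupBracket_sum {ι κ : Type*} [Fintype ι] [Fintype κ]
    (a b : ι → GroupLieAlgebra 𝓘(ℂ, E) G) (c d : κ → GroupLieAlgebra 𝓘(ℂ, E) G)
    (f h : G → ℂ) (g : G) :
    groupBracket (∑ j, c j ⊗ₜ[ℂ] d j) (∑ i, a i ⊗ₜ[ℂ] b i) f h g =
      ∑ i, leftD E f g (a i) * leftD E h g (b i) -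
        ∑ j, rightD E f g (c j) * rightD E h g (d j) := by
  simp only [groupBracket, map_sum, pair2_tmul]
  rfl

variable [LieGroup 𝓘(ℂ, E) ω G]

theorem contMDiffAt_groupBracket (ρ b : GroupLieAlgebra 𝓘(ℂ, E) G ⊗[ℂ] GroupLieAlgebra 𝓘(ℂ, E) G)
    {f h : G → ℂ} {g : G} (hf : ContMDiffAt 𝓘(ℂ, E) 𝓘(ℂ, ℂ) ω f g)
    (hh : ContMDiffAt 𝓘(ℂ, E) 𝓘(ℂ, ℂ) ω h g) :
    ContMDiffAt 𝓘(ℂ, E) 𝓘(ℂ, ℂ) ω (groupBracket ρ b f h) g := by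
  obtain ⟨n, a, b, rfl⟩ := exists_sum_tmul b
  obtain ⟨m, c, d, rfl⟩ := exists_sum_tmul ρ
  have e := groupBracket_sum (E := E) a b c d f h
  refine ContMDiffAt.congr_of_eventuallyEq ?_ (Filter.Eventually.of_forall e)
  refine ContMDiffAt.sub (contMDiffAt_finsetSum fun i _ => ?_)
    (contMDiffAt_finsetSum fun i _ => ?_)
  · exact (contMDiffAt_leftD hf _).mul (contMDiffAt_leftD hh _)
  · exact (contMDiffAt_rightD hf _).mul (contMDiffAt_rightD hh _)

theorem dAt_sum_mul_sub_sum_mul {M : Type*} [TopologicalSpace M] [ChartedSpace E M]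
    {ι κ : Type*} [Fintype ι] [Fintype κ] {p q : ι → M → ℂ} {r s : κ → M → ℂ} {x : M}
    (hp : ∀ i, MDifferentiableAt 𝓘(ℂ, E) 𝓘(ℂ, ℂ) (p i) x)
    (hq : ∀ i, MDifferentiableAt 𝓘(ℂ, E) 𝓘(ℂ, ℂ) (q i) x)
    (hr : ∀ i, MDifferentiableAt 𝓘(ℂ, E) 𝓘(ℂ, ℂ) (r i) x)
    (hs : ∀ i, MDifferentiableAt 𝓘(ℂ, E) 𝓘(ℂ, ℂ) (s i) x) (v : E) :
    dAt E (fun y => ∑ i, p i y * q i y - ∑ j, r j y * s j y) x v =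
      ∑ i, (dAt E (p i) x v * q i x + p i x * dAt E (q i) x v) -
        ∑ j, (dAt E (r j) x v * s j x + r j x * dAt E (s j) x v) := by
  have hpq : ∀ i, MDifferentiableAt 𝓘(ℂ, E) 𝓘(ℂ, ℂ) (fun y => p i y * q i y) x :=
    fun i => (hp i).mul (hq i)
  have hrs : ∀ i, MDifferentiableAt 𝓘(ℂ, E) 𝓘(ℂ, ℂ) (fun y => r i y * s i y) x :=
    fun i => (hr i).mul (hs i)
  rw [dAt_sub_apply (mdifferentiableAt_sum _ fun i _ => hpq i)
    (mdifferentiableAt_sum _ fun i _ => hrs i),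
    dAt_sum_apply _ (fun i _ => hpq i), dAt_sum_apply _ (fun i _ => hrs i)]
  congr 1
  · exact Finset.sum_congr rfl fun i _ => dAt_mul_apply (hp i) (hq i) v
  · exact Finset.sum_congr rfl fun i _ => dAt_mul_apply (hr i) (hs i) v

theorem pair2_leftD_eq_pair2_rightD {Ω : GroupLieAlgebra 𝓘(ℂ, E) G ⊗[ℂ] GroupLieAlgebra 𝓘(ℂ, E) G}
    (hΩ : ∀ g : G, map2 (Ad E g).toLinearMap Ω = Ω) {f h : G → ℂ} {g : G}
    (hf : ContMDiffAt 𝓘(ℂ, E) 𝓘(ℂ, ℂ) ω f g) (hh : ContMDiffAt 𝓘(ℂ, E) 𝓘(ℂ, ℂ) ω h g) :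
    pair2 (leftD E f g).toLinearMap (leftD E h g).toLinearMap Ω =
      pair2 (rightD E f g).toLinearMap (rightD E h g).toLinearMap Ω := by
  conv_rhs => rw [← hΩ g, pair2_map2]
  congr 2
  · exact LinearMap.ext fun x => leftD_eq_rightD_Ad (hf.mdifferentiableAt (by simp)) x
  · exact LinearMap.ext fun x => leftD_eq_rightD_Ad (hh.mdifferentiableAt (by simp)) x

variable [CompleteSpace E]

section Sums

variable {ι κ : Type*} [Fintype ι] [Fintype κ]
    (a b : ι → GroupLieAlgebra 𝓘(ℂ, E) G) (c d : κ → GroupLieAlgebra 𝓘(ℂ, E) G)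
    {f h : G → ℂ} {g : G}

theorem leftD_groupBracket (hf : ContMDiffAt 𝓘(ℂ, E) 𝓘(ℂ, ℂ) ω f g)
    (hh : ContMDiffAt 𝓘(ℂ, E) 𝓘(ℂ, ℂ) ω h g) (x : GroupLieAlgebra 𝓘(ℂ, E) G) :
    leftD E (groupBracket (∑ j, c j ⊗ₜ[ℂ] d j) (∑ i, a i ⊗ₜ[ℂ] b i) f h) g x =
      TwoJet.bracketL a b c d (twoJet E f g) (twoJet E h g) x := by
  have hm : ∀ {k : G → ℂ}, ContMDiffAt 𝓘(ℂ, E) 𝓘(ℂ, ℂ) ω k g →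
      MDifferentiableAt 𝓘(ℂ, E) 𝓘(ℂ, ℂ) (fun y => k (g * y)) 1 := fun hk =>
    MDifferentiableAt.comp (g := _) (f := fun y => g * y) 1
      (by simpa using hk.mdifferentiableAt (by simp))
      ((contMDiff_mul_left' E g).mdifferentiableAt (by simp))
  have h1 := dAt_sum_mul_sub_sum_mul (E := E) (x := (1 : G))
    (fun i => hm (contMDiffAt_leftD hf (a i))) (fun i => hm (contMDiffAt_leftD hh (b i)))
    (fun j => hm (contMDiffAt_rightD hf (c j))) (fun j => hm (contMDiffAt_rightD hh (d j))) x
  simp only [mul_one] at h1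
  rw [show groupBracket (∑ j, c j ⊗ₜ[ℂ] d j) (∑ i, a i ⊗ₜ[ℂ] b i) f h = _ from
    funext fun y => groupBracket_sum a b c d f h y]
  exact h1

theorem rightD_groupBracket (hf : ContMDiffAt 𝓘(ℂ, E) 𝓘(ℂ, ℂ) ω f g)
    (hh : ContMDiffAt 𝓘(ℂ, E) 𝓘(ℂ, ℂ) ω h g) (x : GroupLieAlgebra 𝓘(ℂ, E) G) :
    rightD E (groupBracket (∑ j, c j ⊗ₜ[ℂ] d j) (∑ i, a i ⊗ₜ[ℂ] b i) f h) g x =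
      TwoJet.bracketR a b c d (twoJet E f g) (twoJet E h g) x := by
  have hm : ∀ {k : G → ℂ}, ContMDiffAt 𝓘(ℂ, E) 𝓘(ℂ, ℂ) ω k g →
      MDifferentiableAt 𝓘(ℂ, E) 𝓘(ℂ, ℂ) (fun y => k (y * g)) 1 := fun hk =>
    MDifferentiableAt.comp (g := _) (f := fun y => y * g) 1
      (by simpa using hk.mdifferentiableAt (by simp))
      ((contMDiff_mul_right' E g).mdifferentiableAt (by simp))
  have h1 := dAt_sum_mul_sub_sum_mul (E := E) (x := (1 : G))
    (fun i => hm (contMDiffAt_leftD hf (a i))) (fun i => hm (contMDiffAt_leftD hh (b i)))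
    (fun j => hm (contMDiffAt_rightD hf (c j))) (fun j => hm (contMDiffAt_rightD hh (d j))) x
  simp only [one_mul] at h1
  rw [show groupBracket (∑ j, c j ⊗ₜ[ℂ] d j) (∑ i, a i ⊗ₜ[ℂ] b i) f h = _ from
    funext fun y => groupBracket_sum a b c d f h y]
  simp only [TwoJet.bracketR, twoJet, leftD_rightD_comm hf, leftD_rightD_comm hh]
  exact h1

theorem groupBracket_groupBracket (k : G → ℂ) (hf : ContMDiffAt 𝓘(ℂ, E) 𝓘(ℂ, ℂ) ω f g)
    (hh : ContMDiffAt 𝓘(ℂ, E) 𝓘(ℂ, ℂ) ω h g) :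
    groupBracket (∑ j, c j ⊗ₜ[ℂ] d j) (∑ i, a i ⊗ₜ[ℂ] b i) k
      (groupBracket (∑ j, c j ⊗ₜ[ℂ] d j) (∑ i, a i ⊗ₜ[ℂ] b i) f h) g =
    TwoJet.iterBracket a b c d (twoJet E k g) (twoJet E f g) (twoJet E h g) := by
  rw [groupBracket_sum]
  simp only [leftD_groupBracket a b c d hf hh, rightD_groupBracket a b c d hf hh]
  rfl

end Sums

theorem pair2_sum_add_flip {V : Type*} [AddCommGroup V] [Module ℂ V] {ι : Type*} [Fintype ι]
    (a b : ι → V) (ξ η : V →ₗ[ℂ] ℂ) :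
    pair2 ξ η (∑ i, a i ⊗ₜ[ℂ] b i + flip (∑ i, a i ⊗ₜ[ℂ] b i)) =
      ∑ i, (ξ (a i) * η (b i) + ξ (b i) * η (a i)) := by
  simp only [flip, map_add, map_sum, TensorProduct.comm_tmul, pair2_tmul, Finset.sum_add_distrib]

/-- The Jacobiator of the bracket defined by `fieldOnGroup ρ b`. -/
theorem sum_cyclic_groupBracket
    {ρ b Ω : GroupLieAlgebra 𝓘(ℂ, E) G ⊗[ℂ] GroupLieAlgebra 𝓘(ℂ, E) G}
    (hρ : ρ + flip ρ = Ω) (hb : b + flip b = Ω) (hΩ : IsInvariant ⊤ Ω)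
    (hAd : ∀ g : G, map2 (Ad E g).toLinearMap Ω = Ω) {f h k : G → ℂ} {g : G}
    (hf : ContMDiffAt 𝓘(ℂ, E) 𝓘(ℂ, ℂ) ω f g) (hh : ContMDiffAt 𝓘(ℂ, E) 𝓘(ℂ, ℂ) ω h g)
    (hk : ContMDiffAt 𝓘(ℂ, E) 𝓘(ℂ, ℂ) ω k g) :
    groupBracket ρ b f (groupBracket ρ b h k) g + groupBracket ρ b h (groupBracket ρ b k f) g +
      groupBracket ρ b k (groupBracket ρ b f h) g =
    pair3 (leftD E f g).toLinearMap (leftD E h g).toLinearMap (leftD E k g).toLinearMap (CYB b) -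
      pair3 (rightD E f g).toLinearMap (rightD E h g).toLinearMap (rightD E k g).toLinearMap
        (CYB ρ) := by
  obtain ⟨n, a, b, rfl⟩ := exists_sum_tmul b
  obtain ⟨m, c, d, rfl⟩ := exists_sum_tmul ρ
  rw [groupBracket_groupBracket a b c d f hh hk, groupBracket_groupBracket a b c d h hk hf,
    groupBracket_groupBracket a b c d k hf hh]
  -- The corrections on the left and right sides agree, since left derivatives are right derivatives
  -- composed with `Ad g`.
  have hz : pair3 (leftD E f g).toLinearMap (leftD E h g).toLinearMap (leftD E k g).toLinearMap
      (br1213 Ω Ω) = pair3 (rightD E f g).toLinearMap (rightD E h g).toLinearMap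
        (rightD E k g).toLinearMap (br1213 Ω Ω) := by
    have e : ∀ {f : G → ℂ}, ContMDiffAt 𝓘(ℂ, E) 𝓘(ℂ, ℂ) ω f g → (leftD E f g).toLinearMap =
        (rightD E f g).toLinearMap ∘ₗ (Ad E g).toLinearMap := fun hf =>
      LinearMap.ext fun x => leftD_eq_rightD_Ad (hf.mdifferentiableAt (by simp)) x
    rw [e hf, e hh, e hk, ← pair3_map3, map3_br1213 (Ad_bracket g), hAd]
  have hmem : ∀ q ∈ [twoJet E f g, twoJet E h g, twoJet E k g],
      ∃ q' : G → ℂ, ContMDiffAt 𝓘(ℂ, E) 𝓘(ℂ, ℂ) ω q' g ∧ twoJet E q' g = q := by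
    intro q hq
    simp only [List.mem_cons, List.not_mem_nil, or_false] at hq
    rcases hq with rfl | rfl | rfl
    exacts [⟨f, hf, rfl⟩, ⟨h, hh, rfl⟩, ⟨k, hk, rfl⟩]
  have e1 := pair3_CYB_of_isInvariant a b hb hΩ (leftD E f g).toLinearMap
    (leftD E h g).toLinearMap (leftD E k g).toLinearMap
  have e2 := pair3_CYB_of_isInvariant c d hρ hΩ (rightD E f g).toLinearMap
    (rightD E h g).toLinearMap (rightD E k g).toLinearMap
  refine (TwoJet.sum_cyclic_iterBracket a b c d _ _ _ ?_ ?_ ?_ ?_).trans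
    ((congrArg₂ (· - ·) e1 e2).trans (by rw [hz]; ring))
  · intro q hq x y
    obtain ⟨q', hq', rfl⟩ := hmem q hq
    exact (leftD_bracket hq' x y).symm
  · intro q hq x y
    obtain ⟨q', hq', rfl⟩ := hmem q hq
    have := rightD_bracket hq' x y
    simp only [twoJet]
    rw [ContinuousLinearMap.coe_coe, this]
    ring
  -- `Ω^L = Ω^R` is applied to the left derivative of `q'` along `x` in place of `q'`. Commuting
  -- left with right derivatives then puts the second derivatives in the order of `lr`.
  · intro q hq p hp x
    obtain ⟨q', hq', rfl⟩ := hmem q hq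
    obtain ⟨p', hp', rfl⟩ := hmem p hp
    have := pair2_leftD_eq_pair2_rightD hAd (contMDiffAt_leftD hq' x) hp'
    conv_lhs at this => rw [← hb, pair2_sum_add_flip]
    conv_rhs at this => rw [← hρ, pair2_sum_add_flip]
    simp only [ContinuousLinearMap.coe_coe, ← leftD_rightD_comm hq'] at this
    exact this
  · intro q hq p hp y
    obtain ⟨q', hq', rfl⟩ := hmem q hq
    obtain ⟨p', hp', rfl⟩ := hmem p hp
    have := pair2_leftD_eq_pair2_rightD hAd (contMDiffAt_rightD hq' y) hp'
    conv_lhs at this => rw [← hb, pair2_sum_add_flip]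
    conv_rhs at this => rw [← hρ, pair2_sum_add_flip]
    exact this

end GroupBracket

/-! ### Submersions and their local sections. -/

section MapD

variable (E E' : Type*) [NormedAddCommGroup E] [NormedSpace ℂ E]
  [NormedAddCommGroup E'] [NormedSpace ℂ E']
  {M : Type*} [TopologicalSpace M] [ChartedSpace E M]
  {N : Type*} [TopologicalSpace N] [ChartedSpace E' N]

/-- The derivative of a map of complex manifolds, as a map of the model spaces. -/
def mapD (c : M → N) (x : M) : E →L[ℂ] E' :=
  mfderiv 𝓘(ℂ, E) 𝓘(ℂ, E') c x

variable {E E'}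

theorem mapD_congr {c d : M → N} {x : M} (h : c =ᶠ[𝓝 x] d) : mapD E E' c x = mapD E E' d x :=
  h.mfderiv_eq

theorem mapD_id (x : M) : mapD E E (fun y : M => y) x = ContinuousLinearMap.id ℂ E :=
  mfderiv_id

theorem mapD_const (y : N) (x : M) : mapD E E' (fun _ : M => y) x = 0 :=
  mfderiv_const

theorem mapD_comp {E'' : Type*} [NormedAddCommGroup E''] [NormedSpace ℂ E'']
    {P : Type*} [TopologicalSpace P] [ChartedSpace E'' P] {d : N → P} {c : M → N} {x : M}
    (hd : MDifferentiableAt 𝓘(ℂ, E') 𝓘(ℂ, E'') d (c x))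
    (hc : MDifferentiableAt 𝓘(ℂ, E) 𝓘(ℂ, E') c x) :
    mapD E E'' (fun y => d (c y)) x = (mapD E' E'' d (c x)).comp (mapD E E' c x) :=
  mfderiv_comp x hd hc

theorem dAt_comp {W : Type*} [NormedAddCommGroup W] [NormedSpace ℂ W] {f : N → W} {c : M → N}
    {x : M} (hf : MDifferentiableAt 𝓘(ℂ, E') 𝓘(ℂ, W) f (c x))
    (hc : MDifferentiableAt 𝓘(ℂ, E) 𝓘(ℂ, E') c x) :
    dAt E (fun y => f (c y)) x = (dAt E' f (c x)).comp (mapD E E' c x) :=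
  mfderiv_comp x hf hc

/-- A submersion has local sections. -/
theorem exists_localSection [IsManifold 𝓘(ℂ, E) ω M] [IsManifold 𝓘(ℂ, E') ω N] {p : M → N} {x : M}
    (hp : Manifold.IsSubmersionAt 𝓘(ℂ, E) 𝓘(ℂ, E') ω p x) :
    ∃ s : N → M, ContMDiffAt 𝓘(ℂ, E') 𝓘(ℂ, E) ω s (p x) ∧ s (p x) = x ∧
      ∀ᶠ y in 𝓝 (p x), p (s y) = y := by
  set φ := hp.domChart
  set ψ := hp.codChart
  set e := hp.equiv
  have hφ : x ∈ φ.source := hp.mem_domChart_source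
  have hψ : p x ∈ ψ.source := hp.mem_codChart_source
  have hpe : ∀ z ∈ φ.target, ψ (p (φ.symm z)) = (e z).1 := fun z hz =>
    hp.writtenInCharts (by simpa using hz)
  have hz : ∀ z ∈ φ.target, p (φ.symm z) ∈ ψ.source := fun z hz =>
    hp.source_subset_preimage_source (φ.map_target hz)
  -- In adapted charts the submersion is the first projection. The section keeps the second
  -- coordinate at its value for `x`, so that it passes through `x`.
  set q : N → E := fun y => e.symm (ψ y, (e (φ x)).2)
  have hq : ContMDiffAt 𝓘(ℂ, E') 𝓘(ℂ, E) ω q (p x) := by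
    have h1 : ContMDiffAt 𝓘(ℂ, E') 𝓘(ℂ, E') ω ψ (p x) :=
      (contMDiffOn_of_mem_maximalAtlas hp.codChart_mem_maximalAtlas).contMDiffAt
        (ψ.open_source.mem_nhds hψ)
    have h2 : ContDiff ℂ ω (fun w : E' => e.symm (w, (e (φ x)).2)) :=
      e.symm.contDiff.comp (contDiff_id.prodMk contDiff_const)
    exact ContMDiffAt.comp (g := fun w : E' => e.symm (w, (e (φ x)).2)) (p x)
      h2.contDiffAt.contMDiffAt h1
  have hqx : q (p x) = φ x := by
    have := hpe (φ x) (φ.map_source hφ)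
    rw [φ.left_inv hφ] at this
    simp only [q, this, Prod.mk.eta, ContinuousLinearEquiv.symm_apply_apply]
  refine ⟨fun y => φ.symm (q y), ?_, by simp only [hqx, φ.left_inv hφ], ?_⟩
  · refine ContMDiffAt.comp (g := φ.symm) (I' := 𝓘(ℂ, E)) (p x) ?_ hq
    rw [hqx]
    exact (contMDiffOn_symm_of_mem_maximalAtlas hp.domChart_mem_maximalAtlas).contMDiffAt
      (φ.open_target.mem_nhds (φ.map_source hφ))
  · have h1 : ∀ᶠ y in 𝓝 (p x), q y ∈ φ.target :=
      hq.continuousAt.eventually_mem (φ.open_target.mem_nhds (by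
        rw [hqx]; exact φ.map_source hφ))
    filter_upwards [h1, ψ.open_source.mem_nhds hψ] with y hy hyψ
    refine ψ.injOn (hz _ hy) hyψ ?_
    rw [hpe _ hy]
    simp [q]

theorem mapD_surjective_of_isSubmersionAt [IsManifold 𝓘(ℂ, E) ω M] [IsManifold 𝓘(ℂ, E') ω N]
    {p : M → N} {x : M} (hp : Manifold.IsSubmersionAt 𝓘(ℂ, E) 𝓘(ℂ, E') ω p x) :
    Function.Surjective (mapD E E' p x) := by
  obtain ⟨s, hs, hsx, hps⟩ := exists_localSection hp
  intro v
  refine ⟨mapD E' E s (p x) v, ?_⟩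
  have h := mapD_comp (E'' := E') (d := p) (c := s) (x := p x)
    (by rw [hsx]; exact hp.contMDiffAt.mdifferentiableAt (by simp)) (hs.mdifferentiableAt (by simp))
  rw [mapD_congr (d := fun y => y) hps, mapD_id, hsx] at h
  exact (DFunLike.congr_fun h v).symm

/-- A function is holomorphic at a point if its pullback under a submersion is. -/
theorem contMDiffAt_of_comp_isSubmersionAt [IsManifold 𝓘(ℂ, E) ω M] [IsManifold 𝓘(ℂ, E') ω N]
    {W : Type*} [NormedAddCommGroup W] [NormedSpace ℂ W]
    {p : M → N} {x : M} (hp : Manifold.IsSubmersionAt 𝓘(ℂ, E) 𝓘(ℂ, E') ω p x) {f : N → W}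
    (hf : ContMDiffAt 𝓘(ℂ, E) 𝓘(ℂ, W) ω (fun y => f (p y)) x) :
    ContMDiffAt 𝓘(ℂ, E') 𝓘(ℂ, W) ω f (p x) := by
  obtain ⟨s, hs, hsx, hps⟩ := exists_localSection hp
  rw [← hsx] at hf
  refine (ContMDiffAt.comp (g := fun y => f (p y)) (p x) hf hs).congr_of_eventuallyEq ?_
  filter_upwards [hps] with y hy
  simp [hy]

end MapD

/-! ### The projection near the identity and its kernel. -/

section Quotient

variable {E : Type*} [NormedAddCommGroup E] [NormedSpace ℂ E]
  {G : Type*} [TopologicalSpace G] [ChartedSpace E G] [Group G] [LieGroup 𝓘(ℂ, E) ω G]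
  {F : Type*} [NormedAddCommGroup F] [NormedSpace ℂ F]
  {U : Subgroup G} [ChartedSpace F (G ⧸ U)] [IsManifold 𝓘(ℂ, F) ω (G ⧸ U)]

variable (E F) in
/-- Near the identity, a Lie group retracts onto a subgroup with a submersion to the quotient. -/
theorem exists_retraction
    (hp : Manifold.IsSubmersion 𝓘(ℂ, E) 𝓘(ℂ, F) ω (QuotientGroup.mk : G → G ⧸ U)) :
    ∃ r : G → G, ContMDiffAt 𝓘(ℂ, E) 𝓘(ℂ, E) ω r 1 ∧ (∀ᶠ h in 𝓝 1, r h ∈ U) ∧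
      (∀ u ∈ U, r u = u) ∧
      ∀ v : E, mapD E F (QuotientGroup.mk : G → G ⧸ U) 1 v = 0 → mapD E E r 1 v = v := by
  obtain ⟨s, hs, hs1, hps⟩ := exists_localSection (hp.isSubmersionAt (1 : G))
  have hmk : ContMDiff 𝓘(ℂ, E) 𝓘(ℂ, F) ω (QuotientGroup.mk : G → G ⧸ U) := hp.contMDiff
  -- The retraction is `h ↦ s(p(h))⁻¹ h`. It is factored through `K` so that on `ker dp` only the
  -- partial derivative in the second variable survives, and that one is the identity because
  -- `s(p(1)) = 1`.
  let K : (G ⧸ U) × G → G := fun z => (s z.1)⁻¹ * z.2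
  have hK : ContMDiffAt (𝓘(ℂ, F).prod 𝓘(ℂ, E)) 𝓘(ℂ, E) ω K
      ((QuotientGroup.mk 1 : G ⧸ U), (1 : G)) := by
    have h1 : ContMDiffAt (𝓘(ℂ, F).prod 𝓘(ℂ, E)) 𝓘(ℂ, E) ω (fun z : (G ⧸ U) × G => s z.1)
        ((QuotientGroup.mk 1 : G ⧸ U), (1 : G)) :=
      ContMDiffAt.comp (g := s) (f := Prod.fst) (I' := 𝓘(ℂ, F)) _ hs contMDiffAt_fst
    exact h1.inv.mul contMDiffAt_snd
  have hc : ContMDiffAt 𝓘(ℂ, E) (𝓘(ℂ, F).prod 𝓘(ℂ, E)) ω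
      (fun h : G => ((QuotientGroup.mk h : G ⧸ U), h)) 1 := hmk.contMDiffAt.prodMk contMDiffAt_id
  refine ⟨fun h => K (QuotientGroup.mk h, h), ContMDiffAt.comp (g := K) 1 hK hc, ?_, ?_, ?_⟩
  · filter_upwards [(hmk.continuous.continuousAt (x := 1)).eventually hps] with h hh
    exact QuotientGroup.eq.1 hh
  · intro u hu
    have : (QuotientGroup.mk u : G ⧸ U) = QuotientGroup.mk 1 :=
      QuotientGroup.eq.2 (by simpa using hu)
    simp only [K, this, hs1, inv_one, one_mul]
  · intro v hv
    have hKd := hK.mdifferentiableAt (by simp)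
    have e1 := DFunLike.congr_fun
      (mfderiv_comp (g := K) (f := fun h : G => ((QuotientGroup.mk h : G ⧸ U), h)) (1 : G)
        hKd (hc.mdifferentiableAt (by simp))) v
    have e2 := DFunLike.congr_fun (mfderiv_prodMk (hmk.contMDiffAt.mdifferentiableAt (by simp))
      (mdifferentiableAt_id (I := 𝓘(ℂ, E)) (x := (1 : G)))) v
    have hK1 : ∀ y : G, K ((QuotientGroup.mk 1 : G ⧸ U), y) = y := fun y => by
      simp only [K, hs1, inv_one, one_mul]
    have e3 : ∀ w : E, (mfderiv (𝓘(ℂ, F).prod 𝓘(ℂ, E)) 𝓘(ℂ, E) K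
        ((QuotientGroup.mk 1 : G ⧸ U), (1 : G)) : F × E →L[ℂ] E) (0, w) = w := by
      intro w
      refine (mfderiv_prod_eq_add_apply (v := ((0 : F), w)) hKd).trans ?_
      have h1 : mapD E E (fun y => K ((QuotientGroup.mk 1 : G ⧸ U), y)) 1 w = w := by
        simp only [hK1, mapD_id, ContinuousLinearMap.id_apply]
      refine (congrArg₂ (fun a b : E => a + b) (map_zero (mapD F E
        (fun y => K (y, (1 : G))) (QuotientGroup.mk 1))) h1).trans (zero_add w)
    have e4 : (mapD E F (QuotientGroup.mk : G → G ⧸ U) 1 v, v) = (0, v) := by rw [hv]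
    exact e1.trans ((congrArg (mfderiv (𝓘(ℂ, F).prod 𝓘(ℂ, E)) 𝓘(ℂ, E) K
        ((QuotientGroup.mk 1 : G ⧸ U), (1 : G)) : F × E →L[ℂ] E)
        (((e2.trans (by rw [mfderiv_id]; rfl))).trans e4)).trans (e3 v))

/-- A curve in `U` has constant projection, which gives one inclusion. Conversely the retraction
onto `U` fixes vectors of `ker dp`, so each of them is the velocity of a curve in `U`. -/
theorem mapD_mk_eq_zero_iff
    (hp : Manifold.IsSubmersion 𝓘(ℂ, E) 𝓘(ℂ, F) ω (QuotientGroup.mk : G → G ⧸ U))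
    (v : GroupLieAlgebra 𝓘(ℂ, E) G) :
    mapD E F (QuotientGroup.mk : G → G ⧸ U) 1 v = 0 ↔ v ∈ lieAlgebraOf E U := by
  constructor
  · intro hv
    obtain ⟨r, hr, hrU, hr1, hrv⟩ := exists_retraction E F hp
    have h := mfderiv_mem_lieAlgebraOf E U hr (hr1 1 U.one_mem) hrU v
    have h' : ∀ w : E, w = v → w ∈ (lieAlgebraOf E U : Submodule ℂ (GroupLieAlgebra 𝓘(ℂ, E) G)) →
      v ∈ lieAlgebraOf E U := fun w hw hm => by rw [hw] at hm; exact hm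
    exact h' _ (hrv v hv) h
  -- Stated for an arbitrary base point `g = γ 0`, so that substituting it turns the heterogeneous
  -- equality of tangent vectors into an ordinary one.
  · have key : ∀ (γ : ℂ → G) (g : G), γ 0 = g → (∀ᶠ t in 𝓝 (0 : ℂ), γ t ∈ U) →
        ContMDiffAt 𝓘(ℂ, ℂ) 𝓘(ℂ, E) ω γ 0 → ∀ v : TangentSpace 𝓘(ℂ, E) g,
        HEq v (mfderiv 𝓘(ℂ, ℂ) 𝓘(ℂ, E) γ 0 (1 : ℂ)) →
        mapD E F (QuotientGroup.mk : G → G ⧸ U) g v = 0 := by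
      rintro γ _ rfl hγU hγ v hv
      obtain rfl := eq_of_heq hv
      have h := mapD_comp (E := ℂ) (E'' := F) (d := (QuotientGroup.mk : G → G ⧸ U))
        (hp.contMDiff.contMDiffAt.mdifferentiableAt (by simp)) (hγ.mdifferentiableAt (by simp))
      rw [mapD_congr (d := fun _ => QuotientGroup.mk 1), mapD_const] at h
      · exact (DFunLike.congr_fun h (1 : ℂ)).symm
      · filter_upwards [hγU] with t ht
        exact QuotientGroup.eq.2 (by simpa using ht)
    intro hv
    refine Submodule.span_induction (p := fun (v : GroupLieAlgebra 𝓘(ℂ, E) G) _ =>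
      mapD E F (QuotientGroup.mk : G → G ⧸ U) 1 v = 0) ?_ (map_zero _) ?_ ?_ hv
    · rintro v ⟨γ, h1, hγU, hγ, hv⟩
      exact key γ 1 h1 hγU hγ v hv
    · intro x y _ _ hx hy
      exact (map_add (mapD E F (QuotientGroup.mk : G → G ⧸ U) 1) (x : E) y).trans
        ((congrArg₂ (fun a b : F => a + b) hx hy).trans (add_zero 0))
    · intro c x _ hx
      exact (map_smul (mapD E F (QuotientGroup.mk : G → G ⧸ U) 1) c (x : E)).trans
        ((congrArg (fun a : F => c • a) hx).trans (smul_zero c))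

/-- Invariance under the Lie algebra of a connected subgroup implies invariance under the
subgroup. -/
theorem map2_Ad_eq_of_isSubmersion [FiniteDimensional ℂ E] [CompleteSpace E]
    (hp : Manifold.IsSubmersion 𝓘(ℂ, E) 𝓘(ℂ, F) ω (QuotientGroup.mk : G → G ⧸ U))
    (hU : IsConnected (U : Set G))
    {b : GroupLieAlgebra 𝓘(ℂ, E) G ⊗[ℂ] GroupLieAlgebra 𝓘(ℂ, E) G}
    (hb : IsInvariant (lieAlgebraOf E U) b) {u : G} (hu : u ∈ U) :
    map2 (Ad E u).toLinearMap b = b := by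
  obtain ⟨r, hr, hrU, hr1, -⟩ := exists_retraction E F hp
  exact map2_Ad_eq_of_isInvariant U hU hr hrU hr1 hb hu

/-- The case `U = G`, with the identity map as retraction. -/
theorem map2_Ad_eq_of_connectedSpace [FiniteDimensional ℂ E] [CompleteSpace E] [ConnectedSpace G]
    {b : GroupLieAlgebra 𝓘(ℂ, E) G ⊗[ℂ] GroupLieAlgebra 𝓘(ℂ, E) G}
    (hb : IsInvariant ⊤ b) (g : G) : map2 (Ad E g).toLinearMap b = b :=
  map2_Ad_eq_of_isInvariant ⊤ (by simpa using isConnected_univ) (r := fun h => h) contMDiffAt_id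
    (by simp) (fun _ _ => rfl) (fun x _ => hb x trivial) (Subgroup.mem_top g)

end Quotient

/-! ### The field on the quotient: well-definedness, skewness and multiplicativity. -/

section QuotientField

variable {E : Type*} [NormedAddCommGroup E] [NormedSpace ℂ E]
  {G : Type*} [TopologicalSpace G] [ChartedSpace E G] [Group G]
  (F : Type*) [NormedAddCommGroup F] [NormedSpace ℂ F]
  (U : Subgroup G) [ChartedSpace F (G ⧸ U)]

/-- The derivative at the identity of `y ↦ p(g y h)`. -/
def projMul (g h : G) : GroupLieAlgebra 𝓘(ℂ, E) G →L[ℂ] F :=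
  mapD E F (fun y : G => (QuotientGroup.mk (g * y * h) : G ⧸ U)) 1

/-- The value of `quotientField` at `p(g)`, as a tensor on the model space. -/
def quotientValue (ρ b : GroupLieAlgebra 𝓘(ℂ, E) G ⊗[ℂ] GroupLieAlgebra 𝓘(ℂ, E) G) (g : G) :
    F ⊗[ℂ] F :=
  map2 (projMul F U g 1).toLinearMap b - map2 (projMul F U 1 g).toLinearMap ρ

variable {F U}

theorem projMul_mul_mem (g h : G) {u : G} (hu : u ∈ U) :
    projMul (E := E) F U g (h * u) = projMul F U g h := by
  have : (fun y : G => (QuotientGroup.mk (g * y * (h * u)) : G ⧸ U)) =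
      fun y => QuotientGroup.mk (g * y * h) := funext fun y => by
    rw [← mul_assoc]
    exact QuotientGroup.mk_mul_of_mem _ hu
  exact congrArg (fun c => mapD E F c 1) this

theorem projMul_one_eq_mapD (a : GroupLieAlgebra 𝓘(ℂ, E) G) :
    projMul F U 1 1 a = mapD E F (QuotientGroup.mk : G → G ⧸ U) 1 a := by
  simp only [projMul, mul_one, one_mul]
  rfl

theorem rec_eq_of_model {x y : G ⧸ U} (h : x = y)
    (t : TangentSpace 𝓘(ℂ, F) x ⊗[ℂ] TangentSpace 𝓘(ℂ, F) x) :
    ((h ▸ t : TangentSpace 𝓘(ℂ, F) y ⊗[ℂ] TangentSpace 𝓘(ℂ, F) y) : F ⊗[ℂ] F) = t := by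
  subst h
  rfl

theorem infinitesimalAction_mk (g : G) :
    (infinitesimalAction (QuotientGroup.mk g : G ⧸ U) : GroupLieAlgebra 𝓘(ℂ, E) G →L[ℂ] F) =
      projMul F U 1 g := by
  have h : ∀ {x y : G ⧸ U} (h : x = y)
      (A : GroupLieAlgebra 𝓘(ℂ, E) G →L[ℂ] TangentSpace 𝓘(ℂ, F) x),
      ((h ▸ A : GroupLieAlgebra 𝓘(ℂ, E) G →L[ℂ] TangentSpace 𝓘(ℂ, F) y) :
        GroupLieAlgebra 𝓘(ℂ, E) G →L[ℂ] F) = A := by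
    rintro x _ rfl A
    rfl
  refine (h (one_smul G (QuotientGroup.mk g : G ⧸ U)) _).trans ?_
  have h2 : (fun y : G => (QuotientGroup.mk (1 * y * g) : G ⧸ U)) =
      fun y => y • (QuotientGroup.mk g : G ⧸ U) := funext fun y => by
    rw [one_mul]
    rfl
  exact (congrArg (fun c => mapD E F c 1) h2).symm

variable [LieGroup 𝓘(ℂ, E) ω G]

theorem mapD_conj (g : G) (a : E) : mapD E E (fun y : G => g * y * g⁻¹) 1 a = modelAd E g a := by
  have hf : MDifferentiableAt 𝓘(ℂ, E) 𝓘(ℂ, E) (extChartAt 𝓘(ℂ, E) (1 : G)) 1 :=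
    contMDiffAt_extChartAt_one.mdifferentiableAt (by simp)
  have h := (dAt_comp_conj_eq_mfderiv hf g a).symm.trans (dAt_comp_conj hf g a)
  rw [dAt_extChartAt] at h
  exact h

section

variable (hmk : ContMDiff 𝓘(ℂ, E) 𝓘(ℂ, F) ω (QuotientGroup.mk : G → G ⧸ U))
include hmk

theorem mdifferentiable_mk_mul (g h : G) :
    MDifferentiable 𝓘(ℂ, E) 𝓘(ℂ, F) (fun y : G => (QuotientGroup.mk (g * y * h) : G ⧸ U)) :=
  (hmk.comp ((contMDiff_mul_right' E h).comp (contMDiff_mul_left' E g))).mdifferentiable (by simp)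

theorem projMul_left_eq (g : G) (a : GroupLieAlgebra 𝓘(ℂ, E) G) :
    projMul F U g 1 a = (projDeriv F U g (leftMulDeriv g a) : F) := by
  have h := mapD_comp (E'' := F) (d := (QuotientGroup.mk : G → G ⧸ U)) (c := fun y : G => g * y)
    (x := 1) (hmk.mdifferentiable (by simp) _)
    ((contMDiff_mul_left' E g).mdifferentiable (by simp) _)
  have h' := DFunLike.congr_fun h (a : E)
  simp only [projMul, mul_one]
  simp only [mul_one] at h'
  exact h'

theorem projMul_right_eq (g : G) (a : GroupLieAlgebra 𝓘(ℂ, E) G) :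
    projMul F U 1 g a = (projDeriv F U g (rightMulDeriv g a) : F) := by
  have h := mapD_comp (E'' := F) (d := (QuotientGroup.mk : G → G ⧸ U)) (c := fun y : G => y * g)
    (x := 1) (hmk.mdifferentiable (by simp) _)
    ((contMDiff_mul_right' E g).mdifferentiable (by simp) _)
  have h' := DFunLike.congr_fun h (a : E)
  simp only [projMul, one_mul]
  simp only [one_mul] at h'
  exact h'

/-- From `g h y = g (h y h⁻¹) h`. With `h ∈ U` it yields independence of the representative; with `g
= 1` it compares left- and right-invariant fields on the quotient. -/
theorem projMul_mul_left (g h : G) (a : GroupLieAlgebra 𝓘(ℂ, E) G) :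
    projMul F U (g * h) 1 a = projMul F U g h (Ad E h a) := by
  have h1 := mapD_comp (E'' := F) (d := fun y : G => (QuotientGroup.mk (g * y * h) : G ⧸ U))
    (c := fun y : G => h * y * h⁻¹) (x := 1) (mdifferentiable_mk_mul hmk g h _)
    ((contMDiff_conj E h).mdifferentiable (by simp) _)
  have h2 : (fun y : G => (QuotientGroup.mk (g * (h * y * h⁻¹) * h) : G ⧸ U)) =
      fun y => QuotientGroup.mk (g * h * y * 1) := funext fun y => by group
  have h3 : projMul F U (g * h) 1 a =
      mapD E F (fun y : G => (QuotientGroup.mk (g * (h * y * h⁻¹) * h) : G ⧸ U)) 1 a := by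
    rw [h2]; rfl
  have h4 := DFunLike.congr_fun h1 (a : E)
  simp only [mul_one, mul_inv_cancel] at h4
  exact h3.trans (h4.trans (congrArg (mapD E F (fun y : G =>
    (QuotientGroup.mk (g * y * h) : G ⧸ U)) 1) (mapD_conj (E := E) h (a : E))))

/-- The derivative of the action on the left of a tangent vector. -/
theorem mapD_smul_projMul (hs : ∀ g : G, ContMDiff 𝓘(ℂ, F) 𝓘(ℂ, F) ω (fun x : G ⧸ U => g • x))
    (g k h : G) (a : GroupLieAlgebra 𝓘(ℂ, E) G) :
    mapD F F (fun x : G ⧸ U => g • x) (QuotientGroup.mk (k * h)) (projMul F U k h a) =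
      projMul F U (g * k) h a := by
  have h1 := mapD_comp (E'' := F) (d := fun x : G ⧸ U => g • x)
    (c := fun y : G => (QuotientGroup.mk (k * y * h) : G ⧸ U)) (x := 1)
    ((hs g).mdifferentiable (by simp) _) (mdifferentiable_mk_mul hmk k h _)
  have h2 : (fun y : G => g • (QuotientGroup.mk (k * y * h) : G ⧸ U)) =
      fun y => QuotientGroup.mk (g * k * y * h) := funext fun y => by
    rw [mul_assoc g, mul_assoc g]
    rfl
  rw [h2, mul_one] at h1
  exact (DFunLike.congr_fun h1 (a : E)).symm

theorem contMDiff_orbit (h : G) :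
    ContMDiff 𝓘(ℂ, E) 𝓘(ℂ, F) ω (fun y : G => y • (QuotientGroup.mk h : G ⧸ U)) :=
  hmk.comp (contMDiff_mul_right' E h)

theorem mapD_orbit_leftMulDeriv (g h : G) (a : GroupLieAlgebra 𝓘(ℂ, E) G) :
    mapD E F (fun y : G => y • (QuotientGroup.mk h : G ⧸ U)) g (leftMulDeriv g a) =
      projMul F U g h a := by
  have h1 := mapD_comp (E'' := F) (d := fun y : G => y • (QuotientGroup.mk h : G ⧸ U))
    (c := fun y : G => g * y) (x := 1) ((contMDiff_orbit hmk h).mdifferentiable (by simp) _)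
    ((contMDiff_mul_left' E g).mdifferentiable (by simp) _)
  have h2 := DFunLike.congr_fun h1 (a : E)
  simp only [mul_one] at h2
  exact h2.symm

theorem mapD_orbit_rightMulDeriv (g h : G) (a : GroupLieAlgebra 𝓘(ℂ, E) G) :
    mapD E F (fun y : G => y • (QuotientGroup.mk h : G ⧸ U)) g (rightMulDeriv g a) =
      projMul F U 1 (g * h) a := by
  have h1 := mapD_comp (E'' := F) (d := fun y : G => y • (QuotientGroup.mk h : G ⧸ U))
    (c := fun y : G => y * g) (x := 1) ((contMDiff_orbit hmk h).mdifferentiable (by simp) _)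
    ((contMDiff_mul_right' E g).mdifferentiable (by simp) _)
  have h2 := DFunLike.congr_fun h1 (a : E)
  have h3 : (fun y : G => (y * g) • (QuotientGroup.mk h : G ⧸ U)) =
      fun y => QuotientGroup.mk (1 * y * (g * h)) := funext fun y => by
    rw [one_mul, ← mul_assoc]
    rfl
  have h4 : projMul F U 1 (g * h) a =
      mapD E F (fun y : G => (y * g) • (QuotientGroup.mk h : G ⧸ U)) 1 a := by rw [h3]; rfl
  simp only [one_mul] at h2
  exact h2.symm.trans h4.symm

theorem map2_projDeriv_fieldOnGroup
    (ρ b : GroupLieAlgebra 𝓘(ℂ, E) G ⊗[ℂ] GroupLieAlgebra 𝓘(ℂ, E) G) (g : G) :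
    map2 (projDeriv F U g).toLinearMap (fieldOnGroup ρ b g) = quotientValue F U ρ b g := by
  rw [fieldOnGroup, map_sub, leftInvariant, rightInvariant, ← map2_comp, ← map2_comp]
  refine congrArg₂ (fun s t : F ⊗[ℂ] F => s - t) ?_ ?_
  · exact congrArg (fun f : GroupLieAlgebra 𝓘(ℂ, E) G →ₗ[ℂ] F => map2 f b)
      (LinearMap.ext fun a => (projMul_left_eq hmk g a).symm)
  · exact congrArg (fun f : GroupLieAlgebra 𝓘(ℂ, E) G →ₗ[ℂ] F => map2 f ρ)
      (LinearMap.ext fun a => (projMul_right_eq hmk g a).symm)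

/-- The value of `quotientField` at `p(g)` does not depend on the choice of `g`. -/
theorem quotientValue_mul {ρ b : GroupLieAlgebra 𝓘(ℂ, E) G ⊗[ℂ] GroupLieAlgebra 𝓘(ℂ, E) G}
    (hb : ∀ u ∈ U, map2 (Ad E u).toLinearMap b = b) (g : G) {u : G} (hu : u ∈ U) :
    quotientValue F U ρ b (g * u) = quotientValue F U ρ b g := by
  rw [quotientValue, quotientValue, projMul_mul_mem 1 g hu]
  have h : (projMul (E := E) F U (g * u) 1).toLinearMap =
      (projMul F U g 1).toLinearMap ∘ₗ (Ad E u).toLinearMap := LinearMap.ext fun a => by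
    refine (projMul_mul_left hmk g u a).trans ?_
    have := projMul_mul_mem (E := E) (F := F) g 1 hu
    rw [one_mul] at this
    rw [this]
    rfl
  rw [h, map2_comp, hb u hu]

theorem quotientField_mk {ρ b : GroupLieAlgebra 𝓘(ℂ, E) G ⊗[ℂ] GroupLieAlgebra 𝓘(ℂ, E) G}
    (hb : ∀ u ∈ U, map2 (Ad E u).toLinearMap b = b) (g : G) :
    (quotientField F U ρ b (QuotientGroup.mk g) : F ⊗[ℂ] F) = quotientValue F U ρ b g := by
  refine (rec_eq_of_model (QuotientGroup.out_eq' (QuotientGroup.mk g : G ⧸ U)) _).trans ?_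
  refine (map2_projDeriv_fieldOnGroup hmk ρ b _).trans ?_
  obtain ⟨u, hu⟩ := QuotientGroup.mk_out_eq_mul U g
  have := quotientValue_mul hmk (ρ := ρ) hb g u.2
  rw [← hu] at this
  exact this

/-- Multiplicativity. -/
theorem multiplicative_rhs_eq (hs : ∀ g : G, ContMDiff 𝓘(ℂ, F) 𝓘(ℂ, F) ω (fun x : G ⧸ U => g • x))
    (ρ b : GroupLieAlgebra 𝓘(ℂ, E) G ⊗[ℂ] GroupLieAlgebra 𝓘(ℂ, E) G) (g h : G) :
    map2 (mapD F F (fun x : G ⧸ U => g • x) (QuotientGroup.mk h)).toLinearMap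
        (quotientValue F U ρ b h) +
      map2 (mapD E F (fun y : G => y • (QuotientGroup.mk h : G ⧸ U)) g).toLinearMap
        (fieldOnGroup ρ ρ g : E ⊗[ℂ] E) =
    quotientValue F U ρ b (g * h) := by
  have e1 : ∀ k l : G, k * l = h → ∀ t : GroupLieAlgebra 𝓘(ℂ, E) G ⊗[ℂ] GroupLieAlgebra 𝓘(ℂ, E) G,
      map2 (mapD F F (fun x : G ⧸ U => g • x) (QuotientGroup.mk h)).toLinearMap
        (map2 (projMul F U k l).toLinearMap t) = map2 (projMul F U (g * k) l).toLinearMap t := by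
    rintro k l rfl t
    rw [← map2_comp]
    exact congrArg (fun f : GroupLieAlgebra 𝓘(ℂ, E) G →ₗ[ℂ] F => map2 f t)
      (LinearMap.ext fun a => mapD_smul_projMul hmk hs g k l a)
  have e2 : map2 (mapD E F (fun y : G => y • (QuotientGroup.mk h : G ⧸ U)) g).toLinearMap
        (fieldOnGroup ρ ρ g : E ⊗[ℂ] E) =
      map2 (projMul F U g h).toLinearMap ρ - map2 (projMul F U 1 (g * h)).toLinearMap ρ := by
    let A : TangentSpace 𝓘(ℂ, E) g →ₗ[ℂ] F :=
      (mapD E F (fun y : G => y • (QuotientGroup.mk h : G ⧸ U)) g).toLinearMap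
    have : map2 A (fieldOnGroup ρ ρ g) =
        map2 (projMul F U g h).toLinearMap ρ - map2 (projMul F U 1 (g * h)).toLinearMap ρ := by
      rw [fieldOnGroup, map_sub, leftInvariant, rightInvariant, ← map2_comp, ← map2_comp]
      refine congrArg₂ (fun s t : F ⊗[ℂ] F => s - t) ?_ ?_
      · exact congrArg (fun f : GroupLieAlgebra 𝓘(ℂ, E) G →ₗ[ℂ] F => map2 f ρ)
          (LinearMap.ext fun a => mapD_orbit_leftMulDeriv hmk g h a)
      · exact congrArg (fun f : GroupLieAlgebra 𝓘(ℂ, E) G →ₗ[ℂ] F => map2 f ρ)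
          (LinearMap.ext fun a => mapD_orbit_rightMulDeriv hmk g h a)
    exact this
  -- The translate of `π(hU)` contributes `-(projMul g h)_* ρ` and the orbit term contributes
  -- `+(projMul g h)_* ρ`. These cancel, leaving the value at `g h`.
  rw [e2, quotientValue, map_sub, e1 h 1 (mul_one h), e1 1 h (one_mul h), quotientValue, mul_one]
  abel

variable {Ω ρ b : GroupLieAlgebra 𝓘(ℂ, E) G ⊗[ℂ] GroupLieAlgebra 𝓘(ℂ, E) G}

theorem map2_projMul_left_eq_right (hAd : ∀ g : G, map2 (Ad E g).toLinearMap Ω = Ω) (g : G) :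
    map2 (projMul F U g 1).toLinearMap Ω = map2 (projMul F U 1 g).toLinearMap Ω := by
  conv_rhs => rw [← hAd g, ← map2_comp]
  refine congrArg (fun f : GroupLieAlgebra 𝓘(ℂ, E) G →ₗ[ℂ] F => map2 f Ω)
    (LinearMap.ext fun a => ?_)
  have h := projMul_mul_left hmk 1 g a
  rw [one_mul] at h
  exact h

/-- Substituting `b²¹ = Ω - b` and `ρ²¹ = Ω - ρ`, the two `Ω` terms cancel because `Ω^L` and `Ω^R`
have the same projection. -/
theorem flip_quotientValue (hAd : ∀ g : G, map2 (Ad E g).toLinearMap Ω = Ω)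
    (hρ : ρ + flip ρ = Ω) (hb : b + flip b = Ω) (g : G) :
    flip (quotientValue F U ρ b g) = -quotientValue F U ρ b g := by
  rw [quotientValue, flip_sub, flip_map2, flip_map2, eq_sub_of_add_eq' hρ, eq_sub_of_add_eq' hb,
    map_sub, map_sub, map2_projMul_left_eq_right hmk hAd]
  abel

/-- If `π(p(g)) = p_*(b^L(g) - ρ^R(g))`, then `b` is `U`-invariant modulo the kernel of `p_*`. -/
theorem map2_projMul_Ad_eq
    {π : (x : G ⧸ U) → TangentSpace 𝓘(ℂ, F) x ⊗[ℂ] TangentSpace 𝓘(ℂ, F) x}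
    (hπ : ∀ g : G, (π (QuotientGroup.mk g) : F ⊗[ℂ] F) = quotientValue F U ρ b g) {u : G} (hu : u ∈ U) :
    map2 (projMul F U 1 1).toLinearMap (map2 (Ad E u).toLinearMap b) =
      map2 (projMul F U 1 1).toLinearMap b := by
  have h : ∀ x : G ⧸ U, x = QuotientGroup.mk 1 →
      (π x : F ⊗[ℂ] F) = π (QuotientGroup.mk 1) := by
    rintro x rfl
    rfl
  have h1 : quotientValue F U ρ b u = quotientValue F U ρ b 1 :=
    ((hπ u).symm.trans (h _ (QuotientGroup.eq.2 (by simpa using hu)))).trans (hπ 1)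
  have h2 : projMul (E := E) F U 1 u = projMul F U 1 1 := by
    have := projMul_mul_mem (E := E) (F := F) 1 1 hu
    rwa [one_mul] at this
  rw [quotientValue, quotientValue, h2, sub_left_inj] at h1
  refine Eq.trans ?_ h1
  rw [← map2_comp]
  refine congrArg (fun f : GroupLieAlgebra 𝓘(ℂ, E) G →ₗ[ℂ] F => map2 f b)
    (LinearMap.ext fun a => ?_)
  have h3 := projMul_mul_left hmk 1 u a
  rw [one_mul, h2] at h3
  exact h3.symm

end

/-- The group acts on the quotient by holomorphic maps. -/
theorem contMDiff_smul_quotient [IsManifold 𝓘(ℂ, F) ω (G ⧸ U)]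
    (hp : Manifold.IsSubmersion 𝓘(ℂ, E) 𝓘(ℂ, F) ω (QuotientGroup.mk : G → G ⧸ U)) (g : G) :
    ContMDiff 𝓘(ℂ, F) 𝓘(ℂ, F) ω (fun x : G ⧸ U => g • x) := by
  intro x
  obtain ⟨h, rfl⟩ := QuotientGroup.mk_surjective x
  obtain ⟨s, hs, hsh, hps⟩ := exists_localSection (hp.isSubmersionAt h)
  refine (ContMDiffAt.comp (g := fun y : G => (QuotientGroup.mk (g * y) : G ⧸ U))
    (QuotientGroup.mk h) (hp.contMDiff.comp (contMDiff_mul_left' E g)).contMDiffAt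
    hs).congr_of_eventuallyEq ?_
  filter_upwards [hps] with y hy
  conv_lhs => rw [← hy]
  rfl

end QuotientField

/-! ### The Schouten square on the quotient. -/

section QuotientBracket

variable {E : Type*} [NormedAddCommGroup E] [NormedSpace ℂ E]
  {G : Type*} [TopologicalSpace G] [ChartedSpace E G] [Group G] [LieGroup 𝓘(ℂ, E) ω G]
  {F : Type*} [NormedAddCommGroup F] [NormedSpace ℂ F]
  {U : Subgroup G} [ChartedSpace F (G ⧸ U)]

section

variable (hmk : ContMDiff 𝓘(ℂ, E) 𝓘(ℂ, F) ω (QuotientGroup.mk : G → G ⧸ U))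
include hmk

theorem dAt_projMul {f : G ⧸ U → ℂ} {k h : G}
    (hf : MDifferentiableAt 𝓘(ℂ, F) 𝓘(ℂ, ℂ) f (QuotientGroup.mk (k * h)))
    (a : GroupLieAlgebra 𝓘(ℂ, E) G) :
    dAt F f (QuotientGroup.mk (k * h)) (projMul F U k h a) =
      dAt E (fun y : G => f (QuotientGroup.mk (k * y * h))) 1 a := by
  have h1 := dAt_comp (E := E) (f := f)
    (c := fun y : G => (QuotientGroup.mk (k * y * h) : G ⧸ U)) (x := 1)
    (by simpa using hf) (mdifferentiable_mk_mul hmk k h _)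
  have h2 := DFunLike.congr_fun h1 (a : E)
  simp only [mul_one] at h2
  exact h2.symm

theorem dAt_comp_projMul_left {f : G ⧸ U → ℂ} {g : G}
    (hf : MDifferentiableAt 𝓘(ℂ, F) 𝓘(ℂ, ℂ) f (QuotientGroup.mk g)) :
    (dAt F f (QuotientGroup.mk g)).toLinearMap ∘ₗ (projMul (E := E) F U g 1).toLinearMap =
      (leftD E (fun y => f (QuotientGroup.mk y)) g).toLinearMap := LinearMap.ext fun a => by
  have h := dAt_projMul hmk (k := g) (h := 1) (by simpa using hf) a
  simp only [mul_one] at h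
  exact h

theorem dAt_comp_projMul_right {f : G ⧸ U → ℂ} {g : G}
    (hf : MDifferentiableAt 𝓘(ℂ, F) 𝓘(ℂ, ℂ) f (QuotientGroup.mk g)) :
    (dAt F f (QuotientGroup.mk g)).toLinearMap ∘ₗ (projMul (E := E) F U 1 g).toLinearMap =
      (rightD E (fun y => f (QuotientGroup.mk y)) g).toLinearMap := LinearMap.ext fun a => by
  have h := dAt_projMul hmk (k := 1) (h := g) (by simpa using hf) a
  simp only [one_mul] at h
  exact h

variable {ρ b : GroupLieAlgebra 𝓘(ℂ, E) G ⊗[ℂ] GroupLieAlgebra 𝓘(ℂ, E) G}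
  {π : (x : G ⧸ U) → TangentSpace 𝓘(ℂ, F) x ⊗[ℂ] TangentSpace 𝓘(ℂ, F) x}

theorem fieldBracket_eq_groupBracket {g : G}
    (hπ : (π (QuotientGroup.mk g) : F ⊗[ℂ] F) = quotientValue F U ρ b g) {f h : G ⧸ U → ℂ}
    (hf : MDifferentiableAt 𝓘(ℂ, F) 𝓘(ℂ, ℂ) f (QuotientGroup.mk g))
    (hh : MDifferentiableAt 𝓘(ℂ, F) 𝓘(ℂ, ℂ) h (QuotientGroup.mk g)) :
    fieldBracket π f h (QuotientGroup.mk g) =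
      groupBracket ρ b (fun y => f (QuotientGroup.mk y)) (fun y => h (QuotientGroup.mk y)) g := by
  refine (congrArg (pair2 (dAt F f (QuotientGroup.mk g)).toLinearMap
    (dAt F h (QuotientGroup.mk g)).toLinearMap) hπ).trans ?_
  rw [quotientValue, map_sub, pair2_map2, pair2_map2, dAt_comp_projMul_left hmk hf,
    dAt_comp_projMul_left hmk hh, dAt_comp_projMul_right hmk hf, dAt_comp_projMul_right hmk hh]
  rfl

end

variable [IsManifold 𝓘(ℂ, F) ω (G ⧸ U)]
  (hp : Manifold.IsSubmersion 𝓘(ℂ, E) 𝓘(ℂ, F) ω (QuotientGroup.mk : G → G ⧸ U))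
  {ρ b : GroupLieAlgebra 𝓘(ℂ, E) G ⊗[ℂ] GroupLieAlgebra 𝓘(ℂ, E) G}
  {π : (x : G ⧸ U) → TangentSpace 𝓘(ℂ, F) x ⊗[ℂ] TangentSpace 𝓘(ℂ, F) x}
  (hπ : ∀ g : G, (π (QuotientGroup.mk g) : F ⊗[ℂ] F) = quotientValue F U ρ b g)
include hp hπ

/-- Equality on a neighbourhood is needed because the bracket is differentiated again in an iterated
bracket. -/
theorem fieldBracket_mk_eventuallyEq {g : G} {f h : G ⧸ U → ℂ}
    (hf : ContMDiffAt 𝓘(ℂ, F) 𝓘(ℂ, ℂ) ω f (QuotientGroup.mk g))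
    (hh : ContMDiffAt 𝓘(ℂ, F) 𝓘(ℂ, ℂ) ω h (QuotientGroup.mk g)) :
    (fun y : G => fieldBracket π f h (QuotientGroup.mk y)) =ᶠ[𝓝 g]
      groupBracket ρ b (fun y => f (QuotientGroup.mk y)) (fun y => h (QuotientGroup.mk y)) := by
  have hc := hp.contMDiff.continuous.continuousAt (x := g)
  filter_upwards [hc.eventually (eventually_contMDiffAt hf),
    hc.eventually (eventually_contMDiffAt hh)] with y hy hy'
  exact fieldBracket_eq_groupBracket hp.contMDiff (hπ y) (hy.mdifferentiableAt (by simp))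
    (hy'.mdifferentiableAt (by simp))

theorem contMDiffAt_fieldBracket {g : G} {f h : G ⧸ U → ℂ}
    (hf : ContMDiffAt 𝓘(ℂ, F) 𝓘(ℂ, ℂ) ω f (QuotientGroup.mk g))
    (hh : ContMDiffAt 𝓘(ℂ, F) 𝓘(ℂ, ℂ) ω h (QuotientGroup.mk g)) :
    ContMDiffAt 𝓘(ℂ, F) 𝓘(ℂ, ℂ) ω (fieldBracket π f h) (QuotientGroup.mk g) := by
  refine contMDiffAt_of_comp_isSubmersionAt (hp.isSubmersionAt g)
    (ContMDiffAt.congr_of_eventuallyEq ?_ (fieldBracket_mk_eventuallyEq hp hπ hf hh))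
  exact contMDiffAt_groupBracket ρ b (hf.comp g hp.contMDiff.contMDiffAt)
    (hh.comp g hp.contMDiff.contMDiffAt)

theorem fieldBracket_fieldBracket_mk {g : G} {f h k : G ⧸ U → ℂ}
    (hf : ContMDiffAt 𝓘(ℂ, F) 𝓘(ℂ, ℂ) ω f (QuotientGroup.mk g))
    (hh : ContMDiffAt 𝓘(ℂ, F) 𝓘(ℂ, ℂ) ω h (QuotientGroup.mk g))
    (hk : ContMDiffAt 𝓘(ℂ, F) 𝓘(ℂ, ℂ) ω k (QuotientGroup.mk g)) :
    fieldBracket π f (fieldBracket π h k) (QuotientGroup.mk g) =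
      groupBracket ρ b (fun y => f (QuotientGroup.mk y)) (groupBracket ρ b
        (fun y => h (QuotientGroup.mk y)) (fun y => k (QuotientGroup.mk y))) g := by
  rw [fieldBracket_eq_groupBracket hp.contMDiff (hπ g) (hf.mdifferentiableAt (by simp))
    ((contMDiffAt_fieldBracket hp hπ hh hk).mdifferentiableAt (by simp))]
  have h1 := fieldBracket_mk_eventuallyEq hp hπ hh hk
  simp only [groupBracket.eq_def (ρ := ρ) (b := b) (f := fun y => f (QuotientGroup.mk y)),
    leftD_congr h1, rightD_congr h1]

variable [CompleteSpace E]

/-- For equal arguments `schouten` is twice the cyclic sum of iterated brackets, so the factor `1/2`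
leaves the Jacobiator computed on `G`. -/
theorem half_schouten_mk {Ω : GroupLieAlgebra 𝓘(ℂ, E) G ⊗[ℂ] GroupLieAlgebra 𝓘(ℂ, E) G}
    (hρ : ρ + flip ρ = Ω) (hb : b + flip b = Ω) (hΩ : IsInvariant ⊤ Ω)
    (hAd : ∀ g : G, map2 (Ad E g).toLinearMap Ω = Ω) {g : G} {f h k : G ⧸ U → ℂ}
    (hf : ContMDiffAt 𝓘(ℂ, F) 𝓘(ℂ, ℂ) ω f (QuotientGroup.mk g))
    (hh : ContMDiffAt 𝓘(ℂ, F) 𝓘(ℂ, ℂ) ω h (QuotientGroup.mk g))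
    (hk : ContMDiffAt 𝓘(ℂ, F) 𝓘(ℂ, ℂ) ω k (QuotientGroup.mk g)) :
    (1 / 2 : ℂ) * schouten π π f h k (QuotientGroup.mk g) =
      pair3 (dAt F f (QuotientGroup.mk g)).toLinearMap (dAt F h (QuotientGroup.mk g)).toLinearMap
        (dAt F k (QuotientGroup.mk g)).toLinearMap
        (map3 (projMul (E := E) F U g 1).toLinearMap (CYB b) +
          map3 (projMul (E := E) F U 1 g).toLinearMap (-CYB ρ)) := by
  have hd : ∀ {q : G ⧸ U → ℂ}, ContMDiffAt 𝓘(ℂ, F) 𝓘(ℂ, ℂ) ω q (QuotientGroup.mk g) →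
      MDifferentiableAt 𝓘(ℂ, F) 𝓘(ℂ, ℂ) q (QuotientGroup.mk g) := fun h =>
    h.mdifferentiableAt (by simp)
  have hc : ∀ {q : G ⧸ U → ℂ}, ContMDiffAt 𝓘(ℂ, F) 𝓘(ℂ, ℂ) ω q (QuotientGroup.mk g) →
      ContMDiffAt 𝓘(ℂ, E) 𝓘(ℂ, ℂ) ω (fun y => q (QuotientGroup.mk y)) g := fun h =>
    h.comp g hp.contMDiff.contMDiffAt
  have h1 := sum_cyclic_groupBracket hρ hb hΩ hAd (hc hf) (hc hh) (hc hk)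
  rw [schouten, fieldBracket_fieldBracket_mk hp hπ hf hh hk,
    fieldBracket_fieldBracket_mk hp hπ hh hk hf, fieldBracket_fieldBracket_mk hp hπ hk hf hh,
    map_add, pair3_map3, pair3_map3, dAt_comp_projMul_left hp.contMDiff (hd hf),
    dAt_comp_projMul_left hp.contMDiff (hd hh), dAt_comp_projMul_left hp.contMDiff (hd hk),
    dAt_comp_projMul_right hp.contMDiff (hd hf), dAt_comp_projMul_right hp.contMDiff (hd hh),
    dAt_comp_projMul_right hp.contMDiff (hd hk), map_neg]
  linear_combination h1

end QuotientBracket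

/-! ### Linear algebra of a complement to the isotropy algebra. -/

section Complement

variable {V W : Type*} [AddCommGroup V] [Module ℂ V] [AddCommGroup W] [Module ℂ W]

/-- Over a field the injection of `V/u` into `W` stays injective on tensor cubes. This moves the
condition between the tangent space and `g/u`. -/
theorem map3_eq_zero_iff_of_ker_eq {p : V →ₗ[ℂ] W} {u : Submodule ℂ V} (hu : LinearMap.ker p = u)
    (t : V ⊗[ℂ] (V ⊗[ℂ] V)) : map3 p t = 0 ↔ map3 u.mkQ t = 0 := by
  have hinj : Function.Injective (u.liftQ p hu.ge) :=
    LinearMap.ker_eq_bot.1 (Submodule.ker_liftQ_eq_bot _ _ _ hu.le)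
  rw [← Submodule.liftQ_mkQ u p hu.ge, map3_comp]
  exact map_eq_zero_iff _ (map3_injective hinj)

theorem exists_of_mem_wedge2 {m : Submodule ℂ V} {B : V ⊗[ℂ] V} (hB : B ∈ wedge2 m) :
    ∃ B' : m ⊗[ℂ] m, map2 m.subtype B' = B ∧ flip B' = -B' := by
  obtain ⟨B', hB', rfl⟩ := hB
  exact ⟨B', rfl, eq_neg_of_add_eq_zero_left hB'⟩

theorem flip_of_mem_wedge2 {m : Submodule ℂ V} {B : V ⊗[ℂ] V} (hB : B ∈ wedge2 m) :
    flip B = -B := by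
  obtain ⟨B', rfl, h⟩ := exists_of_mem_wedge2 hB
  rw [flip_map2, h, map_neg]

variable {p : V →ₗ[ℂ] W} {m : Submodule ℂ V}

theorem comp_subtype_injective (hm : IsCompl (LinearMap.ker p) m) :
    Function.Injective (p ∘ₗ m.subtype) := by
  rw [← LinearMap.ker_eq_bot, LinearMap.ker_eq_bot']
  intro x hx
  exact Subtype.ext (Submodule.disjoint_def.1 hm.disjoint _ hx x.2)

theorem comp_subtype_surjective (hp : Function.Surjective p) (hm : IsCompl (LinearMap.ker p) m) :
    Function.Surjective (p ∘ₗ m.subtype) := by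
  intro w
  obtain ⟨v, rfl⟩ := hp w
  have hv : v ∈ LinearMap.ker p ⊔ m := by rw [hm.sup_eq_top]; trivial
  obtain ⟨x, hx, y, hy, rfl⟩ := Submodule.mem_sup.1 hv
  exact ⟨⟨y, hy⟩, by simp [LinearMap.mem_ker.1 hx]⟩

theorem eq_zero_of_map2_eq_zero (hm : IsCompl (LinearMap.ker p) m) {B : V ⊗[ℂ] V}
    (hB : B ∈ LinearMap.range (map2 m.subtype)) (h : map2 p B = 0) : B = 0 := by
  obtain ⟨B', rfl⟩ := hB
  rw [← map2_comp] at h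
  rw [(map_eq_zero_iff _ (map2_injective (comp_subtype_injective hm))).1 h, map_zero]

/-- The restriction of `p` to `m` is an isomorphism, and the bivector is lifted through its inverse.
-/
theorem exists_mem_wedge2_map2_eq (hp : Function.Surjective p) (hm : IsCompl (LinearMap.ker p) m)
    {T : W ⊗[ℂ] W} (hT : flip T = -T) : ∃ B ∈ wedge2 m, map2 p B = T := by
  let e := LinearEquiv.ofBijective (p ∘ₗ m.subtype)
    ⟨comp_subtype_injective hm, comp_subtype_surjective hp hm⟩
  refine ⟨map2 m.subtype (map2 e.symm.toLinearMap T), ⟨map2 e.symm.toLinearMap T, ?_, rfl⟩, ?_⟩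
  · change flip _ + _ = _
    rw [flip_map2, hT, map_neg]
    exact neg_add_cancel _
  · rw [← map2_comp, ← map2_comp]
    have : (p ∘ₗ m.subtype) ∘ₗ e.symm.toLinearMap = LinearMap.id :=
      LinearMap.ext fun w => e.apply_symm_apply w
    rw [this, map2_id]

theorem lie_mem_range_map2_subtype {L : Type*} [LieRing L] [LieAlgebra ℂ L] {m : Submodule ℂ L}
    {x : L} (hx : ∀ y ∈ m, ⁅x, y⁆ ∈ m) {B : L ⊗[ℂ] L} (hB : B ∈ LinearMap.range (map2 m.subtype)) :
    ⁅x, B⁆ ∈ LinearMap.range (map2 m.subtype) := by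
  obtain ⟨B', rfl⟩ := hB
  induction B' using TensorProduct.induction_on with
  | zero => simp
  | add s t hs ht =>
    rw [map_add, lie_add]
    exact add_mem hs ht
  | tmul a b =>
    rw [map2_tmul, TensorProduct.LieModule.lie_tmul_right]
    exact add_mem ⟨⟨_, hx _ a.2⟩ ⊗ₜ b, rfl⟩ ⟨a ⊗ₜ ⟨_, hx _ b.2⟩, rfl⟩

end Complement

/-! ### The criterion for a quasi-Poisson homogeneous structure. -/

section Homogeneous

variable {E : Type*} [NormedAddCommGroup E] [NormedSpace ℂ E]
  {G : Type*} [TopologicalSpace G] [ChartedSpace E G] [Group G] [LieGroup 𝓘(ℂ, E) ω G]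
  {F : Type*} [NormedAddCommGroup F] [NormedSpace ℂ F]
  {U : Subgroup G} [ChartedSpace F (G ⧸ U)] [IsManifold 𝓘(ℂ, F) ω (G ⧸ U)]
  (hp : Manifold.IsSubmersion 𝓘(ℂ, E) 𝓘(ℂ, F) ω (QuotientGroup.mk : G → G ⧸ U))

section
include hp

theorem projMul_one_surjective : Function.Surjective (projMul (E := E) F U 1 1) := fun w => by
  obtain ⟨v, hv⟩ := mapD_surjective_of_isSubmersionAt (hp.isSubmersionAt (1 : G)) w
  exact ⟨v, (projMul_one_eq_mapD (E := E) v).trans hv⟩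

theorem ker_projMul_one :
    LinearMap.ker (projMul (E := E) F U 1 1).toLinearMap = lieAlgebraOf E U :=
  Submodule.ext fun v => by
    rw [LinearMap.mem_ker, ← mapD_mk_eq_zero_iff hp v]
    exact Eq.congr_left (projMul_one_eq_mapD (E := E) v)

/-- Projected left-invariant tensors are translates of their value at the base point, so vanishing
of the `CYB(b)` term there gives vanishing everywhere. -/
theorem projMul_left_eq_comp (g : G) : (projMul (E := E) F U g 1).toLinearMap =
    (mapD F F (fun x : G ⧸ U => g • x) (QuotientGroup.mk 1)).toLinearMap ∘ₗ
      (projMul (E := E) F U 1 1).toLinearMap := LinearMap.ext fun a => by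
  have h := mapD_smul_projMul hp.contMDiff (contMDiff_smul_quotient hp) g 1 1 a
  simp only [mul_one] at h
  exact h.symm

theorem finiteDimensional_of_isSubmersion [FiniteDimensional ℂ E] : FiniteDimensional ℂ F :=
  Module.Finite.of_surjective (mapD E F (QuotientGroup.mk : G → G ⧸ U) 1).toLinearMap
    (mapD_surjective_of_isSubmersionAt (hp.isSubmersionAt (1 : G)))

/-- Every covector is the differential of a function, linear in the chart. An identity tested on
differentials is thus an identity of tensors. -/
theorem exists_contMDiffAt_dAt_eq [FiniteDimensional ℂ E] (x : G ⧸ U) (ξ : F →ₗ[ℂ] ℂ) :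
    ∃ f : G ⧸ U → ℂ, ContMDiffAt 𝓘(ℂ, F) 𝓘(ℂ, ℂ) ω f x ∧ (dAt F f x).toLinearMap = ξ := by
  have := finiteDimensional_of_isSubmersion hp
  have hc : ContMDiffAt 𝓘(ℂ, F) 𝓘(ℂ, F) ω (extChartAt 𝓘(ℂ, F) x) x := contMDiffAt_extChartAt
  let ξ' := LinearMap.toContinuousLinearMap ξ
  refine ⟨fun y => ξ' (extChartAt 𝓘(ℂ, F) x y),
    ContMDiffAt.comp (g := ξ') x ξ'.contDiff.contDiffAt.contMDiffAt hc, ?_⟩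
  rw [fderiv_comp_dAt ξ'.differentiableAt (hc.mdifferentiableAt (by simp)), dAt_extChartAt,
    ContinuousLinearMap.fderiv]
  rfl

end

variable [FiniteDimensional ℂ E] [CompleteSpace E]
  {Ω ρ b : GroupLieAlgebra 𝓘(ℂ, E) G ⊗[ℂ] GroupLieAlgebra 𝓘(ℂ, E) G}
  {π : (x : G ⧸ U) → TangentSpace 𝓘(ℂ, F) x ⊗[ℂ] TangentSpace 𝓘(ℂ, F) x}
  (hπ : ∀ g : G, (π (QuotientGroup.mk g) : F ⊗[ℂ] F) = quotientValue F U ρ b g)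
  (hρ : ρ + flip ρ = Ω) (hb : b + flip b = Ω) (hΩ : IsInvariant ⊤ Ω)
  (hAd : ∀ g : G, map2 (Ad E g).toLinearMap Ω = Ω)
include hp

include hπ hρ hb hΩ hAd

theorem isQuasiPoissonHomogeneous_iff :
    IsQuasiPoissonHomogeneous (fieldOnGroup ρ ρ) (-CYB ρ) π ↔
      CYBVanishesMod (lieAlgebraOf E U) b := by
  have hker : CYBVanishesMod (lieAlgebraOf E U) b ↔
      map3 (projMul (E := E) F U 1 1).toLinearMap (CYB b) = 0 :=
    (map3_eq_zero_iff_of_ker_eq (ker_projMul_one hp) _).symm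
  have hφ : ∀ g : G, (inducedTrivector (-CYB ρ) (QuotientGroup.mk g : G ⧸ U) :
      F ⊗[ℂ] (F ⊗[ℂ] F)) = map3 (projMul (E := E) F U 1 g).toLinearMap (-CYB ρ) := fun g =>
    congrArg (fun A : GroupLieAlgebra 𝓘(ℂ, E) G →L[ℂ] F => map3 A.toLinearMap (-CYB ρ))
      (infinitesimalAction_mk g)
  rw [hker]
  constructor
  · intro h
    -- The Schouten condition at the base point alone suffices: both sides contain the same `φ`
    -- term, and what is left is the projection of `CYB b`.
    refine eq_zero_of_pair3 fun ξ η ζ => ?_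
    obtain ⟨f, hf, rfl⟩ := exists_contMDiffAt_dAt_eq hp (QuotientGroup.mk 1) ξ
    obtain ⟨k, hk, rfl⟩ := exists_contMDiffAt_dAt_eq hp (QuotientGroup.mk 1) η
    obtain ⟨l, hl, rfl⟩ := exists_contMDiffAt_dAt_eq hp (QuotientGroup.mk 1) ζ
    have h1 := half_schouten_mk hp hπ hρ hb hΩ hAd hf hk hl
    have h2 := (h.half_schouten (QuotientGroup.mk 1) f k l hf hk hl).trans
      (congrArg (pair3 (dAt F f (QuotientGroup.mk 1)).toLinearMap
        (dAt F k (QuotientGroup.mk 1)).toLinearMap (dAt F l (QuotientGroup.mk 1)).toLinearMap)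
        (hφ 1))
    rw [h2, map_add] at h1
    exact left_eq_add.1 ((add_comm _ _).trans h1.symm).symm
  · intro h
    refine ⟨⟨fun x => ?_, fun x f k hf hk => ?_⟩, fun g x => ?_, fun x f k l hf hk hl => ?_⟩ <;>
      obtain ⟨y, rfl⟩ := QuotientGroup.mk_surjective x
    · have h1 := flip_quotientValue hp.contMDiff hAd hρ hb y
      rw [← hπ] at h1
      exact h1
    · exact contMDiffAt_fieldBracket hp hπ hf hk
    · have h1 := multiplicative_rhs_eq hp.contMDiff (contMDiff_smul_quotient hp) ρ b g y
      rw [← hπ, ← hπ] at h1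
      exact h1.symm
    · refine (half_schouten_mk hp hπ hρ hb hΩ hAd hf hk hl).trans ?_
      rw [projMul_left_eq_comp hp, map3_comp, h, map_zero, zero_add]
      exact (congrArg (pair3 (dAt F f (QuotientGroup.mk y)).toLinearMap
        (dAt F k (QuotientGroup.mk y)).toLinearMap (dAt F l (QuotientGroup.mk y)).toLinearMap)
        (hφ y)).symm

end Homogeneous

/-! ### Classification of the homogeneous structures. -/

section Classification

variable {E : Type*} [NormedAddCommGroup E] [NormedSpace ℂ E]
  {G : Type*} [TopologicalSpace G] [ChartedSpace E G] [Group G] [LieGroup 𝓘(ℂ, E) ω G]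

theorem leftMulDeriv_eq_rightMulDeriv_Ad (g : G) (a : GroupLieAlgebra 𝓘(ℂ, E) G) :
    leftMulDeriv g a = rightMulDeriv g (Ad E g a) := by
  have h1 := mapD_comp (E'' := E) (d := fun y : G => y * g) (c := fun y : G => g * y * g⁻¹) (x := 1)
    ((contMDiff_mul_right' E g).mdifferentiable (by simp) _)
    ((contMDiff_conj E g).mdifferentiable (by simp) _)
  have h2 := DFunLike.congr_fun h1 (a : E)
  simp only [mul_one, mul_inv_cancel, inv_mul_cancel_right] at h2
  exact h2.trans (congrArg (mapD E E (fun y : G => y * g) 1) (mapD_conj (E := E) g (a : E)))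

theorem rightMulDeriv_injective (g : G) :
    Function.Injective (rightMulDeriv g : GroupLieAlgebra 𝓘(ℂ, E) G →L[ℂ] _) := by
  have h1 := mapD_comp (E'' := E) (d := fun y : G => y * g⁻¹) (c := fun y : G => y * g) (x := 1)
    ((contMDiff_mul_right' E g⁻¹).mdifferentiable (by simp) _)
    ((contMDiff_mul_right' E g).mdifferentiable (by simp) _)
  simp only [mul_inv_cancel_right, mapD_id] at h1
  exact Function.LeftInverse.injective (g := mapD E E (fun y : G => y * g⁻¹) (1 * g))
    fun a => (DFunLike.congr_fun h1 (a : E)).symm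

theorem map2_Ad_eq_of_leftInvariant_eq
    {Ω : GroupLieAlgebra 𝓘(ℂ, E) G ⊗[ℂ] GroupLieAlgebra 𝓘(ℂ, E) G}
    {g : G} (h : leftInvariant Ω g = rightInvariant Ω g) : map2 (Ad E g).toLinearMap Ω = Ω := by
  refine map2_injective (f := (rightMulDeriv g).toLinearMap) (rightMulDeriv_injective g) ?_
  refine Eq.trans ?_ h
  rw [← map2_comp]
  exact congrArg (fun f : GroupLieAlgebra 𝓘(ℂ, E) G →ₗ[ℂ] TangentSpace 𝓘(ℂ, E) g => map2 f Ω)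
    (LinearMap.ext fun a => (leftMulDeriv_eq_rightMulDeriv_Ad g a).symm)

variable {F : Type*} [NormedAddCommGroup F] [NormedSpace ℂ F]
  {U : Subgroup G} [ChartedSpace F (G ⧸ U)] [IsManifold 𝓘(ℂ, F) ω (G ⧸ U)]
  (hp : Manifold.IsSubmersion 𝓘(ℂ, E) 𝓘(ℂ, F) ω (QuotientGroup.mk : G → G ⧸ U))
  {Ω ρ b : GroupLieAlgebra 𝓘(ℂ, E) G ⊗[ℂ] GroupLieAlgebra 𝓘(ℂ, E) G}
  {π : (x : G ⧸ U) → TangentSpace 𝓘(ℂ, F) x ⊗[ℂ] TangentSpace 𝓘(ℂ, F) x}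
include hp

/-- Both sides obey the same transformation law and `G` acts transitively, so agreement at the base
point propagates. -/
theorem eq_quotientValue_of_multiplicative
    {φ : GroupLieAlgebra 𝓘(ℂ, E) G ⊗[ℂ]
      (GroupLieAlgebra 𝓘(ℂ, E) G ⊗[ℂ] GroupLieAlgebra 𝓘(ℂ, E) G)}
    (hπ : IsQuasiPoissonHomogeneous (fieldOnGroup ρ ρ) φ π)
    (h1 : (π (QuotientGroup.mk 1) : F ⊗[ℂ] F) = quotientValue F U ρ b 1) (g : G) :
    (π (QuotientGroup.mk g) : F ⊗[ℂ] F) = quotientValue F U ρ b g := by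
  have h2 : (π (QuotientGroup.mk (g * 1)) : F ⊗[ℂ] F) =
      map2 (mapD F F (fun x : G ⧸ U => g • x) (QuotientGroup.mk 1)).toLinearMap
        (π (QuotientGroup.mk 1) : F ⊗[ℂ] F) +
      map2 (mapD E F (fun y : G => y • (QuotientGroup.mk 1 : G ⧸ U)) g).toLinearMap
        (fieldOnGroup ρ ρ g : E ⊗[ℂ] E) := hπ.multiplicative g (QuotientGroup.mk 1)
  rw [h1, multiplicative_rhs_eq hp.contMDiff (contMDiff_smul_quotient hp)] at h2
  have h3 : ∀ k : G, k = g → (π (QuotientGroup.mk k) : F ⊗[ℂ] F) = quotientValue F U ρ b k →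
      (π (QuotientGroup.mk g) : F ⊗[ℂ] F) = quotientValue F U ρ b g := by
    rintro k rfl h
    exact h
  exact h3 _ (mul_one g) h2

variable [FiniteDimensional ℂ E] [CompleteSpace E]

/-- Composing `g ↦ p_*(Ad_g b)` with the retraction onto `U` gives a function constant near `1`. The
retraction has derivative the identity on `u`, so the derivative along `x`, which is `p_*[x, b]`,
vanishes. -/
theorem map2_projMul_lie_eq_zero
    (hb : ∀ u ∈ U, map2 (projMul F U 1 1).toLinearMap (map2 (Ad E u).toLinearMap b) =
      map2 (projMul F U 1 1).toLinearMap b)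
    {x : GroupLieAlgebra 𝓘(ℂ, E) G} (hx : x ∈ lieAlgebraOf E U) :
    map2 (projMul F U 1 1).toLinearMap ⁅x, b⁆ = 0 := by
  have := finiteDimensional_of_isSubmersion hp
  refine eq_zero_of_pair2 fun ξ η => ?_
  obtain ⟨r, hr, hrU, hr1, hrv⟩ := exists_retraction E F hp
  let α : GroupLieAlgebra 𝓘(ℂ, E) G →L[ℂ] ℂ :=
    (LinearMap.toContinuousLinearMap ξ).comp (projMul (E := E) F U 1 1)
  let β : GroupLieAlgebra 𝓘(ℂ, E) G →L[ℂ] ℂ :=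
    (LinearMap.toContinuousLinearMap η).comp (projMul (E := E) F U 1 1)
  let f : G → ℂ := fun g => pair2 α.toLinearMap β.toLinearMap (map2 (Ad E g).toLinearMap b)
  have hf : ContMDiff 𝓘(ℂ, E) 𝓘(ℂ, ℂ) ω f := contMDiff_pair2_Ad α β b
  have hpair : ∀ t : GroupLieAlgebra 𝓘(ℂ, E) G ⊗[ℂ] GroupLieAlgebra 𝓘(ℂ, E) G,
      pair2 α.toLinearMap β.toLinearMap t =
        pair2 ξ η (map2 (projMul F U 1 1).toLinearMap t) := fun t => (pair2_map2 ξ η _ t).symm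
  have hconst : (fun y => f (r y)) =ᶠ[𝓝 1] fun _ => pair2 α.toLinearMap β.toLinearMap b := by
    filter_upwards [hrU] with y hy
    simp only [f]
    rw [hpair, hb _ hy, ← hpair]
  have h1 := dAt_comp (E := E) (f := f) (c := r) (x := (1 : G))
    (hf.mdifferentiable (by simp) _) (hr.mdifferentiableAt (by simp))
  rw [dAt_congr hconst, dAt_const] at h1
  have h2 := DFunLike.congr_fun h1 (x : E)
  have h3 : mapD E E r 1 x = x := hrv x ((mapD_mk_eq_zero_iff hp x).2 hx)
  have h4 : dAt E f (r 1) x = 0 := (congrArg (dAt E f (r 1)) h3).symm.trans h2.symm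
  rw [hr1 1 U.one_mem] at h4
  rw [← hpair, ← dAt_pair2_Ad α β b x]
  exact h4

variable (hU : IsConnected (U : Set G)) (hρ : ρ + flip ρ = Ω) (hΩ : IsInvariant ⊤ Ω)
  (hAd : ∀ g : G, map2 (Ad E g).toLinearMap Ω = Ω)
include hU

theorem quotientField_mk_of_isInvariant (hb : IsInvariant (lieAlgebraOf E U) b) (g : G) :
    (quotientField F U ρ b (QuotientGroup.mk g) : F ⊗[ℂ] F) = quotientValue F U ρ b g :=
  quotientField_mk hp.contMDiff (fun _ hu => map2_Ad_eq_of_isSubmersion hp hU hb hu) g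

include hρ hΩ hAd

/-- The parametrization of quasi-Poisson homogeneous structures by solutions of the classical
Yang–Baxter equation modulo the isotropy subalgebra. -/
theorem bijOn_quotientField {m : Submodule ℂ (GroupLieAlgebra 𝓘(ℂ, E) G)}
    (hm : IsCompl (lieAlgebraOf E U) m) (hum : ∀ x ∈ lieAlgebraOf E U, ∀ y ∈ m, ⁅x, y⁆ ∈ m) :
    Set.BijOn (quotientField F U ρ) (MOmega (lieAlgebraOf E U) m Ω)
      (Homsp F U (fieldOnGroup ρ ρ) (-CYB ρ)) := by
  have hker := ker_projMul_one hp
  have hm' : IsCompl (LinearMap.ker (projMul (E := E) F U 1 1).toLinearMap) m := by rwa [hker]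
  have hflip : flip Ω = Ω := by rw [← hρ, flip_add, flip_flip, add_comm]
  have hsymm : ∀ B ∈ wedge2 m, ((1 / 2 : ℂ) • Ω + B) + flip ((1 / 2 : ℂ) • Ω + B) = Ω := by
    intro B hB
    rw [flip_add, flip_smul, hflip, flip_of_mem_wedge2 hB]
    module
  have hlie : ∀ (x : GroupLieAlgebra 𝓘(ℂ, E) G)
      (B : GroupLieAlgebra 𝓘(ℂ, E) G ⊗[ℂ] GroupLieAlgebra 𝓘(ℂ, E) G),
      ⁅x, (1 / 2 : ℂ) • Ω + B⁆ = ⁅x, B⁆ := by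
    intro x B
    rw [lie_add, lie_smul, hΩ x trivial, smul_zero, zero_add]
  have hinv : ∀ B, IsInvariant (lieAlgebraOf E U) B →
      IsInvariant (lieAlgebraOf E U) ((1 / 2 : ℂ) • Ω + B) := fun B hB x hx => by
    rw [hlie, hB x hx]
  refine ⟨?_, ?_, ?_⟩
  · rintro _ ⟨⟨B, hB, hBu, rfl⟩, hC⟩
    exact (isQuasiPoissonHomogeneous_iff hp (quotientField_mk_of_isInvariant hp hU (hinv B hBu)) hρ
      (hsymm B hB) hΩ hAd).2 hC
  · rintro _ ⟨⟨B, hB, hBu, rfl⟩, -⟩ _ ⟨⟨B', hB', hBu', rfl⟩, -⟩ h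
    -- At the base point the `Ω` and `ρ` terms coincide, leaving `p_* B = p_* B'`, and `p_*` is
    -- injective on `m ⊗ m`.
    have h1 : quotientValue F U ρ ((1 / 2 : ℂ) • Ω + B) 1 =
        quotientValue F U ρ ((1 / 2 : ℂ) • Ω + B') 1 :=
      ((quotientField_mk_of_isInvariant hp hU (hinv B hBu) 1).symm.trans
      (congrFun h (QuotientGroup.mk 1))).trans
      (quotientField_mk_of_isInvariant hp hU (hinv B' hBu') 1)
    rw [quotientValue, quotientValue, sub_left_inj, map_add, map_add, add_right_inj,
      ← sub_eq_zero, ← map_sub] at h1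
    have hr : ∀ {B}, B ∈ wedge2 m → B ∈ LinearMap.range (map2 m.subtype) := fun hB => by
      obtain ⟨B', h, -⟩ := exists_of_mem_wedge2 hB
      exact ⟨B', h⟩
    rw [sub_eq_zero.1 (eq_zero_of_map2_eq_zero hm' (sub_mem (hr hB) (hr hB')) h1)]
  · intro π hπ
    let p := (projMul (E := E) F U 1 1).toLinearMap
    obtain ⟨P, hP⟩ : ∃ P : F ⊗[ℂ] F, (π (QuotientGroup.mk 1) : F ⊗[ℂ] F) = P := ⟨_, rfl⟩
    -- Solving `p_*(Ω/2 + B) - p_* ρ = π(eU)` for `p_* B` gives this tensor. It is skew because `ρ -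
    -- Ω/2` is the skew part of `ρ`.
    have hT : flip (P + map2 p (ρ - (1 / 2 : ℂ) • Ω)) = -(P + map2 p (ρ - (1 / 2 : ℂ) • Ω)) := by
      have h1 : flip P = -P := by
        rw [← hP]
        exact hπ.isBivectorField.skew (QuotientGroup.mk 1)
      have h2 : flip (ρ - (1 / 2 : ℂ) • Ω) = -(ρ - (1 / 2 : ℂ) • Ω) := by
        rw [flip_sub, flip_smul, hflip, eq_sub_of_add_eq' hρ]
        module
      rw [flip_add, flip_map2, h2, h1, map_neg, neg_add]
    obtain ⟨B, hB, hBT⟩ := exists_mem_wedge2_map2_eq (p := p) (projMul_one_surjective hp) hm' hT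
    have h1 : (π (QuotientGroup.mk 1) : F ⊗[ℂ] F) =
        quotientValue F U ρ ((1 / 2 : ℂ) • Ω + B) 1 := by
      refine hP.trans ?_
      rw [quotientValue, map_add]
      refine Eq.trans ?_ (congrArg (fun t => map2 p ((1 / 2 : ℂ) • Ω) + t - map2 p ρ) hBT.symm)
      rw [map_sub]
      abel
    have h2 := eq_quotientValue_of_multiplicative hp hπ h1
    -- For `x ∈ u` the tensor `[x, B]` lies in `m ⊗ m`, since `m` is `u`-stable, and in the kernel
    -- of `p_*`; hence it is zero.
    have hBu : IsInvariant (lieAlgebraOf E U) B := fun x hx => by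
      have h3 := map2_projMul_lie_eq_zero hp (fun u hu => map2_projMul_Ad_eq hp.contMDiff h2 hu) hx
      rw [hlie] at h3
      refine eq_zero_of_map2_eq_zero hm' (lie_mem_range_map2_subtype (hum x hx) ?_) h3
      obtain ⟨B', h, -⟩ := exists_of_mem_wedge2 hB
      exact ⟨B', h⟩
    refine ⟨(1 / 2 : ℂ) • Ω + B, ⟨⟨B, hB, hBu, rfl⟩,
      (isQuasiPoissonHomogeneous_iff hp h2 hρ (hsymm B hB) hΩ hAd).1 hπ⟩, ?_⟩
    funext x
    obtain ⟨g, rfl⟩ := QuotientGroup.mk_surjective x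
    exact (quotientField_mk_of_isInvariant hp hU (hinv B hBu) g).trans (h2 g).symm

end Classification

end QuasiPoisson

end

theorem mainTheorem2
    {E : Type*} [NormedAddCommGroup E] [NormedSpace ℂ E] [FiniteDimensional ℂ E] [CompleteSpace E]
    {G : Type*} [TopologicalSpace G] [ChartedSpace E G] [Group G] [LieGroup 𝓘(ℂ, E) ω G]
    {F : Type*} [NormedAddCommGroup F] [NormedSpace ℂ F]
    (U : Subgroup G) (hU : IsConnected (U : Set G))
    -- the complex structure of `G / U`, for which `G → G / U` is a holomorphic submersion
    [ChartedSpace F (G ⧸ U)] [IsManifold 𝓘(ℂ, F) ω (G ⧸ U)]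
    (hp : Manifold.IsSubmersion 𝓘(ℂ, E) 𝓘(ℂ, F) ω (QuotientGroup.mk : G → G ⧸ U))
    (ρ Ω : GroupLieAlgebra 𝓘(ℂ, E) G ⊗[ℂ] GroupLieAlgebra 𝓘(ℂ, E) G)
    (hρ : ρ + QuasiPoisson.flip ρ = Ω)
    (hΩ : QuasiPoisson.IsInvariant ⊤ Ω)
    (hG : ConnectedSpace G ∨
      ∀ g : G, QuasiPoisson.leftInvariant Ω g = QuasiPoisson.rightInvariant Ω g) :
    (∀ b : GroupLieAlgebra 𝓘(ℂ, E) G ⊗[ℂ] GroupLieAlgebra 𝓘(ℂ, E) G,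
      QuasiPoisson.IsInvariant (QuasiPoisson.lieAlgebraOf E U) b →
      b + QuasiPoisson.flip b = Ω →
      (∀ g : G, QuasiPoisson.quotientField F U ρ b (QuotientGroup.mk g) =
        QuasiPoisson.map2 (QuasiPoisson.projDeriv F U g).toLinearMap
          (QuasiPoisson.fieldOnGroup ρ b g)) ∧
      (QuasiPoisson.IsQuasiPoissonHomogeneous (QuasiPoisson.fieldOnGroup ρ ρ)
          (-QuasiPoisson.CYB ρ) (QuasiPoisson.quotientField F U ρ b) ↔
        QuasiPoisson.CYBVanishesMod (QuasiPoisson.lieAlgebraOf E U) b)) ∧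
    (∀ m : Submodule ℂ (GroupLieAlgebra 𝓘(ℂ, E) G),
      IsCompl (QuasiPoisson.lieAlgebraOf E U) m →
      (∀ x ∈ QuasiPoisson.lieAlgebraOf E U, ∀ y ∈ m, ⁅x, y⁆ ∈ m) →
      Set.BijOn (QuasiPoisson.quotientField F U ρ)
        (QuasiPoisson.MOmega (QuasiPoisson.lieAlgebraOf E U) m Ω)
        (QuasiPoisson.Homsp F U (QuasiPoisson.fieldOnGroup ρ ρ) (-QuasiPoisson.CYB ρ))) := by
  -- Both alternatives for `G` enter only through `Ad(G)`-invariance of `Ω`. It is integrated from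
  -- `g`-invariance when `G` is connected, and read off from `Ω^L = Ω^R` otherwise.
  have hAd : ∀ g : G, QuasiPoisson.map2 (QuasiPoisson.Ad E g).toLinearMap Ω = Ω := by
    rcases hG with hG | hG
    · exact QuasiPoisson.map2_Ad_eq_of_connectedSpace hΩ
    · exact fun g => QuasiPoisson.map2_Ad_eq_of_leftInvariant_eq (hG g)
  refine ⟨fun b hbu hb => ?_, fun m hm hum =>
    QuasiPoisson.bijOn_quotientField hp hU hρ hΩ hAd hm hum⟩
  have hπ := QuasiPoisson.quotientField_mk_of_isInvariant (ρ := ρ) hp hU hbu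
  exact ⟨fun g => (hπ g).trans (QuasiPoisson.map2_projDeriv_fieldOnGroup hp.contMDiff ρ b g).symm,
    QuasiPoisson.isQuasiPoissonHomogeneous_iff hp hπ hρ hb hΩ hAd⟩
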